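/- Let $N\ge 1$, $0<s<1$, $Q=\mathbb{R}^N\times(0,\infty)$, and let $\phi:(0,\infty)\to\mathbb{R}$ be continuous and strictly increasing with $\phi(0^+)=-\infty$ (for instance $\phi(u)=-u^{-n}$ with $n>0$, or $\phi(u)=\log u$). For $0<\sigma<1$ and $\psi\in C_c^\infty(\mathbb{R}^N)$ put $(-\Delta)^{\sigma}\psi(x)=c(N,\sigma)\,\mathrm{p.v.}\!\int_{\mathbb{R}^N}\frac{\psi(x)-\psi(y)}{|x-y|^{N+2\sigma}}\,dy$, where $c(N,\sigma)>0$ is the usual normalizing constant. Let $\dot H^s(\mathbb{R}^N)$ be the completion of $C_c^\infty(\mathbb{R}^N)$ in the norm $\|(-\Delta)^{s/2}\psi\|_{L^2}$, realized by functions modulo additive constants, and extend $(-\Delta)^{s/2}$ to $\dot H^s(\mathbb{R}^N)\to L^2(\mathbb{R}^N)$ by continuity. For a function $\Phi$, say that $u$ satisfies $\partial_t u+(-\Delta)^s\Phi(u)=0$ in the weak energy sense if $\Phi(u)\in L^2_{\rm loc}((0,\infty);\dot H^s(\mathbb{R}^N))$ and $$\int_0^\infty\!\!\int_{\mathbb{R}^N}u\,\partial_t\zeta\,dx\,dt-\int_0^\infty\!\!\int_{\mathbb{R}^N}(-\Delta)^{s/2}\Phi(u)\,(-\Delta)^{s/2}\zeta\,dx\,dt=0\qquad\text{for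 all }\zeta\in C_c^\infty(Q).$$ A strong solution of $\partial_t u+(-\Delta)^s\phi(u)=0$ is a nonnegative measurable function $u$ on $Q$ with $u\in C((0,\infty);L^1(\mathbb{R}^N))$ such that $\phi(u)$ is finite a.e. (that is, $u>0$ a.e.), $u$ satisfies the equation in the weak energy sense, and the distributional derivative $\partial_t u$ is a locally integrable function on $Q$ with $\partial_t u(\cdot,t)\in L^1(\mathbb{R}^N)$ for every $t>0$. It corresponds to the initial datum $u_0$ if $u(t)\to u_0$ in $L^1(\mathbb{R}^N)$ as $t\to0^+$. Let $u_0\in L^1(\mathbb{R}^N)$, $u_0\ge0$, and let $u$ be a strong solution of $\partial_t u+(-\Delta)^s\phi(u)=0$ corresponding to the initial datum $u_0$. Let $\varepsilon>0$ and let $u_\varepsilon$ be a solution of the same equation with initial datum $u_0+\varepsilon$ in the following sense: $u_\varepsilon=v_\varepsilon+\varepsilon$, where $v_\varepsilon\ge 0$, $v_\varepsilon\in C([0,\infty);L^1(\mathbb{R}^N))$, $v_\varepsilon(0)=u_0$ a.e., and $v_\varepsilon$ satisfies $\partial_t v+(-\Delta)^s\phi_\varepsilon(v)=0$ in the weak energy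 sense with $\phi_\varepsilon(v)=\phi(v+\varepsilon)-\phi(\varepsilon)$. Then $$u\le u_\varepsilon\qquad\text{a.e. in }\mathbb{R}^N\times(0,\infty).$$ -/

import Mathlib

open MeasureTheory Filter Set
open scoped Topology ContDiff

noncomputable section

/-- Euclidean space `ℝ^N`. -/
abbrev RN (N : ℕ) : Type := EuclideanSpace ℝ (Fin N)

/-- The open space-time region `(0,∞) × ℝ^N` (time is the first coordinate). -/
def spaceTime (N : ℕ) : Set (ℝ × RN N) := Ioi (0 : ℝ) ×ˢ univ

/-- The usual normalizing constant
`c(N,σ) = 4^σ Γ(N/2+σ) / (π^{N/2} |Γ(-σ)|)` of `(-Δ)^σ`, `0 < σ < 1`, written with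
`|Γ(-σ)| = Γ(1-σ)/σ`. -/
def fracLapConst (N : ℕ) (σ : ℝ) : ℝ :=
  σ * (4 : ℝ) ^ σ * Real.Gamma ((N : ℝ) / 2 + σ) /
    (Real.pi ^ ((N : ℝ) / 2) * Real.Gamma (1 - σ))

/-- The fractional Laplacian `(-Δ)^σ v (x) = c(N,σ) p.v. ∫ (v(x) - v(y)) / |x-y|^{N+2σ} dy`.
It is applied to smooth compactly supported `v` only. -/
def fracLap {N : ℕ} (σ : ℝ) (v : RN N → ℝ) (x : RN N) : ℝ :=
  fracLapConst N σ *
    limUnder (𝓝[>] (0 : ℝ)) (fun r : ℝ =>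
      ∫ y in {y : RN N | r < ‖x - y‖}, (v x - v y) / ‖x - y‖ ^ ((N : ℝ) + 2 * σ))

/-- `f ∈ Ḣ^s(ℝ^N)` and `(-Δ)^{s/2} f = g ∈ L²(ℝ^N)`. Here `Ḣ^s` is the completion of
`C_c^∞(ℝ^N)` for the norm `‖(-Δ)^{s/2} ψ‖_{L²}`, realized by functions modulo additive constants:
there are `ψ_j ∈ C_c^∞` and constants `c_j` with `ψ_j - c_j → f` in `L²_loc` and
`(-Δ)^{s/2} ψ_j → g` in `L²`. -/
def HasHalfFracLap {N : ℕ} (s : ℝ) (f g : RN N → ℝ) : Prop :=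
  MemLp g 2 volume ∧
  ∃ (ψ : ℕ → RN N → ℝ) (c : ℕ → ℝ),
    (∀ j, ContDiff ℝ ∞ (ψ j) ∧ HasCompactSupport (ψ j)) ∧
    (∀ R : ℝ, Tendsto
      (fun j => eLpNorm (fun x => ψ j x - c j - f x) 2 (volume.restrict (Metric.ball 0 R)))
      atTop (𝓝 0)) ∧
    Tendsto (fun j => eLpNorm (fun x => fracLap (s / 2) (ψ j) x - g x) 2 volume) atTop (𝓝 0)

/-- `ζ ∈ C_c^∞((0,∞) × ℝ^N)`. -/
structure IsTestFunction {N : ℕ} (ζ : ℝ × RN N → ℝ) : Prop where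
  smooth : ContDiff ℝ ∞ ζ
  compactSupport : HasCompactSupport ζ
  support_subset : tsupport ζ ⊆ spaceTime N

/-- `u ∈ C(I; L¹(ℝ^N))`. -/
def ContinuousInL1 {N : ℕ} (I : Set ℝ) (u : ℝ → RN N → ℝ) : Prop :=
  (∀ t ∈ I, Integrable (u t) volume) ∧
  ∀ t₀ ∈ I, Tendsto (fun t => eLpNorm (u t - u t₀) 1 volume) (𝓝[I] t₀) (𝓝 0)

/-- `Φ(u) ∈ L²_loc((0,∞); Ḣ^s(ℝ^N))`, and `u` satisfies `∂_t u + (-Δ)^s Φ(u) = 0` in the weak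
energy sense: for all `ζ ∈ C_c^∞((0,∞) × ℝ^N)`,
`∫∫ u ∂_t ζ dx dt - ∫∫ (-Δ)^{s/2} Φ(u) (-Δ)^{s/2} ζ dx dt = 0`.
The function `g` is `(-Δ)^{s/2} Φ(u)`. -/
def SatisfiesWeakForm {N : ℕ} (s : ℝ) (Φ : ℝ → ℝ) (u : ℝ → RN N → ℝ) : Prop :=
  ∃ g : ℝ → RN N → ℝ,
    (∀ᵐ t ∂(volume.restrict (Ioi (0 : ℝ))), HasHalfFracLap s (fun x => Φ (u t x)) (g t)) ∧
    (∀ a b : ℝ, 0 < a → a < b →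
      MemLp (Function.uncurry g) 2 (volume.restrict (Ioo a b ×ˢ (univ : Set (RN N))))) ∧
    ∀ ζ : ℝ × RN N → ℝ, IsTestFunction ζ →
      (∫ t in Ioi (0 : ℝ), ∫ x, u t x * deriv (fun τ => ζ (τ, x)) t) -
        (∫ t in Ioi (0 : ℝ), ∫ x, g t x * fracLap (s / 2) (fun y => ζ (t, y)) x) = 0

/-- The admissible nonlinearities: defined, increasing and continuous on `(0,∞)`, with
`φ(0+) = -∞`; the values of `φ` on `(-∞,0]` are irrelevant. -/
structure IsSingularNonlinearity (φ : ℝ → ℝ) : Prop where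
  strictMono : StrictMonoOn φ (Ioi 0)
  continuous : ContinuousOn φ (Ioi 0)
  singular : Tendsto φ (𝓝[>] 0) atBot

/-- Weak energy solutions of `∂_t u + (-Δ)^s φ(u) = 0` in `(0,∞) × ℝ^N`. -/
structure IsWeakEnergySolution {N : ℕ} (s : ℝ) (φ : ℝ → ℝ) (u : ℝ → RN N → ℝ) : Prop where
  measurable : AEStronglyMeasurable (Function.uncurry u) (volume.restrict (spaceTime N))
  nonneg : ∀ t : ℝ, 0 < t → ∀ᵐ x, 0 ≤ u t x
  continuousInL1 : ContinuousInL1 (Ioi 0) u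
  /-- `φ(u)` is finite almost everywhere, where `φ(0) = -∞`. -/
  finite : ∀ᵐ t ∂(volume.restrict (Ioi (0 : ℝ))), ∀ᵐ x, 0 < u t x
  weakForm : SatisfiesWeakForm s φ u

/-- Strong solutions: weak energy solutions whose distributional derivative `∂_t u` is a function
`w` with `w(t,·) ∈ L¹(ℝ^N)` for every `t > 0`. -/
structure IsStrongSolution {N : ℕ} (s : ℝ) (φ : ℝ → ℝ) (u : ℝ → RN N → ℝ) : Prop
    extends IsWeakEnergySolution s φ u where
  timeDeriv : ∃ w : ℝ → RN N → ℝ,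
    LocallyIntegrableOn (Function.uncurry w) (spaceTime N) volume ∧
    (∀ t : ℝ, 0 < t → Integrable (w t) volume) ∧
    ∀ ζ : ℝ × RN N → ℝ, IsTestFunction ζ →
      (∫ t in Ioi (0 : ℝ), ∫ x, u t x * deriv (fun τ => ζ (τ, x)) t) =
        -(∫ t in Ioi (0 : ℝ), ∫ x, w t x * ζ (t, x))

/-- `u` takes the initial datum `u₀`: `u(t,·) → u₀` in `L¹(ℝ^N)` as `t → 0+`. -/
def HasInitialDatum {N : ℕ} (u : ℝ → RN N → ℝ) (u₀ : RN N → ℝ) : Prop :=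
  Tendsto (fun t => eLpNorm (u t - u₀) 1 volume) (𝓝[>] 0) (𝓝 0)

/-- The shifted nonlinearity `φ_ε(v) = φ(v+ε) - φ(ε)`. -/
def shiftedNonlinearity (φ : ℝ → ℝ) (ε : ℝ) (r : ℝ) : ℝ := φ (r + ε) - φ ε

/-- Nonnegative weak solutions `v ∈ C([0,∞); L¹)` of the Cauchy problem
`∂_t v + (-Δ)^s φ_ε(v) = 0`, `v(0) = u₀`. -/
structure IsShiftedWeakSolution {N : ℕ} (s : ℝ) (φ : ℝ → ℝ) (ε : ℝ) (u₀ : RN N → ℝ)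
    (v : ℝ → RN N → ℝ) : Prop where
  measurable : AEStronglyMeasurable (Function.uncurry v) (volume.restrict (spaceTime N))
  nonneg : ∀ t : ℝ, 0 ≤ t → ∀ᵐ x, 0 ≤ v t x
  continuousInL1 : ContinuousInL1 (Ici 0) v
  initial : v 0 =ᵐ[volume] u₀
  weakForm : SatisfiesWeakForm s (shiftedNonlinearity φ ε) v

/-- `uε` is the approximate solution, i.e. the solution of `∂_t uε + (-Δ)^s φ(uε) = 0`,
`uε(0) = u₀ + ε`: by definition `uε = v + ε` with `v` as above. -/
def IsApproximateSolution {N : ℕ} (s : ℝ) (φ : ℝ → ℝ) (ε : ℝ) (u₀ : RN N → ℝ)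
    (uε : ℝ → RN N → ℝ) : Prop :=
  ∃ v : ℝ → RN N → ℝ, IsShiftedWeakSolution s φ ε u₀ v ∧ ∀ t x, uε t x = v t x + ε

end

noncomputable section

/-! ### Square-integrable functions -/

section SquareIntegrable

variable {X : Type*} [MeasurableSpace X] {μ : Measure X}

/-! Formally, subtract the two equations and test with p(w), where w = φ(u) - φ(uε) and p is a
nondecreasing approximation of the indicator of (0,∞). The quadratic form of (-Δ)^s is nonnegative
on the pair (w, p(w)), and φ is strictly increasing, so ∫ (u - uε)₊ dx cannot grow in time. Near t =
0 this integral is at most ‖u(t) - u₀‖₁ + ‖v(t) - u₀‖₁, which tends to 0; hence it vanishes. The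
shift ε tames the singularity: u > uε forces u > ε and |u - v| > ε, so only values of φ on [ε,∞)
matter and p(w) is integrable although the constant ε is not.

Three points need work. The sign of the form is visible on differences: (w(x) - w(y))(p(w(x)) -
p(w(y))) ≥ 0. By Fourier transform, ⟨(-Δ)^{s/2}ψ, (-Δ)^{s/2}η⟩ is a positive multiple κ of the
Gagliardo form (`exists_integral_fracLap_mul_eq`); this passes to the completion by
`HasHalfFracLap.eLpNorm_gagliardoDiff_le` and `HasHalfFracLap.integral_mul_fracLap`. Next, p(w) is
not smooth, so test functions are enlarged to all bounded integrable functions of finite energy by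
cutoff and mollification (`energy_induction`).

Finally, the flows are only continuous in time with values in L¹, and their energies only square
integrable in time, so times are doubled as in Kružkov's method. At frozen times t, τ the function
p(φ(u(t)) - φ(uε(τ))) tests backward increments of length h of both flows. Convexity of the
primitives of p turns this into an inequality for difference quotients in t and in τ
(`doubling_increment_le`). The error involves means of ‖g(r) - g(t)‖₂ over r in (t-h,t), and
vanishes as h → 0 by continuity of translations in L². Letting h → 0 and then p tend to the
indicator gives (∂ₜ + ∂_τ) ∫ (u(t) - uε(τ))₊ ≤ 0 in the sense of distributions
(`integral_positivePart_mul_fderiv_nonneg`), hence monotonicity on the diagonal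
(`diagonal_le_of_integral_nonneg`). -/

theorem abs_integral_mul_le_eLpNorm_two {f g : X → ℝ} (hf : MemLp f 2 μ) (hg : MemLp g 2 μ) :
    |∫ x, f x * g x ∂μ| ≤ (eLpNorm f 2 μ).toReal * (eLpNorm g 2 μ).toReal := by
  have h := abs_real_inner_le_norm (hf.toLp f) (hg.toLp g)
  rw [L2.inner_def, Lp.norm_toLp, Lp.norm_toLp] at h
  refine le_trans (le_of_eq ?_) h
  congr 1
  refine integral_congr_ae ?_
  filter_upwards [hf.coeFn_toLp, hg.coeFn_toLp] with x h1 h2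
  simp [h1, h2, mul_comm]

theorem toReal_eLpNorm_two_sq {f : X → ℝ} (hf : MemLp f 2 μ) :
    (eLpNorm f 2 μ).toReal ^ 2 = ∫ x, f x ^ 2 ∂μ := by
  have h := real_inner_self_eq_norm_sq (hf.toLp f)
  rw [Lp.norm_toLp, L2.inner_def] at h
  rw [← h]
  refine integral_congr_ae ?_
  filter_upwards [hf.coeFn_toLp] with x h1
  simp [h1, pow_two]

theorem eLpNorm_two_sq_eq_lintegral (f : X → ℝ) :
    eLpNorm f 2 μ ^ 2 = ∫⁻ x, ENNReal.ofReal (f x ^ 2) ∂μ := by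
  rw [eLpNorm_eq_lintegral_rpow_enorm_toReal (by norm_num) (by norm_num), ← ENNReal.rpow_natCast,
    ← ENNReal.rpow_mul]
  norm_num
  refine lintegral_congr fun x => ?_
  rw [← sq_abs, ENNReal.ofReal_pow (abs_nonneg _), ← Real.norm_eq_abs, ofReal_norm]

theorem tendsto_integral_mul_of_tendsto_eLpNorm {ι : Type*} {l : Filter ι} {f : ι → X → ℝ}
    {f₀ g : X → ℝ} (hf : ∀ i, MemLp (f i) 2 μ) (hf₀ : MemLp f₀ 2 μ) (hg : MemLp g 2 μ)
    (h : Tendsto (fun i => eLpNorm (fun x => f i x - f₀ x) 2 μ) l (𝓝 0)) :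
    Tendsto (fun i => ∫ x, f i x * g x ∂μ) l (𝓝 (∫ x, f₀ x * g x ∂μ)) := by
  rw [tendsto_iff_norm_sub_tendsto_zero]
  have h' := ((ENNReal.tendsto_toReal ENNReal.zero_ne_top).comp h).mul_const
    (eLpNorm g 2 μ).toReal
  simp only [ENNReal.toReal_zero, zero_mul, Function.comp_def] at h'
  refine squeeze_zero (fun _ => norm_nonneg _) (fun i => ?_) h'
  have e : ∫ x, f i x * g x ∂μ - ∫ x, f₀ x * g x ∂μ = ∫ x, (f i x - f₀ x) * g x ∂μ := by
    simp_rw [sub_mul]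
    exact (integral_sub ((hf i).integrable_mul hg) (hf₀.integrable_mul hg)).symm
  rw [e]
  exact abs_integral_mul_le_eLpNorm_two ((hf i).sub hf₀) hg

theorem tendsto_toReal_eLpNorm_of_tendsto {ι : Type*} {l : Filter ι} {f : ι → X → ℝ}
    {f₀ : X → ℝ} (hf : ∀ i, MemLp (f i) 2 μ) (hf₀ : MemLp f₀ 2 μ)
    (h : Tendsto (fun i => eLpNorm (fun x => f i x - f₀ x) 2 μ) l (𝓝 0)) :
    Tendsto (fun i => (eLpNorm (f i) 2 μ).toReal) l (𝓝 (eLpNorm f₀ 2 μ).toReal) := by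
  rw [tendsto_iff_norm_sub_tendsto_zero]
  have h' := (ENNReal.tendsto_toReal ENNReal.zero_ne_top).comp h
  simp only [ENNReal.toReal_zero, Function.comp_def] at h'
  refine squeeze_zero (fun _ => norm_nonneg _) (fun i => ?_) h'
  have := norm_sub_norm_le ((hf i).toLp (f i)) (hf₀.toLp f₀)
  have h2 := norm_sub_norm_le (hf₀.toLp f₀) ((hf i).toLp (f i))
  rw [norm_sub_rev] at h2
  rw [← MemLp.toLp_sub, Lp.norm_toLp, Lp.norm_toLp, Lp.norm_toLp] at this h2
  rw [Real.norm_eq_abs, abs_le]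
  constructor
  · have : (f i - f₀) = fun x => f i x - f₀ x := rfl
    rw [this] at h2; linarith
  · exact this

theorem MeasureTheory.Integrable.memLp_two_of_bound {f : X → ℝ} (hf : Integrable f μ) {B : ℝ}
    (hB : ∀ᵐ x ∂μ, ‖f x‖ ≤ B) : MemLp f 2 μ := by
  rw [memLp_two_iff_integrable_sq hf.aestronglyMeasurable]
  simp_rw [pow_two]
  exact hf.bdd_mul hf.aestronglyMeasurable hB

/-- Jensen's inequality, for the two averages of the proof: mollification in space and the mean over
a backward time interval. -/
theorem ofReal_sq_integral_le [IsProbabilityMeasure μ] {f : X → ℝ} (hf : AEStronglyMeasurable f μ) :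
    ENNReal.ofReal ((∫ x, f x ∂μ) ^ 2) ≤ ∫⁻ x, ENNReal.ofReal (f x ^ 2) ∂μ := by
  rw [← eLpNorm_two_sq_eq_lintegral, ← sq_abs, ENNReal.ofReal_pow (abs_nonneg _)]
  gcongr
  refine le_trans ?_ (eLpNorm_le_eLpNorm_of_exponent_le (p := 1) (by norm_num) hf)
  rw [eLpNorm_one_eq_lintegral_enorm, ← Real.norm_eq_abs, ofReal_norm]
  exact enorm_integral_le_lintegral_enorm _

end SquareIntegrable

/-- Translations act continuously on L². This drives both the mollification of finite-energy
functions and the vanishing of the time-doubling error. -/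
theorem tendsto_eLpNorm_translate_sub {X : Type*} [NormedAddCommGroup X] [MeasurableSpace X]
    [BorelSpace X] {μ : Measure X} [μ.IsAddRightInvariant] [IsLocallyFiniteMeasure μ]
    [μ.InnerRegularCompactLTTop] {G : X → ℝ} (hG : MemLp G 2 μ) :
    Tendsto (fun z => eLpNorm (fun x => G (x + z) - G x) 2 μ) (𝓝 0) (𝓝 0) := by
  let T : C(X, C(X, X)) := (ContinuousMap.mk (fun a : X × X => a.2 + a.1) (by fun_prop)).curry
  have hT : ∀ z, MeasurePreserving (T z) μ μ := fun z => measurePreserving_add_right μ z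
  have h := Continuous.compMeasurePreservingLp (f := fun _ : X => hG.toLp G) (g := T)
    continuous_const T.continuous hT (by norm_num)
  have h2 := ((h.tendsto 0).sub_const (hG.toLp G)).enorm
  have e0 : Lp.compMeasurePreserving (T 0) (hT 0) (hG.toLp G) = hG.toLp G := by
    refine Lp.ext ?_
    filter_upwards [Lp.coeFn_compMeasurePreserving (hG.toLp G) (hT 0)] with x hx
    rw [hx]; simp [T]
  rw [e0, sub_self, enorm_zero] at h2
  refine h2.congr fun z => ?_
  rw [Lp.enorm_def]
  refine eLpNorm_congr_ae ?_
  filter_upwards [Lp.coeFn_compMeasurePreserving (hG.toLp G) (hT z),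
    Lp.coeFn_sub (Lp.compMeasurePreserving (T z) (hT z) (hG.toLp G)) (hG.toLp G), hG.coeFn_toLp,
    (hT z).quasiMeasurePreserving.ae hG.coeFn_toLp] with x h1 h2 h3 h4
  rw [h2, Pi.sub_apply, h1, h3, Function.comp_apply, h4]
  simp [T]

end

noncomputable section

/-! ### The kernels `‖h‖ ^ (-(N + b))` and difference quotients -/

section Kernel

variable {N : ℕ}

/-- In polar coordinates the integrand is y^(a-1-b) near 0 and y^(-1-b) at infinity. The exponent a
is the order at which the numerator vanishes: 1 for the half Laplacian, 2 for the energy. -/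
theorem integrable_min_one_norm_rpow_mul (hN : 1 ≤ N) {a b : ℝ} (hb : 0 < b) (hab : b < a) :
    Integrable (fun h : RN N => min 1 (‖h‖ ^ a) * ‖h‖ ^ (-((N : ℝ) + b))) := by
  have : Nonempty (Fin N) := ⟨⟨0, hN⟩⟩
  rw [integrable_fun_norm_addHaar volume (f := fun y : ℝ => min 1 (y ^ a) * y ^ (-((N : ℝ) + b)))]
  rw [← Ioc_union_Ioi_eq_Ioi (zero_le_one (α := ℝ))]
  have key : ∀ y : ℝ, 0 < y → y ^ (Module.finrank ℝ (RN N) - 1) *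
      (min 1 (y ^ a) * y ^ (-((N : ℝ) + b))) = min 1 (y ^ a) * y ^ (-1 - b) := by
    intro y hy
    rw [finrank_euclideanSpace_fin, ← Real.rpow_natCast, mul_left_comm, ← Real.rpow_add hy,
      Nat.cast_sub hN]
    congr 2; push_cast; ring
  refine IntegrableOn.union ?_ ?_
  · have : IntegrableOn (fun y : ℝ => y ^ (a - 1 - b)) (Ioc 0 1) := by
      rw [← intervalIntegrable_iff_integrableOn_Ioc_of_le zero_le_one]
      exact intervalIntegral.intervalIntegrable_rpow' (by linarith)
    refine this.congr_fun (fun y hy => ?_) measurableSet_Ioc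
    simp only [smul_eq_mul]
    rw [key y hy.1, min_eq_right (Real.rpow_le_one hy.1.le hy.2 (by linarith)),
      ← Real.rpow_add hy.1]
    congr 1; ring
  · have : IntegrableOn (fun y : ℝ => y ^ (-1 - b)) (Ioi 1) :=
      integrableOn_Ioi_rpow_of_lt (by linarith) one_pos
    refine this.congr_fun (fun y hy => ?_) measurableSet_Ioi
    have hy' : (1 : ℝ) < y := hy
    simp only [smul_eq_mul]
    rw [key y (by linarith), min_eq_left (Real.one_le_rpow hy'.le (by linarith)), one_mul]

/-- The weighted difference of `f` whose `L²` norm is the Gagliardo seminorm of order `s`. -/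
def gagliardoDiff (s : ℝ) (f : RN N → ℝ) (p : RN N × RN N) : ℝ :=
  (f p.1 - f (p.1 - p.2)) * ‖p.2‖ ^ (-((N : ℝ) / 2 + s))

theorem aestronglyMeasurable_gagliardoDiff (s : ℝ) {f : RN N → ℝ}
    (hf : AEStronglyMeasurable f volume) :
    AEStronglyMeasurable (gagliardoDiff s f) (volume : Measure (RN N × RN N)) := by
  refine AEStronglyMeasurable.mul (AEStronglyMeasurable.sub ?_ ?_) ?_
  · exact hf.comp_fst
  · exact hf.comp_quasiMeasurePreserving
      (quasiMeasurePreserving_sub_of_right_invariant volume volume)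
  · exact Measurable.aestronglyMeasurable (by fun_prop)

/-- Short steps are controlled by the Lipschitz constant, long ones by twice the supremum. The
difference lives on the support and its translate, a set of measure at most twice that of the
support whatever h is; this converts the pointwise bound into the integral ones. -/
theorem exists_difference_bounds {ψ : RN N → ℝ} (hψ : ContDiff ℝ ∞ ψ) (hc : HasCompactSupport ψ) :
    ∃ C : ℝ, 0 ≤ C ∧ (∀ x h, |ψ x - ψ (x - h)| ≤ C * min 1 ‖h‖) ∧
      (∀ h, ∫⁻ x, ENNReal.ofReal |ψ x - ψ (x - h)| ≤ ENNReal.ofReal (C * min 1 ‖h‖)) ∧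
      (∀ h, ∫⁻ x, ENNReal.ofReal ((ψ x - ψ (x - h)) ^ 2) ≤
        ENNReal.ofReal (C * min 1 (‖h‖ ^ (2 : ℝ)))) := by
  obtain ⟨K, hK⟩ := (hψ.of_le (m := 1) (by exact_mod_cast le_top)).lipschitzWith_of_hasCompactSupport hc one_ne_zero
  obtain ⟨M, hM⟩ := hc.exists_bound_of_continuous hψ.continuous
  have hM0 : 0 ≤ M := (norm_nonneg _).trans (hM 0)
  set A : ℝ := K + 2 * M with hA
  have hA0 : 0 ≤ A := by positivity
  have hb : ∀ x h, |ψ x - ψ (x - h)| ≤ A * min 1 ‖h‖ := by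
    intro x h
    have h1 : |ψ x - ψ (x - h)| ≤ K * ‖h‖ := by
      have := hK.dist_le_mul x (x - h)
      simpa [Real.dist_eq, dist_eq_norm] using this
    have h2 : |ψ x - ψ (x - h)| ≤ 2 * M := by
      have h3 := abs_sub (ψ x) (ψ (x - h))
      have := hM x; have := hM (x - h)
      simp only [Real.norm_eq_abs] at *
      linarith
    rcases le_total 1 ‖h‖ with h3 | h3
    · rw [min_eq_left h3]; have := K.coe_nonneg; linarith
    · rw [min_eq_right h3]; nlinarith [norm_nonneg h]
  set S := tsupport ψ with hS
  have hSc : IsCompact S := hc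
  have hSfin : volume S ≠ ⊤ := hSc.measure_lt_top.ne
  set v := (volume S).toReal
  have hsup : ∀ h x, x ∉ S ∪ (fun y => y - h) ⁻¹' S → ψ x - ψ (x - h) = 0 := by
    intro h x hx
    simp only [mem_union, mem_preimage, not_or] at hx
    rw [image_eq_zero_of_notMem_tsupport hx.1, image_eq_zero_of_notMem_tsupport hx.2, sub_zero]
  have hms : ∀ h : RN N, volume (S ∪ (fun y => y - h) ⁻¹' S) ≤ ENNReal.ofReal (2 * v) := by
    intro h
    refine (measure_union_le _ _).trans ?_
    rw [(measurePreserving_sub_right volume h).measure_preimage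
      hSc.measurableSet.nullMeasurableSet, ENNReal.ofReal_mul zero_le_two,
      ENNReal.ofReal_toReal hSfin, ENNReal.ofReal_ofNat, two_mul]
  have gen : ∀ (F : RN N → ℝ) (h : RN N) (c : ℝ), 0 ≤ c → (∀ x, F x ≤ c) →
      (∀ x, x ∉ S ∪ (fun y => y - h) ⁻¹' S → F x = 0) →
      ∫⁻ x, ENNReal.ofReal (F x) ≤ ENNReal.ofReal (2 * v * c) := by
    intro F h c hc0 hF h0
    calc ∫⁻ x, ENNReal.ofReal (F x)
        ≤ ∫⁻ x, (S ∪ (fun y => y - h) ⁻¹' S).indicator (fun _ => ENNReal.ofReal c) x := by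
          refine lintegral_mono fun x => ?_
          by_cases hx : x ∈ S ∪ (fun y => y - h) ⁻¹' S
          · rw [indicator_of_mem hx]; exact ENNReal.ofReal_le_ofReal (hF x)
          · rw [h0 x hx]; simp
      _ ≤ ENNReal.ofReal c * volume (S ∪ (fun y => y - h) ⁻¹' S) := lintegral_indicator_const_le _ _
      _ ≤ ENNReal.ofReal c * ENNReal.ofReal (2 * v) := by gcongr; exact hms h
      _ = _ := by rw [← ENNReal.ofReal_mul hc0, mul_comm]
  have hv0 : 0 ≤ v := ENNReal.toReal_nonneg
  have hmin : ∀ h : RN N, 0 ≤ min 1 ‖h‖ := fun h => le_min zero_le_one (norm_nonneg h)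
  refine ⟨A + 2 * v * A + 2 * v * A ^ 2, by positivity, fun x h => (hb x h).trans ?_, fun h => ?_,
    fun h => ?_⟩
  · gcongr
    have : 0 ≤ v * A := by positivity
    have : 0 ≤ v * A ^ 2 := by positivity
    linarith
  · refine (gen (fun x => |ψ x - ψ (x - h)|) h (A * min 1 ‖h‖) (mul_nonneg hA0 (hmin h))
      (fun x => hb x h) fun x hx => by simp [hsup h x hx]).trans ?_
    refine ENNReal.ofReal_le_ofReal ?_
    rw [← mul_assoc]
    gcongr
    have : 0 ≤ v * A ^ 2 := by positivity
    linarith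
  · have e : min 1 (‖h‖ ^ (2 : ℝ)) = (min 1 ‖h‖) ^ 2 := by
      rw [Real.rpow_two]
      rcases le_total 1 ‖h‖ with h3 | h3
      · rw [min_eq_left h3, min_eq_left (one_le_pow₀ h3)]; norm_num
      · rw [min_eq_right h3, min_eq_right (pow_le_one₀ (norm_nonneg _) h3)]
    refine (gen (fun x => (ψ x - ψ (x - h)) ^ 2) h ((A * min 1 ‖h‖) ^ 2) (by positivity)
      (fun x => by rw [← sq_abs]; exact pow_le_pow_left₀ (abs_nonneg _) (hb x h) 2)
      fun x hx => by simp [hsup h x hx]).trans ?_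
    refine ENNReal.ofReal_le_ofReal ?_
    rw [e, mul_pow, ← mul_assoc]
    gcongr
    have : 0 ≤ v * A := by positivity
    linarith

theorem norm_difference_mul_le {a C : ℝ} {h : RN N} (ha : |a| ≤ C * min 1 ‖h‖) (b : ℝ) :
    ‖a * ‖h‖ ^ b‖ ≤ C * (min 1 (‖h‖ ^ (1 : ℝ)) * ‖h‖ ^ b) := by
  rw [norm_mul, Real.norm_eq_abs, Real.norm_of_nonneg (Real.rpow_nonneg (norm_nonneg h) b),
    ← mul_assoc, Real.rpow_one]
  gcongr

theorem memLp_gagliardoDiff (hN : 1 ≤ N) {s : ℝ} (hs0 : 0 < s) (hs1 : s < 1) {ψ : RN N → ℝ}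
    (hψ : ContDiff ℝ ∞ ψ) (hc : HasCompactSupport ψ) :
    MemLp (gagliardoDiff s ψ) 2 (volume : Measure (RN N × RN N)) := by
  obtain ⟨C, hC, -, -, h2⟩ := exists_difference_bounds hψ hc
  have hm := aestronglyMeasurable_gagliardoDiff s hψ.continuous.aestronglyMeasurable
  refine ⟨hm, ?_⟩
  have hsq : eLpNorm (gagliardoDiff s ψ) 2 volume ^ 2 < ⊤ := by
    rw [eLpNorm_two_sq_eq_lintegral]
    rw [show (volume : Measure (RN N × RN N)) = volume.prod volume from rfl,
      lintegral_prod_symm _ ((hm.aemeasurable.pow_const 2).ennreal_ofReal)]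
    calc ∫⁻ h, ∫⁻ x, ENNReal.ofReal (gagliardoDiff s ψ (x, h) ^ 2)
        ≤ ∫⁻ h : RN N, ENNReal.ofReal (C * (min 1 (‖h‖ ^ (2 : ℝ)) *
            ‖h‖ ^ (-((N : ℝ) + 2 * s)))) := by
          refine lintegral_mono fun h => ?_
          have e : ∀ x, ENNReal.ofReal (gagliardoDiff s ψ (x, h) ^ 2) =
              ENNReal.ofReal ((ψ x - ψ (x - h)) ^ 2) *
                ENNReal.ofReal (‖h‖ ^ (-((N : ℝ) + 2 * s))) := by
            intro x
            rw [← ENNReal.ofReal_mul (sq_nonneg _), gagliardoDiff, mul_pow]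
            congr 2
            rw [← Real.rpow_natCast, ← Real.rpow_mul (norm_nonneg _)]
            congr 1; push_cast; ring
          simp_rw [e]
          rw [lintegral_mul_const' _ _ ENNReal.ofReal_ne_top, ← mul_assoc,
            ENNReal.ofReal_mul (by positivity)]
          gcongr
          exact h2 h
      _ < ⊤ := ((integrable_min_one_norm_rpow_mul hN (by positivity)
          (by linarith)).const_mul C).lintegral_lt_top
  by_contra hne
  rw [not_lt, top_le_iff] at hne
  rw [hne] at hsq
  simp at hsq

theorem integrable_prod_difference (hN : 1 ≤ N) {s : ℝ} (hs0 : 0 < s) (hs1 : s < 1) {ψ : RN N → ℝ}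
    (hψ : ContDiff ℝ ∞ ψ) (hc : HasCompactSupport ψ) :
    Integrable (fun p : RN N × RN N => (ψ p.1 - ψ (p.1 - p.2)) * ‖p.2‖ ^ (-((N : ℝ) + s)))
      (volume.prod volume) := by
  obtain ⟨C, hC, -, h1, -⟩ := exists_difference_bounds hψ hc
  have hcont := hψ.continuous
  have hm : AEStronglyMeasurable
      (fun p : RN N × RN N => (ψ p.1 - ψ (p.1 - p.2)) * ‖p.2‖ ^ (-((N : ℝ) + s)))
      (volume.prod volume) :=
    AEStronglyMeasurable.mul (Continuous.aestronglyMeasurable (by fun_prop))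
      (Measurable.aestronglyMeasurable (by fun_prop))
  refine ⟨hm, ?_⟩
  rw [HasFiniteIntegral, lintegral_prod_symm _ hm.enorm]
  calc ∫⁻ h, ∫⁻ x, ‖(ψ x - ψ (x - h)) * ‖h‖ ^ (-((N : ℝ) + s))‖ₑ
      ≤ ∫⁻ h : RN N, ENNReal.ofReal (C * (min 1 (‖h‖ ^ (1 : ℝ)) * ‖h‖ ^ (-((N : ℝ) + s)))) := by
        refine lintegral_mono fun h => ?_
        have e : ∀ x, ‖(ψ x - ψ (x - h)) * ‖h‖ ^ (-((N : ℝ) + s))‖ₑ =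
            ENNReal.ofReal |ψ x - ψ (x - h)| * ENNReal.ofReal (‖h‖ ^ (-((N : ℝ) + s))) := by
          intro x
          rw [← ENNReal.ofReal_mul (abs_nonneg _), ← ofReal_norm, norm_mul, Real.norm_eq_abs,
            Real.norm_of_nonneg (by positivity : (0 : ℝ) ≤ ‖h‖ ^ (-((N : ℝ) + s)))]
        simp_rw [e]
        rw [lintegral_mul_const' _ _ ENNReal.ofReal_ne_top, ← mul_assoc,
          ENNReal.ofReal_mul (by positivity), Real.rpow_one]
        gcongr
        exact h1 h
    _ < ⊤ := ((integrable_min_one_norm_rpow_mul hN (by positivity)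
        (by linarith)).const_mul C).lintegral_lt_top

theorem integrable_difference (hN : 1 ≤ N) {s : ℝ} (hs0 : 0 < s) (hs1 : s < 1) {ψ : RN N → ℝ}
    (hψ : ContDiff ℝ ∞ ψ) (hc : HasCompactSupport ψ) (x : RN N) :
    Integrable (fun h : RN N => (ψ x - ψ (x - h)) * ‖h‖ ^ (-((N : ℝ) + s))) := by
  obtain ⟨C, hC, h0, -, -⟩ := exists_difference_bounds hψ hc
  have hcont := hψ.continuous
  refine ((integrable_min_one_norm_rpow_mul hN hs0 hs1).const_mul C).mono'
    (AEStronglyMeasurable.mul (Continuous.aestronglyMeasurable (by fun_prop))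
      (Measurable.aestronglyMeasurable (by fun_prop))) (Eventually.of_forall fun h => ?_)
  exact norm_difference_mul_le (h0 x h) _

/-- The order s of the operator is below 1, so a Lipschitz numerator already makes the singular
integral converge absolutely, and dominated convergence removes the principal value. -/
theorem fracLap_half_eq_integral (hN : 1 ≤ N) {s : ℝ} (hs0 : 0 < s) (hs1 : s < 1) {ψ : RN N → ℝ}
    (hψ : ContDiff ℝ ∞ ψ) (hc : HasCompactSupport ψ) (x : RN N) :
    fracLap (s / 2) ψ x = fracLapConst N (s / 2) *
      ∫ h : RN N, (ψ x - ψ (x - h)) * ‖h‖ ^ (-((N : ℝ) + s)) := by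
  rw [fracLap]
  congr 1
  refine Tendsto.limUnder_eq ?_
  have : Nonempty (Fin N) := ⟨⟨0, hN⟩⟩
  have hI := integrable_difference hN hs0 hs1 hψ hc x
  have e : ∀ r : ℝ, ∫ y in {y : RN N | r < ‖x - y‖}, (ψ x - ψ y) / ‖x - y‖ ^ ((N : ℝ) + 2 * (s / 2))
      = ∫ h, {h : RN N | r < ‖h‖}.indicator
        (fun h => (ψ x - ψ (x - h)) * ‖h‖ ^ (-((N : ℝ) + s))) h := by
    intro r
    rw [← integral_indicator (measurableSet_lt measurable_const (by fun_prop)),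
      ← integral_sub_left_eq_self _ volume x]
    refine integral_congr_ae (Eventually.of_forall fun h => ?_)
    simp only [indicator, mem_ofPred_eq, sub_sub_cancel]
    refine if_congr Iff.rfl ?_ rfl
    rw [Real.rpow_neg (norm_nonneg _), div_eq_mul_inv]
    congr 3; ring
  simp_rw [e]
  refine tendsto_integral_filter_of_dominated_convergence _ (Eventually.of_forall fun r => ?_)
    (Eventually.of_forall fun r => Eventually.of_forall fun h => ?_) hI.norm ?_
  · exact hI.aestronglyMeasurable.indicator (measurableSet_lt measurable_const (by fun_prop))
  · exact norm_indicator_le_norm_self _ _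
  · have hne : ∀ᵐ h : RN N, h ≠ 0 := by
      simp [ae_iff, measure_singleton]
    filter_upwards [hne] with h hh
    refine tendsto_const_nhds.congr' ?_
    have : ∀ᶠ r : ℝ in 𝓝[>] 0, r < ‖h‖ :=
      nhdsWithin_le_nhds (eventually_lt_nhds (norm_pos_iff.2 hh))
    filter_upwards [this] with r hr
    rw [indicator_of_mem]
    exact hr

theorem fracLapConst_pos {σ : ℝ} (h0 : 0 < σ) (h1 : σ < 1) : 0 < fracLapConst N σ := by
  have := Real.Gamma_pos_of_pos (show 0 < (N : ℝ) / 2 + σ by positivity)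
  have := Real.Gamma_pos_of_pos (show 0 < 1 - σ by linarith)
  have := Real.pi_pos
  unfold fracLapConst
  positivity

theorem integrable_fracLap_half (hN : 1 ≤ N) {s : ℝ} (hs0 : 0 < s) (hs1 : s < 1) {ψ : RN N → ℝ}
    (hψ : ContDiff ℝ ∞ ψ) (hc : HasCompactSupport ψ) :
    Integrable (fracLap (s / 2) ψ) := by
  rw [funext (fracLap_half_eq_integral hN hs0 hs1 hψ hc)]
  exact (integrable_prod_difference hN hs0 hs1 hψ hc).integral_prod_left.const_mul _

theorem continuous_fracLap_half (hN : 1 ≤ N) {s : ℝ} (hs0 : 0 < s) (hs1 : s < 1) {ψ : RN N → ℝ}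
    (hψ : ContDiff ℝ ∞ ψ) (hc : HasCompactSupport ψ) :
    Continuous (fracLap (s / 2) ψ) := by
  rw [funext (fracLap_half_eq_integral hN hs0 hs1 hψ hc)]
  obtain ⟨C, hC, h0, -, -⟩ := exists_difference_bounds hψ hc
  have hcont := hψ.continuous
  refine Continuous.mul continuous_const (continuous_of_dominated
    (fun x => (integrable_difference hN hs0 hs1 hψ hc x).aestronglyMeasurable)
    (fun x => Eventually.of_forall fun h => ?_)
    ((integrable_min_one_norm_rpow_mul hN hs0 hs1).const_mul C)
    (Eventually.of_forall fun h => by fun_prop))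
  exact norm_difference_mul_le (h0 x h) _

theorem memLp_fracLap_half (hN : 1 ≤ N) {s : ℝ} (hs0 : 0 < s) (hs1 : s < 1) {ψ : RN N → ℝ}
    (hψ : ContDiff ℝ ∞ ψ) (hc : HasCompactSupport ψ) :
    MemLp (fracLap (s / 2) ψ) 2 volume := by
  obtain ⟨C, hC, h0, -, -⟩ := exists_difference_bounds hψ hc
  have hI := integrable_fracLap_half hN hs0 hs1 hψ hc
  set B := |fracLapConst N (s / 2)| *
    ∫ h : RN N, C * (min 1 (‖h‖ ^ (1 : ℝ)) * ‖h‖ ^ (-((N : ℝ) + s)))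
  have hB : ∀ x, ‖fracLap (s / 2) ψ x‖ ≤ B := by
    intro x
    rw [fracLap_half_eq_integral hN hs0 hs1 hψ hc, norm_mul, Real.norm_eq_abs]
    refine mul_le_mul_of_nonneg_left ?_ (abs_nonneg _)
    refine norm_integral_le_of_norm_le
      ((integrable_min_one_norm_rpow_mul hN hs0 hs1).const_mul C) (Eventually.of_forall fun h => ?_)
    exact norm_difference_mul_le (h0 x h) _
  exact hI.memLp_two_of_bound (Eventually.of_forall hB)

end Kernel
end

noncomputable section

/-! ### Fourier symbols -/

section Fourier

open scoped FourierTransform RealInnerProductSpace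

variable {N : ℕ}

/-- Integrals of `G ⟪h, ξ⟫` against the kernel `‖h‖ ^ (-(N + b))` are homogeneous in `ξ`. -/
theorem integral_kernel_inner_homogeneous {F : Type*} [NormedAddCommGroup F] [NormedSpace ℝ F]
    {b : ℝ} (hb : b ≠ 0) {G : ℝ → F} (hG : G 0 = 0) {e : RN N} (he : ‖e‖ = 1) (ξ : RN N) :
    ∫ h : RN N, ‖h‖ ^ (-((N : ℝ) + b)) • G ⟪h, ξ⟫ =
      ‖ξ‖ ^ b • ∫ h : RN N, ‖h‖ ^ (-((N : ℝ) + b)) • G ⟪h, e⟫ := by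
  rcases eq_or_ne ξ 0 with rfl | hξ
  · simp [hG, Real.zero_rpow hb]
  have hr : 0 < ‖ξ‖ := norm_pos_iff.2 hξ
  set r := ‖ξ‖ with hrdef
  -- Vectors of equal norm are exchanged by a reflection. It preserves volume and the kernel, so
  -- only a dilation by r remains.
  obtain ⟨R, hR⟩ : ∃ R : RN N ≃ₗᵢ[ℝ] RN N, R (r • e) = ξ :=
    ⟨_, Submodule.reflection_sub (by rw [norm_smul, he, mul_one, hrdef, norm_norm])⟩
  rw [← R.measurePreserving.integral_comp R.toHomeomorph.measurableEmbedding
    (fun h => ‖h‖ ^ (-((N : ℝ) + b)) • G ⟪h, ξ⟫)]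
  have e1 : ∀ h : RN N, ‖R h‖ ^ (-((N : ℝ) + b)) • G ⟪R h, ξ⟫ =
      r ^ ((N : ℝ) + b) • (fun k : RN N => ‖k‖ ^ (-((N : ℝ) + b)) • G ⟪k, e⟫) (r • h) := by
    intro h
    rw [← hR, R.inner_map_map, R.norm_map]
    simp only [norm_smul, Real.norm_of_nonneg hr.le, inner_smul_left, inner_smul_right, smul_smul]
    congr 1
    rw [Real.mul_rpow hr.le (norm_nonneg _), ← mul_assoc, ← Real.rpow_add hr]
    simp
  simp_rw [e1]
  rw [integral_smul, Measure.integral_comp_smul volume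
    (fun k : RN N => ‖k‖ ^ (-((N : ℝ) + b)) • G ⟪k, e⟫), smul_smul, finrank_euclideanSpace_fin]
  congr 1
  rw [abs_of_pos (by positivity), ← Real.rpow_natCast, ← Real.rpow_neg hr.le, ← Real.rpow_add hr]
  congr 1; ring

/-- The factor by which a difference of step `a` multiplies the Fourier transform. -/
def phaseGap (a : ℝ) : ℂ := 1 - (Real.fourierChar (-a) : ℂ)

theorem phaseGap_zero : phaseGap 0 = 0 := by simp [phaseGap]

theorem continuous_phaseGap : Continuous phaseGap := by
  unfold phaseGap
  have := Real.continuous_fourierChar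
  fun_prop

/-- The constant 7 is a convenient number above 2π. -/
theorem norm_phaseGap_le (a : ℝ) : ‖phaseGap a‖ ≤ 7 * min 1 |a| := by
  have h1 : ‖phaseGap a‖ ≤ 2 := by
    refine (norm_sub_le _ _).trans ?_
    rw [Circle.norm_coe, norm_one]; norm_num
  have h2 : ‖phaseGap a‖ ≤ 7 * |a| := by
    have h := Real.norm_exp_I_mul_ofReal_sub_one_le (x := 2 * Real.pi * (-a))
    rw [phaseGap, norm_sub_rev, Real.fourierChar_apply]
    rw [mul_comm Complex.I] at h
    refine h.trans ?_
    rw [Real.norm_eq_abs, abs_mul, abs_neg, abs_of_pos (by positivity)]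
    have := Real.pi_lt_d2
    gcongr
    linarith
  rcases le_total 1 |a| with h3 | h3
  · rw [min_eq_left h3]; linarith
  · rw [min_eq_right h3]; exact h2

theorem min_one_abs_inner_le (h ξ : RN N) :
    min 1 |⟪h, ξ⟫| ≤ (1 + ‖ξ‖) * min 1 ‖h‖ := by
  have h1 := abs_real_inner_le_norm h ξ
  have := norm_nonneg ξ
  have := norm_nonneg h
  rcases le_total 1 ‖h‖ with h3 | h3
  · rw [min_eq_left h3]
    exact (min_le_left _ _).trans (by linarith)
  · rw [min_eq_right h3]
    exact (min_le_right _ _).trans (by nlinarith)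

theorem integrable_kernel_phaseGap (hN : 1 ≤ N) {s : ℝ} (hs0 : 0 < s) (hs1 : s < 1) (ξ : RN N) :
    Integrable (fun h : RN N => ‖h‖ ^ (-((N : ℝ) + s)) • phaseGap ⟪h, ξ⟫) := by
  have hc := continuous_phaseGap.measurable
  refine ((integrable_min_one_norm_rpow_mul hN hs0 hs1).const_mul (7 * (1 + ‖ξ‖))).mono'
    (Measurable.aestronglyMeasurable (by fun_prop)) (Eventually.of_forall fun h => ?_)
  rw [norm_smul, Real.norm_of_nonneg (by positivity), Real.rpow_one, mul_comm, ← mul_assoc]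
  gcongr
  refine (norm_phaseGap_le _).trans ?_
  rw [mul_assoc]
  gcongr
  exact min_one_abs_inner_le h ξ

theorem integrable_kernel_phaseGap_sq (hN : 1 ≤ N) {s : ℝ} (hs0 : 0 < s) (hs1 : s < 1)
    (ξ : RN N) :
    Integrable (fun h : RN N => ‖h‖ ^ (-((N : ℝ) + 2 * s)) • ‖phaseGap ⟪h, ξ⟫‖ ^ 2) := by
  have hc := continuous_phaseGap.measurable
  refine ((integrable_min_one_norm_rpow_mul hN (b := 2 * s) (a := 2) (by positivity)
      (by linarith)).const_mul ((7 * (1 + ‖ξ‖)) ^ 2)).mono'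
    (Measurable.aestronglyMeasurable (by fun_prop)) (Eventually.of_forall fun h => ?_)
  have e : min 1 (‖h‖ ^ (2 : ℝ)) = (min 1 ‖h‖) ^ 2 := by
    rw [Real.rpow_two]
    rcases le_total 1 ‖h‖ with h3 | h3
    · rw [min_eq_left h3, min_eq_left (one_le_pow₀ h3)]; norm_num
    · rw [min_eq_right h3, min_eq_right (pow_le_one₀ (norm_nonneg _) h3)]
  rw [norm_smul, Real.norm_of_nonneg (by positivity), norm_pow, norm_norm, mul_comm, ← mul_assoc,
    e, ← mul_pow]
  gcongr
  refine (norm_phaseGap_le _).trans ?_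
  rw [mul_assoc]
  gcongr
  exact min_one_abs_inner_le h ξ

/-- The integrand is positive at h = e/2, hence on a nonempty open set. The value 1/2 is chosen
because `phaseGap` equals 2 there. -/
theorem integral_kernel_inner_pos {b : ℝ} {G : ℝ → ℝ} (hG : Continuous G)
    (hG0 : ∀ a, 0 ≤ G a) (hG1 : 0 < G (1 / 2)) {e : RN N} (he : ‖e‖ = 1)
    (hI : Integrable (fun h : RN N => ‖h‖ ^ (-((N : ℝ) + b)) • G ⟪h, e⟫)) :
    0 < ∫ h : RN N, ‖h‖ ^ (-((N : ℝ) + b)) • G ⟪h, e⟫ := by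
  rw [integral_pos_iff_support_of_nonneg
    (fun h => smul_nonneg (Real.rpow_nonneg (norm_nonneg _) _) (hG0 _)) hI]
  have hop : IsOpen {h : RN N | 0 < ‖h‖ ∧ 0 < G ⟪h, e⟫} :=
    (isOpen_lt continuous_const continuous_norm).inter
      (isOpen_lt continuous_const (hG.comp (by fun_prop)))
  refine lt_of_lt_of_le (hop.measure_pos volume ⟨(1 / 2 : ℝ) • e, ?_, ?_⟩) (measure_mono ?_)
  · rw [norm_smul, he]; norm_num
  · rw [inner_smul_left, real_inner_self_eq_norm_sq, he]; simpa using hG1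
  · rintro h ⟨h1, h2⟩
    exact (mul_pos (Real.rpow_pos_of_pos h1 _) h2).ne'

theorem phaseGap_half : phaseGap (1 / 2) = 2 := by
  rw [phaseGap, Real.fourierChar_apply]
  have : (↑(2 * Real.pi * -(1 / 2)) : ℂ) * Complex.I = -(Real.pi * Complex.I) := by
    push_cast; ring
  rw [this, Complex.exp_neg, Complex.exp_pi_mul_I]
  norm_num

theorem phaseGap_re_nonneg (a : ℝ) : 0 ≤ (phaseGap a).re := by
  have := Complex.re_le_norm (Real.fourierChar (-a) : ℂ)
  rw [Circle.norm_coe] at this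
  simp only [phaseGap, Complex.sub_re, Complex.one_re]
  linarith

/-- Plancherel by the multiplication formula and Fourier inversion. It is needed for (-Δ)^{s/2} ψ,
which need not be a Schwartz function because its transform carries the factor |ξ|^s. -/
theorem integral_norm_sq_fourier_of_continuous {f : RN N → ℂ} (hc : Continuous f)
    (hf : Integrable f) (hf' : Integrable (𝓕 f)) :
    ∫ ξ, ‖𝓕 f ξ‖ ^ 2 = ∫ x, ‖f x‖ ^ 2 := by
  have h : ∫ ξ, innerSL ℂ (𝓕 f ξ) (𝓕 f ξ) = ∫ x, innerSL ℂ (f x) (𝓕⁻ (𝓕 f) x) := by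
    refine (VectorFourier.integral_sesq_fourierIntegral_eq_neg_flip
      (innerSL ℂ) (L := innerₗ (RN N)) Real.continuous_fourierChar continuous_inner hf hf').trans ?_
    refine integral_congr_ae (Eventually.of_forall fun x => ?_)
    simp [Real.fourierInv_eq, VectorFourier.fourierIntegral, real_inner_comm]
  rw [hc.fourierInv_fourier_eq hf hf'] at h
  apply Complex.ofRealLI.injective
  simpa [← LinearIsometry.integral_comp_comm, inner_self_eq_norm_sq_to_K] using h

end Fourier
end

noncomputable section

/-! ### The half fractional Laplacian and the Gagliardo form -/

section GagliardoForm

open scoped FourierTransform RealInnerProductSpace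

variable {N : ℕ}

theorem fourier_comp_sub_right (f : RN N → ℂ) (h ξ : RN N) :
    𝓕 (fun x => f (x - h)) ξ = (Real.fourierChar (-⟪h, ξ⟫) : ℂ) * 𝓕 f ξ := by
  simp only [Real.fourier_eq, Circle.smul_def, smul_eq_mul]
  rw [← integral_const_mul, ← integral_sub_right_eq_self
    (fun x => (Real.fourierChar (-⟪h, ξ⟫) : ℂ) * ((Real.fourierChar (-⟪x, ξ⟫) : ℂ) * f x)) h]
  refine integral_congr_ae (Eventually.of_forall fun x => ?_)
  simp only
  rw [← mul_assoc, ← Circle.coe_mul, ← AddChar.map_add_eq_mul, inner_sub_left]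
  congr 4; ring

theorem fourier_sub_comp_sub_right {f : RN N → ℂ} (hf : Integrable f) (h ξ : RN N) :
    𝓕 (fun x => f x - f (x - h)) ξ = phaseGap ⟪h, ξ⟫ * 𝓕 f ξ := by
  have h1 : 𝓕 (fun x => f x - f (x - h)) ξ = 𝓕 f ξ - 𝓕 (fun x => f (x - h)) ξ := by
    simp only [Real.fourier_eq, Circle.smul_def, smul_eq_mul]
    rw [← integral_sub]
    · simp_rw [mul_sub]
    · exact (Real.fourierIntegral_convergent_iff ξ).2 hf
    · exact (Real.fourierIntegral_convergent_iff ξ).2 (hf.comp_sub_right h)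
  rw [h1, fourier_comp_sub_right, phaseGap]
  ring

/-- Fubini, justified by `integrable_prod_difference`, reduces the computation to the transform of a
single difference. By homogeneity the resulting multiplier is a constant times |ξ|^s. -/
theorem fourier_fracLap_half (hN : 1 ≤ N) {s : ℝ} (hs0 : 0 < s) (hs1 : s < 1) {ψ : RN N → ℝ}
    (hψ : ContDiff ℝ ∞ ψ) (hc : HasCompactSupport ψ) (ξ : RN N) :
    𝓕 (fun x => (fracLap (s / 2) ψ x : ℂ)) ξ = fracLapConst N (s / 2) *
      (∫ h : RN N, ‖h‖ ^ (-((N : ℝ) + s)) • phaseGap ⟪h, ξ⟫) * 𝓕 (fun x => (ψ x : ℂ)) ξ := by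
  have hI := (integrable_prod_difference hN hs0 hs1 hψ hc).ofReal (𝕜 := ℂ)
  have hψI : Integrable (fun x => (ψ x : ℂ)) :=
    (hψ.continuous.integrable_of_hasCompactSupport hc).ofReal
  rw [Real.fourier_eq]
  have e1 : ∀ x, Real.fourierChar (-⟪x, ξ⟫) • (fracLap (s / 2) ψ x : ℂ) =
      fracLapConst N (s / 2) * ∫ h : RN N, (Real.fourierChar (-⟪x, ξ⟫) : ℂ) *
        (((ψ x - ψ (x - h)) * ‖h‖ ^ (-((N : ℝ) + s)) : ℝ) : ℂ) := by
    intro x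
    rw [fracLap_half_eq_integral hN hs0 hs1 hψ hc, integral_const_mul, integral_complex_ofReal,
      Circle.smul_def, smul_eq_mul]
    push_cast
    ring
  simp_rw [e1]
  rw [integral_const_mul, mul_assoc]
  congr 1
  rw [integral_integral_swap, ← integral_mul_const]
  · refine integral_congr_ae (Eventually.of_forall fun h => ?_)
    simp only
    have e2 := fourier_sub_comp_sub_right hψI h ξ
    rw [Real.fourier_eq] at e2
    rw [smul_mul_assoc, ← e2, ← integral_smul]
    refine integral_congr_ae (Eventually.of_forall fun x => ?_)
    simp only [Circle.smul_def, smul_eq_mul, Complex.real_smul]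
    push_cast
    ring
  · refine hI.bdd_mul (c := 1) ?_ (Eventually.of_forall fun p => by simp [Circle.norm_coe])
    have := Real.continuous_fourierChar
    exact Continuous.aestronglyMeasurable (by fun_prop)

theorem rpow_le_one_add {a : ℝ} (ha : 0 ≤ a) {s : ℝ} (hs0 : 0 < s) (hs1 : s < 1) :
    a ^ s ≤ 1 + a := by
  rcases le_total a 1 with h | h
  · exact (Real.rpow_le_one ha h hs0.le).trans (by linarith)
  · exact (Real.rpow_le_rpow_of_exponent_le h hs1.le).trans (by rw [Real.rpow_one]; linarith)

theorem integrable_rpow_mul_schwartz {s : ℝ} (hs0 : 0 < s) (hs1 : s < 1)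
    (f : SchwartzMap (RN N) ℂ) : Integrable (fun ξ : RN N => ‖ξ‖ ^ s * ‖f ξ‖) := by
  refine (((f.integrable_pow_mul volume 0).add (f.integrable_pow_mul volume 1))).mono' ?_
    (Eventually.of_forall fun ξ => ?_)
  · have := f.continuous
    exact Measurable.aestronglyMeasurable (by fun_prop)
  · simp only [pow_zero, one_mul, pow_one, Pi.add_apply]
    rw [Real.norm_of_nonneg (by positivity), ← one_add_mul]
    gcongr
    exact rpow_le_one_add (norm_nonneg _) hs0 hs1

theorem memLp_rpow_mul_schwartz {s : ℝ} (hs0 : 0 < s) (hs1 : s < 1)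
    (f : SchwartzMap (RN N) ℂ) : MemLp (fun ξ : RN N => ‖ξ‖ ^ s * ‖f ξ‖) 2 volume := by
  obtain ⟨A, -, hA⟩ := f.decay 0 0
  obtain ⟨B, -, hB⟩ := f.decay 1 0
  refine (integrable_rpow_mul_schwartz hs0 hs1 f).memLp_two_of_bound (B := A + B)
    (Eventually.of_forall fun ξ => ?_)
  have h1 := hA ξ
  have h2 := hB ξ
  simp only [pow_zero, one_mul, pow_one, norm_iteratedFDeriv_zero] at h1 h2
  rw [Real.norm_of_nonneg (by positivity)]
  calc ‖ξ‖ ^ s * ‖f ξ‖ ≤ (1 + ‖ξ‖) * ‖f ξ‖ := by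
        gcongr; exact rpow_le_one_add (norm_nonneg _) hs0 hs1
    _ ≤ A + B := by rw [one_add_mul]; linarith

theorem fourier_ofReal_eq_schwartz {ψ : RN N → ℝ} {Ψ : SchwartzMap (RN N) ℂ}
    (hΨ : ∀ x, Ψ x = ψ x) (ξ : RN N) : 𝓕 (fun x => (ψ x : ℂ)) ξ = (𝓕 Ψ) ξ := by
  rw [SchwartzMap.fourier_coe, funext hΨ]

theorem integral_fracLap_half_sq (hN : 1 ≤ N) {s : ℝ} (hs0 : 0 < s) (hs1 : s < 1) {e : RN N}
    (he : ‖e‖ = 1) {ψ : RN N → ℝ} (hψ : ContDiff ℝ ∞ ψ) (hc : HasCompactSupport ψ)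
    {Ψ : SchwartzMap (RN N) ℂ} (hΨ : ∀ x, Ψ x = ψ x) :
    ∫ x, fracLap (s / 2) ψ x ^ 2 = fracLapConst N (s / 2) ^ 2 *
      ‖∫ h : RN N, ‖h‖ ^ (-((N : ℝ) + s)) • phaseGap ⟪h, e⟫‖ ^ 2 *
        ∫ ξ : RN N, (‖ξ‖ ^ s * ‖(𝓕 Ψ) ξ‖) ^ 2 := by
  set m : ℂ := ∫ h : RN N, ‖h‖ ^ (-((N : ℝ) + s)) • phaseGap ⟪h, e⟫ with hm
  have hcpos := fracLapConst_pos (N := N) (σ := s / 2) (by linarith) (by linarith)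
  set c := fracLapConst N (s / 2) with hc_def
  have hF : ∀ ξ, 𝓕 (fun x => (fracLap (s / 2) ψ x : ℂ)) ξ = c * m * (‖ξ‖ ^ s • (𝓕 Ψ) ξ) := by
    intro ξ
    rw [fourier_fracLap_half hN hs0 hs1 hψ hc, fourier_ofReal_eq_schwartz hΨ,
      integral_kernel_inner_homogeneous hs0.ne' phaseGap_zero he ξ, ← hm]
    simp only [Complex.real_smul]
    ring
  have hFn : ∀ ξ, ‖𝓕 (fun x => (fracLap (s / 2) ψ x : ℂ)) ξ‖ =
      c * ‖m‖ * (‖ξ‖ ^ s * ‖(𝓕 Ψ) ξ‖) := by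
    intro ξ
    rw [hF, norm_mul, norm_mul, norm_smul, Complex.norm_real, Real.norm_of_nonneg hcpos.le,
      Real.norm_of_nonneg (by positivity)]
  have hmeas : AEStronglyMeasurable (𝓕 (fun x => (fracLap (s / 2) ψ x : ℂ))) volume := by
    rw [funext hF]
    have := (𝓕 Ψ).continuous.measurable
    exact Measurable.aestronglyMeasurable (by fun_prop)
  have h1 := integral_norm_sq_fourier_of_continuous
    (Complex.continuous_ofReal.comp (continuous_fracLap_half hN hs0 hs1 hψ hc))
    (integrable_fracLap_half hN hs0 hs1 hψ hc).ofReal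
    (((integrable_rpow_mul_schwartz hs0 hs1 (𝓕 Ψ)).const_mul (c * ‖m‖)).mono' hmeas
        (Eventually.of_forall fun ξ => (hFn ξ).le))
  have h2 : ∀ x, ‖(Complex.ofReal ∘ fracLap (s / 2) ψ) x‖ ^ 2 = fracLap (s / 2) ψ x ^ 2 := by
    intro x
    rw [Function.comp_apply, Complex.norm_real, Real.norm_eq_abs, sq_abs]
  simp_rw [h2] at h1
  rw [← h1, ← integral_const_mul]
  refine integral_congr_ae (Eventually.of_forall fun ξ => ?_)
  simp only [Function.comp_def]
  rw [hFn]; ring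

/-- Plancherel in x for each fixed step h, then integration in h first: the inner integral is
homogeneous of degree 2s in ξ. -/
theorem integral_gagliardoDiff_sq (hN : 1 ≤ N) {s : ℝ} (hs0 : 0 < s) (hs1 : s < 1) {e : RN N}
    (he : ‖e‖ = 1) {ψ : RN N → ℝ} (hψ : ContDiff ℝ ∞ ψ) (hc : HasCompactSupport ψ)
    {Ψ : SchwartzMap (RN N) ℂ} (hΨ : ∀ x, Ψ x = ψ x) :
    ∫ p, gagliardoDiff s ψ p ^ 2 =
      (∫ h : RN N, ‖h‖ ^ (-((N : ℝ) + 2 * s)) • ‖phaseGap ⟪h, e⟫‖ ^ 2) *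
        ∫ ξ : RN N, (‖ξ‖ ^ s * ‖(𝓕 Ψ) ξ‖) ^ 2 := by
  set M : ℝ := ∫ h : RN N, ‖h‖ ^ (-((N : ℝ) + 2 * s)) • ‖phaseGap ⟪h, e⟫‖ ^ 2 with hM
  have hψ' : ContDiff ℝ ∞ (fun x => (ψ x : ℂ)) := Complex.ofRealCLM.contDiff.comp hψ
  have hc' : HasCompactSupport (fun x => (ψ x : ℂ)) := hc.comp_left Complex.ofReal_zero
  have hψI : Integrable (fun x => (ψ x : ℂ)) :=
    (hψ.continuous.integrable_of_hasCompactSupport hc).ofReal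
  have hsq := (memLp_rpow_mul_schwartz hs0 hs1 (𝓕 Ψ)).integrable_sq
  have hk : ∀ h : RN N, (‖h‖ ^ (-((N : ℝ) / 2 + s))) ^ 2 = ‖h‖ ^ (-((N : ℝ) + 2 * s)) := by
    intro h
    rw [← Real.rpow_natCast, ← Real.rpow_mul (norm_nonneg _)]
    congr 1; push_cast; ring
  have hMξ : ∀ ξ : RN N, ∫ h : RN N, ‖h‖ ^ (-((N : ℝ) + 2 * s)) * (‖phaseGap ⟪h, ξ⟫‖ ^ 2 *
      ‖(𝓕 Ψ) ξ‖ ^ 2) = M * (‖ξ‖ ^ s * ‖(𝓕 Ψ) ξ‖) ^ 2 := by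
    intro ξ
    have := integral_kernel_inner_homogeneous (b := 2 * s) (by positivity)
      (G := fun a => ‖phaseGap a‖ ^ 2) (by simp [phaseGap_zero]) he ξ
    simp only [smul_eq_mul] at this hM
    simp_rw [← mul_assoc]
    rw [integral_mul_const, this, hM, mul_pow, ← Real.rpow_natCast (‖ξ‖ ^ s),
      ← Real.rpow_mul (norm_nonneg _)]
    rw [show s * ((2 : ℕ) : ℝ) = 2 * s by push_cast; ring]
    ring
  have hprod : Integrable (fun p : RN N × RN N => ‖p.2‖ ^ (-((N : ℝ) + 2 * s)) *
      (‖phaseGap ⟪p.2, p.1⟫‖ ^ 2 * ‖(𝓕 Ψ) p.1‖ ^ 2)) (volume.prod volume) := by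
    have hmeas : AEStronglyMeasurable (fun p : RN N × RN N => ‖p.2‖ ^ (-((N : ℝ) + 2 * s)) *
      (‖phaseGap ⟪p.2, p.1⟫‖ ^ 2 * ‖(𝓕 Ψ) p.1‖ ^ 2)) (volume.prod volume) := by
      have := (𝓕 Ψ).continuous.measurable
      have := continuous_phaseGap.measurable
      exact Measurable.aestronglyMeasurable (by fun_prop)
    rw [integrable_prod_iff hmeas]
    constructor
    · refine Eventually.of_forall fun ξ => ?_
      have := (integrable_kernel_phaseGap_sq hN hs0 hs1 ξ).mul_const (‖(𝓕 Ψ) ξ‖ ^ 2)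
      simpa only [smul_eq_mul, mul_assoc] using this
    · have : ∀ ξ h : RN N, ‖‖h‖ ^ (-((N : ℝ) + 2 * s)) * (‖phaseGap ⟪h, ξ⟫‖ ^ 2 *
          ‖(𝓕 Ψ) ξ‖ ^ 2)‖ = ‖h‖ ^ (-((N : ℝ) + 2 * s)) * (‖phaseGap ⟪h, ξ⟫‖ ^ 2 *
          ‖(𝓕 Ψ) ξ‖ ^ 2) := fun ξ h => Real.norm_of_nonneg (by positivity)
      simp_rw [this, hMξ]
      exact hsq.const_mul M
  rw [show (volume : Measure (RN N × RN N)) = volume.prod volume from rfl,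
    integral_prod_symm _ (memLp_gagliardoDiff hN hs0 hs1 hψ hc).integrable_sq]
  have hx : ∀ h : RN N, ∫ x, gagliardoDiff s ψ (x, h) ^ 2 =
      ∫ ξ, ‖h‖ ^ (-((N : ℝ) + 2 * s)) * (‖phaseGap ⟪h, ξ⟫‖ ^ 2 * ‖(𝓕 Ψ) ξ‖ ^ 2) := by
    intro h
    have hd : ContDiff ℝ ∞ (fun x => (ψ x : ℂ) - (ψ (x - h) : ℂ)) :=
      hψ'.sub (hψ'.comp (contDiff_id.sub contDiff_const))
    have hdc : HasCompactSupport (fun x => (ψ x : ℂ) - (ψ (x - h) : ℂ)) := by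
      refine hc'.sub ?_
      exact hc'.comp_homeomorph (Homeomorph.subRight h)
    set Θ := hdc.toSchwartzMap hd with hΘ
    have hΘ' : ∀ x, Θ x = (ψ x : ℂ) - (ψ (x - h) : ℂ) := fun x => rfl
    have h1 := SchwartzMap.integral_norm_sq_fourier Θ
    have h2 : ∀ ξ, (𝓕 Θ) ξ = phaseGap ⟪h, ξ⟫ * (𝓕 Ψ) ξ := by
      intro ξ
      rw [← fourier_ofReal_eq_schwartz hΨ, ← fourier_sub_comp_sub_right hψI h ξ,
        SchwartzMap.fourier_coe]
      congr 1
    simp only [h2, norm_mul, mul_pow, hΘ'] at h1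
    rw [integral_const_mul, h1, ← integral_const_mul]
    refine integral_congr_ae (Eventually.of_forall fun x => ?_)
    simp only [gagliardoDiff, mul_pow, hk]
    rw [← Complex.ofReal_sub, Complex.norm_real, Real.norm_eq_abs, sq_abs, mul_comm]
  simp_rw [hx]
  rw [← integral_prod_symm _ hprod, integral_prod _ hprod]
  simp_rw [hMξ]
  rw [integral_const_mul]

/-- Both sides are constants times the integral of |ξ|^{2s} |ψ̂|², and κ is the ratio of the
constants. Only its existence and positivity matter later. -/
theorem exists_integral_fracLap_sq_eq (hN : 1 ≤ N) {s : ℝ} (hs0 : 0 < s) (hs1 : s < 1) :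
    ∃ κ : ℝ, 0 < κ ∧ ∀ ψ : RN N → ℝ, ContDiff ℝ ∞ ψ → HasCompactSupport ψ →
      ∫ x, fracLap (s / 2) ψ x ^ 2 = κ * ∫ p, gagliardoDiff s ψ p ^ 2 := by
  obtain ⟨e, he⟩ : ∃ e : RN N, ‖e‖ = 1 := ⟨EuclideanSpace.single ⟨0, hN⟩ 1, by simp⟩
  set m : ℂ := ∫ h : RN N, ‖h‖ ^ (-((N : ℝ) + s)) • phaseGap ⟪h, e⟫ with hm
  set M : ℝ := ∫ h : RN N, ‖h‖ ^ (-((N : ℝ) + 2 * s)) • ‖phaseGap ⟪h, e⟫‖ ^ 2 with hM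
  -- The real part of `phaseGap` is 1 - cos(2πa), which is nonnegative and not identically zero.
  have hm0 : m ≠ 0 := by
    intro h0
    have hI := integrable_kernel_phaseGap hN hs0 hs1 e
    have h1 := integral_re hI
    have h2 : 0 < ∫ h : RN N, ‖h‖ ^ (-((N : ℝ) + s)) • (phaseGap ⟪h, e⟫).re := by
      refine integral_kernel_inner_pos (G := fun a => (phaseGap a).re)
        (Complex.continuous_re.comp continuous_phaseGap) phaseGap_re_nonneg ?_ he ?_
      · rw [phaseGap_half]; simp
      · refine hI.re.congr (Eventually.of_forall fun h => ?_)
        simp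
    rw [← hm, h0] at h1
    simp only [RCLike.re_eq_complex_re, Complex.smul_re, Complex.zero_re] at h1
    exact h2.ne' h1
  have hM0 : 0 < M := by
    refine integral_kernel_inner_pos (G := fun a => ‖phaseGap a‖ ^ 2)
      (continuous_phaseGap.norm.pow 2) (fun a => sq_nonneg _) ?_ he
      (integrable_kernel_phaseGap_sq hN hs0 hs1 e)
    rw [phaseGap_half]; norm_num
  have hcpos := fracLapConst_pos (N := N) (σ := s / 2) (by linarith) (by linarith)
  refine ⟨fracLapConst N (s / 2) ^ 2 * ‖m‖ ^ 2 / M,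
    div_pos (mul_pos (pow_pos hcpos 2) (pow_pos (norm_pos_iff.2 hm0) 2)) hM0, fun ψ hψ hc => ?_⟩
  have hψ' : ContDiff ℝ ∞ (fun x => (ψ x : ℂ)) := Complex.ofRealCLM.contDiff.comp hψ
  have hc' : HasCompactSupport (fun x => (ψ x : ℂ)) := hc.comp_left Complex.ofReal_zero
  have hΨ : ∀ x, hc'.toSchwartzMap hψ' x = ψ x := fun x => rfl
  rw [integral_fracLap_half_sq hN hs0 hs1 he hψ hc hΨ,
    integral_gagliardoDiff_sq hN hs0 hs1 he hψ hc hΨ, ← hm, ← hM]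
  field_simp

theorem fracLap_half_add (hN : 1 ≤ N) {s : ℝ} (hs0 : 0 < s) (hs1 : s < 1) {ψ η : RN N → ℝ}
    (hψ : ContDiff ℝ ∞ ψ) (hψc : HasCompactSupport ψ) (hη : ContDiff ℝ ∞ η)
    (hηc : HasCompactSupport η) (x : RN N) :
    fracLap (s / 2) (fun y => ψ y + η y) x = fracLap (s / 2) ψ x + fracLap (s / 2) η x := by
  rw [fracLap_half_eq_integral hN hs0 hs1 (hψ.add hη) (hψc.add hηc),
    fracLap_half_eq_integral hN hs0 hs1 hψ hψc, fracLap_half_eq_integral hN hs0 hs1 hη hηc,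
    ← mul_add, ← integral_add (integrable_difference hN hs0 hs1 hψ hψc x)
      (integrable_difference hN hs0 hs1 hη hηc x)]
  congr 2
  ext h
  ring

theorem fracLap_half_const_mul (hN : 1 ≤ N) {s : ℝ} (hs0 : 0 < s) (hs1 : s < 1) {ψ : RN N → ℝ}
    (hψ : ContDiff ℝ ∞ ψ) (hψc : HasCompactSupport ψ) (a : ℝ) (x : RN N) :
    fracLap (s / 2) (fun y => a * ψ y) x = a * fracLap (s / 2) ψ x := by
  rw [fracLap_half_eq_integral hN hs0 hs1 (contDiff_const.mul hψ) hψc.mul_left,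
    fracLap_half_eq_integral hN hs0 hs1 hψ hψc, mul_left_comm, ← integral_const_mul a]
  congr 2
  ext h
  ring

theorem fracLap_half_sub (hN : 1 ≤ N) {s : ℝ} (hs0 : 0 < s) (hs1 : s < 1) {ψ η : RN N → ℝ}
    (hψ : ContDiff ℝ ∞ ψ) (hψc : HasCompactSupport ψ) (hη : ContDiff ℝ ∞ η)
    (hηc : HasCompactSupport η) (x : RN N) :
    fracLap (s / 2) (fun y => ψ y - η y) x = fracLap (s / 2) ψ x - fracLap (s / 2) η x := by
  have h := fracLap_half_add hN hs0 hs1 hψ hψc (contDiff_const.mul hη) (hηc.mul_left (f := fun _ => (-1 : ℝ))) x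
  rw [fracLap_half_const_mul hN hs0 hs1 hη hηc] at h
  have e : (fun y => ψ y - η y) = fun y => ψ y + -1 * η y := by ext y; ring
  rw [e, h]; ring

theorem gagliardoDiff_sub (s : ℝ) (f g : RN N → ℝ) (p : RN N × RN N) :
    gagliardoDiff s (fun x => f x - g x) p = gagliardoDiff s f p - gagliardoDiff s g p := by
  simp only [gagliardoDiff]; ring

theorem gagliardoDiff_add (s : ℝ) (f g : RN N → ℝ) (p : RN N × RN N) :
    gagliardoDiff s (fun x => f x + g x) p = gagliardoDiff s f p + gagliardoDiff s g p := by
  simp only [gagliardoDiff]; ring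

/-- On smooth compactly supported functions, `⟨(-Δ)^{s/2} ψ, (-Δ)^{s/2} η⟩` is a positive multiple
of the Gagliardo form. -/
theorem exists_integral_fracLap_mul_eq (hN : 1 ≤ N) {s : ℝ} (hs0 : 0 < s) (hs1 : s < 1) :
    ∃ κ : ℝ, 0 < κ ∧ ∀ ψ η : RN N → ℝ, ContDiff ℝ ∞ ψ → HasCompactSupport ψ →
      ContDiff ℝ ∞ η → HasCompactSupport η →
      ∫ x, fracLap (s / 2) ψ x * fracLap (s / 2) η x =
        κ * ∫ p, gagliardoDiff s ψ p * gagliardoDiff s η p := by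
  obtain ⟨κ, hκ, h⟩ := exists_integral_fracLap_sq_eq hN hs0 hs1
  refine ⟨κ, hκ, fun ψ η hψ hψc hη hηc => ?_⟩
  have polar : ∀ {X : Type} [MeasurableSpace X] (μ : Measure X) (f g : X → ℝ), MemLp f 2 μ →
      MemLp g 2 μ →
      ∫ x, f x * g x ∂μ = (∫ x, (f x + g x) ^ 2 ∂μ - ∫ x, (f x - g x) ^ 2 ∂μ) / 4 := by
    intro X _ μ f g hf hg
    have hf' : MemLp (fun x => f x + g x) 2 μ := hf.add hg
    have hg' : MemLp (fun x => f x - g x) 2 μ := hf.sub hg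
    rw [← integral_sub hf'.integrable_sq hg'.integrable_sq, ← integral_div]
    congr 1; ext x; ring
  have h1 := h _ (hψ.add hη) (hψc.add hηc)
  have h2 := h _ (hψ.sub hη) (hψc.sub hηc)
  simp only [fracLap_half_add hN hs0 hs1 hψ hψc hη hηc, fracLap_half_sub hN hs0 hs1 hψ hψc hη hηc,
    gagliardoDiff_add, gagliardoDiff_sub] at h1 h2
  rw [polar _ _ _ (memLp_fracLap_half hN hs0 hs1 hψ hψc) (memLp_fracLap_half hN hs0 hs1 hη hηc),
    polar _ _ _ (memLp_gagliardoDiff hN hs0 hs1 hψ hψc) (memLp_gagliardoDiff hN hs0 hs1 hη hηc),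
    h1, h2]
  ring

end GagliardoForm
end

noncomputable section

/-! ### The homogeneous fractional Sobolev space -/

section HomogeneousSobolev

variable {N : ℕ} {s κ : ℝ}

/-- `κ` is the factor between `⟨(-Δ)^{s/2} ψ, (-Δ)^{s/2} η⟩` and the Gagliardo form. -/
def IsGagliardoFactor (N : ℕ) (s κ : ℝ) : Prop :=
  0 < κ ∧ ∀ ψ η : RN N → ℝ, ContDiff ℝ ∞ ψ → HasCompactSupport ψ →
    ContDiff ℝ ∞ η → HasCompactSupport η →
    ∫ x, fracLap (s / 2) ψ x * fracLap (s / 2) η x =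
      κ * ∫ p, gagliardoDiff s ψ p * gagliardoDiff s η p

theorem eLpNorm_fracLap_half_eq (hN : 1 ≤ N) (hs0 : 0 < s) (hs1 : s < 1)
    (hκ : IsGagliardoFactor N s κ) {ψ : RN N → ℝ} (hψ : ContDiff ℝ ∞ ψ)
    (hc : HasCompactSupport ψ) :
    eLpNorm (fracLap (s / 2) ψ) 2 volume =
      ENNReal.ofReal (√κ) * eLpNorm (gagliardoDiff s ψ) 2 volume := by
  have h1 := memLp_fracLap_half hN hs0 hs1 hψ hc
  have h2 := memLp_gagliardoDiff hN hs0 hs1 hψ hc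
  have h := hκ.2 ψ ψ hψ hc hψ hc
  simp only [← pow_two] at h
  rw [← toReal_eLpNorm_two_sq h1, ← toReal_eLpNorm_two_sq h2, ← Real.sq_sqrt hκ.1.le,
    ← mul_pow] at h
  rw [pow_left_inj₀ ENNReal.toReal_nonneg (by positivity) two_ne_zero] at h
  rw [← ENNReal.ofReal_toReal h1.2.ne, h, ENNReal.ofReal_mul (Real.sqrt_nonneg _),
    ENNReal.ofReal_toReal h2.2.ne]

/-- Fatou's lemma along an almost everywhere convergent subsequence; the additive constants c j
cancel in differences. An inequality is enough, since applied to ψ j - f it also yields convergence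
of the energies. -/
theorem HasHalfFracLap.eLpNorm_gagliardoDiff_le (hN : 1 ≤ N) (hs0 : 0 < s) (hs1 : s < 1)
    (hκ : IsGagliardoFactor N s κ) {f g : RN N → ℝ} (hf : AEStronglyMeasurable f volume)
    (h : HasHalfFracLap s f g) :
    ENNReal.ofReal (√κ) * eLpNorm (gagliardoDiff s f) 2 volume ≤ eLpNorm g 2 volume := by
  obtain ⟨hg, ψ, c, hψ, hψf, hψg⟩ := h
  have hm := aestronglyMeasurable_gagliardoDiff s hf
  have hκ0 : 0 < √κ := Real.sqrt_pos.2 hκ.1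
  have hlim : Tendsto (fun j => eLpNorm (fracLap (s / 2) (ψ j)) 2 volume) atTop
      (𝓝 (eLpNorm g 2 volume)) := by
    have h1 : ∀ j, MemLp (fracLap (s / 2) (ψ j)) 2 volume :=
      fun j => memLp_fracLap_half hN hs0 hs1 (hψ j).1 (hψ j).2
    have h2 := ENNReal.tendsto_ofReal (tendsto_toReal_eLpNorm_of_tendsto h1 hg hψg)
    rw [ENNReal.ofReal_toReal hg.2.ne] at h2
    exact h2.congr fun j => ENNReal.ofReal_toReal (h1 j).2.ne
  -- Both points of the difference must lie in one ball, because the approximation converges only in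
  -- L²_loc.
  set S : ℕ → Set (RN N × RN N) := fun n =>
    {p | p.1 ∈ Metric.ball (0 : RN N) n ∧ p.1 - p.2 ∈ Metric.ball (0 : RN N) n} with hS
  have hSm : ∀ n, MeasurableSet (S n) := fun n =>
    ((measurable_fst Metric.isOpen_ball.measurableSet)).inter
      ((measurable_fst.sub measurable_snd) Metric.isOpen_ball.measurableSet)
  have hball : ∀ n, ∫⁻ p in S n, ENNReal.ofReal (gagliardoDiff s f p ^ 2) ≤
      (ENNReal.ofReal (√κ)⁻¹ * eLpNorm g 2 volume) ^ 2 := by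
    intro n
    have hcv : ∀ j, AEStronglyMeasurable (fun x => ψ j x - c j)
        (volume.restrict (Metric.ball (0 : RN N) n)) := fun j =>
      ((hψ j).1.continuous.sub continuous_const).aestronglyMeasurable
    obtain ⟨k, hk, hkf⟩ := (tendstoInMeasure_of_tendsto_eLpNorm (by norm_num) hcv
      hf.restrict (hψf n)).exists_seq_tendsto_ae
    rw [ae_restrict_iff' Metric.isOpen_ball.measurableSet] at hkf
    have h1 := Measure.quasiMeasurePreserving_fst (μ := (volume : Measure (RN N)))
      (ν := (volume : Measure (RN N))) |>.ae hkf
    have h2 := (quasiMeasurePreserving_sub_of_right_invariant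
      (volume : Measure (RN N)) (volume : Measure (RN N))).ae hkf
    have hpt : ∀ᵐ p ∂(volume.restrict (S n)), Tendsto
        (fun j => ENNReal.ofReal (gagliardoDiff s (ψ (k j)) p ^ 2)) atTop
        (𝓝 (ENNReal.ofReal (gagliardoDiff s f p ^ 2))) := by
      rw [ae_restrict_iff' (hSm n)]
      filter_upwards [h1, h2] with p hp1 hp2 hp
      refine ENNReal.tendsto_ofReal (Tendsto.pow ?_ 2)
      have := ((hp1 hp.1).sub (hp2 hp.2)).mul_const (‖p.2‖ ^ (-((N : ℝ) / 2 + s)))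
      refine this.congr fun j => ?_
      simp [gagliardoDiff]
    have hlim' := ENNReal.Tendsto.const_mul (a := ENNReal.ofReal (√κ)⁻¹)
      (hlim.comp hk.tendsto_atTop) (Or.inr ENNReal.ofReal_ne_top)
    have hlim2 := (ENNReal.continuous_pow 2).tendsto _ |>.comp hlim'
    calc ∫⁻ p in S n, ENNReal.ofReal (gagliardoDiff s f p ^ 2)
        = ∫⁻ p in S n, liminf (fun j => ENNReal.ofReal (gagliardoDiff s (ψ (k j)) p ^ 2)) atTop :=
          lintegral_congr_ae (hpt.mono fun p hp => hp.liminf_eq.symm)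
      _ ≤ liminf (fun j => ∫⁻ p in S n, ENNReal.ofReal (gagliardoDiff s (ψ (k j)) p ^ 2)) atTop := by
          refine lintegral_liminf_le' fun j => ?_
          exact ((aestronglyMeasurable_gagliardoDiff s
            (hψ (k j)).1.continuous.aestronglyMeasurable).restrict.aemeasurable.pow_const
              2).ennreal_ofReal
      _ ≤ liminf (fun j => (ENNReal.ofReal (√κ)⁻¹ *
            eLpNorm (fracLap (s / 2) (ψ (k j))) 2 volume) ^ 2) atTop := by
          refine liminf_le_liminf (Eventually.of_forall fun j => ?_)
          rw [eLpNorm_fracLap_half_eq hN hs0 hs1 hκ (hψ (k j)).1 (hψ (k j)).2, ← mul_assoc,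
            ← ENNReal.ofReal_mul (by positivity), inv_mul_cancel₀ hκ0.ne', ENNReal.ofReal_one,
            one_mul, eLpNorm_two_sq_eq_lintegral]
          exact setLIntegral_le_lintegral _ _
      _ = _ := hlim2.liminf_eq
  have hU : ⋃ n, S n = univ := by
    refine eq_univ_of_forall fun p => mem_iUnion.2 ?_
    obtain ⟨n, hn⟩ := exists_nat_gt (max ‖p.1‖ ‖p.1 - p.2‖)
    exact ⟨n, by simpa using (le_max_left _ _).trans_lt hn,
      by simpa using (le_max_right _ _).trans_lt hn⟩
  have hmono : Monotone S := fun a b hab p hp =>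
    ⟨Metric.ball_subset_ball (by exact_mod_cast hab) hp.1,
      Metric.ball_subset_ball (by exact_mod_cast hab) hp.2⟩
  have htot : eLpNorm (gagliardoDiff s f) 2 volume ^ 2 ≤
      (ENNReal.ofReal (√κ)⁻¹ * eLpNorm g 2 volume) ^ 2 := by
    rw [eLpNorm_two_sq_eq_lintegral, ← setLIntegral_univ, ← hU,
      setLIntegral_iUnion_of_directed _ hmono.directed_le]
    exact iSup_le hball
  have h3 := (ENNReal.pow_le_pow_left_iff two_ne_zero).1 htot
  calc _ ≤ ENNReal.ofReal (√κ) * (ENNReal.ofReal (√κ)⁻¹ * eLpNorm g 2 volume) := by gcongr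
    _ = _ := by
      rw [← mul_assoc, ← ENNReal.ofReal_mul (by positivity), mul_inv_cancel₀ hκ0.ne',
        ENNReal.ofReal_one, one_mul]

theorem HasHalfFracLap.memLp_gagliardoDiff (hN : 1 ≤ N) (hs0 : 0 < s) (hs1 : s < 1)
    (hκ : IsGagliardoFactor N s κ) {f g : RN N → ℝ} (hf : AEStronglyMeasurable f volume)
    (h : HasHalfFracLap s f g) : MemLp (gagliardoDiff s f) 2 volume := by
  refine ⟨aestronglyMeasurable_gagliardoDiff s hf, ?_⟩
  have h1 := (h.eLpNorm_gagliardoDiff_le hN hs0 hs1 hκ hf).trans_lt h.1.2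
  by_contra hne
  rw [not_lt, top_le_iff] at hne
  rw [hne, ENNReal.mul_top (by simpa using Real.sqrt_pos.2 hκ.1)] at h1
  simp at h1

theorem HasHalfFracLap.sub (hN : 1 ≤ N) (hs0 : 0 < s) (hs1 : s < 1)
    {f₁ g₁ f₂ g₂ : RN N → ℝ} (hf₁ : AEStronglyMeasurable f₁ volume)
    (hf₂ : AEStronglyMeasurable f₂ volume) (h₁ : HasHalfFracLap s f₁ g₁)
    (h₂ : HasHalfFracLap s f₂ g₂) :
    HasHalfFracLap s (fun x => f₁ x - f₂ x) (fun x => g₁ x - g₂ x) := by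
  obtain ⟨hg₁, ψ₁, c₁, hψ₁, hψf₁, hψg₁⟩ := h₁
  obtain ⟨hg₂, ψ₂, c₂, hψ₂, hψf₂, hψg₂⟩ := h₂
  have key : ∀ {μ : Measure (RN N)} {a b : ℕ → RN N → ℝ}, (∀ j, AEStronglyMeasurable (a j) μ) →
      (∀ j, AEStronglyMeasurable (b j) μ) →
      Tendsto (fun j => eLpNorm (a j) 2 μ) atTop (𝓝 0) →
      Tendsto (fun j => eLpNorm (b j) 2 μ) atTop (𝓝 0) →
      Tendsto (fun j => eLpNorm (fun x => a j x - b j x) 2 μ) atTop (𝓝 0) := by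
    intro μ a b ha hb h1 h2
    refine tendsto_of_tendsto_of_tendsto_of_le_of_le tendsto_const_nhds
      (by simpa using h1.add h2) (fun _ => zero_le) fun j => ?_
    exact eLpNorm_sub_le (ha j) (hb j) (by norm_num)
  refine ⟨hg₁.sub hg₂, fun j x => ψ₁ j x - ψ₂ j x, fun j => c₁ j - c₂ j,
    fun j => ⟨(hψ₁ j).1.sub (hψ₂ j).1, (hψ₁ j).2.sub (hψ₂ j).2⟩, fun R => ?_, ?_⟩
  · refine (key (fun j => ?_) (fun j => ?_) (hψf₁ R) (hψf₂ R)).congr fun j => ?_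
    · exact ((((hψ₁ j).1.continuous.sub continuous_const).aestronglyMeasurable).sub hf₁).restrict
    · exact ((((hψ₂ j).1.continuous.sub continuous_const).aestronglyMeasurable).sub hf₂).restrict
    · congr 1; ext x; ring
  · refine (key (fun j => ?_) (fun j => ?_) hψg₁ hψg₂).congr fun j => ?_
    · exact ((memLp_fracLap_half hN hs0 hs1 (hψ₁ j).1 (hψ₁ j).2).sub hg₁).1
    · exact ((memLp_fracLap_half hN hs0 hs1 (hψ₂ j).1 (hψ₂ j).2).sub hg₂).1
    · congr 1; ext x
      rw [fracLap_half_sub hN hs0 hs1 (hψ₁ j).1 (hψ₁ j).2 (hψ₂ j).1 (hψ₂ j).2]; ring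

theorem hasHalfFracLap_of_contDiff (hN : 1 ≤ N) (hs0 : 0 < s) (hs1 : s < 1) {ψ : RN N → ℝ}
    (hψ : ContDiff ℝ ∞ ψ) (hc : HasCompactSupport ψ) :
    HasHalfFracLap s ψ (fracLap (s / 2) ψ) :=
  ⟨memLp_fracLap_half hN hs0 hs1 hψ hc, fun _ => ψ, fun _ => 0, fun _ => ⟨hψ, hc⟩,
    fun R => by simp, by simp⟩

/-- The identity for test functions passes to the limit: the energy of ψ j - f is controlled by the
L² norm of (-Δ)^{s/2} ψ j - g, which tends to 0. -/
theorem HasHalfFracLap.integral_mul_fracLap (hN : 1 ≤ N) (hs0 : 0 < s) (hs1 : s < 1)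
    (hκ : IsGagliardoFactor N s κ) {f g : RN N → ℝ} (hf : AEStronglyMeasurable f volume)
    (h : HasHalfFracLap s f g) {η : RN N → ℝ} (hη : ContDiff ℝ ∞ η) (hηc : HasCompactSupport η) :
    ∫ x, g x * fracLap (s / 2) η x = κ * ∫ p, gagliardoDiff s f p * gagliardoDiff s η p := by
  have hD := h.memLp_gagliardoDiff hN hs0 hs1 hκ hf
  have hκ0 : 0 < √κ := Real.sqrt_pos.2 hκ.1
  obtain ⟨ψ, c, hψ, -, hψg⟩ := h.2
  have hconv : Tendsto (fun j => eLpNorm (fun p => gagliardoDiff s (ψ j) p - gagliardoDiff s f p) 2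
      volume) atTop (𝓝 0) := by
    have hb : ∀ j, eLpNorm (fun p => gagliardoDiff s (ψ j) p - gagliardoDiff s f p) 2 volume ≤
        ENNReal.ofReal (√κ)⁻¹ * eLpNorm (fun x => fracLap (s / 2) (ψ j) x - g x) 2 volume := by
      intro j
      have hm := (hψ j).1.continuous.aestronglyMeasurable (μ := (volume : Measure (RN N)))
      have h1 := ((hasHalfFracLap_of_contDiff hN hs0 hs1 (hψ j).1 (hψ j).2).sub hN hs0 hs1 hm hf
        h).eLpNorm_gagliardoDiff_le hN hs0 hs1 hκ (hm.sub hf)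
      rw [show gagliardoDiff s (ψ j - f) =
        fun p => gagliardoDiff s (ψ j) p - gagliardoDiff s f p from
          funext (gagliardoDiff_sub s (ψ j) f)] at h1
      calc _ = ENNReal.ofReal (√κ)⁻¹ * (ENNReal.ofReal (√κ) *
              eLpNorm (fun p => gagliardoDiff s (ψ j) p - gagliardoDiff s f p) 2 volume) := by
            rw [← mul_assoc, ← ENNReal.ofReal_mul (by positivity), inv_mul_cancel₀ hκ0.ne',
              ENNReal.ofReal_one, one_mul]
        _ ≤ _ := by gcongr
    refine tendsto_of_tendsto_of_tendsto_of_le_of_le tendsto_const_nhds ?_ (fun _ => zero_le) hb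
    simpa using ENNReal.Tendsto.const_mul (a := ENNReal.ofReal (√κ)⁻¹) hψg
      (Or.inr ENNReal.ofReal_ne_top)
  have t1 := tendsto_integral_mul_of_tendsto_eLpNorm
    (fun j => memLp_fracLap_half hN hs0 hs1 (hψ j).1 (hψ j).2) h.1
    (memLp_fracLap_half hN hs0 hs1 hη hηc) hψg
  have t2 := (tendsto_integral_mul_of_tendsto_eLpNorm
    (fun j => _root_.memLp_gagliardoDiff hN hs0 hs1 (hψ j).1 (hψ j).2) hD
    (_root_.memLp_gagliardoDiff hN hs0 hs1 hη hηc) hconv).const_mul κ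
  refine tendsto_nhds_unique t1 (t2.congr fun j => ?_)
  exact (hκ.2 (ψ j) η (hψ j).1 (hψ j).2 hη hηc).symm

end HomogeneousSobolev
end

noncomputable section

/-! ### Approximation by test functions -/

section Approximation

variable {N : ℕ} {s : ℝ}

/-- Bounded almost everywhere convergence together with convergence of the Gagliardo energy. -/
structure EnergyConverges (s : ℝ) (η : ℕ → RN N → ℝ) (η₀ : RN N → ℝ) : Prop where
  bound : ∃ B, ∀ j x, |η j x| ≤ B
  measurable : ∀ j, AEStronglyMeasurable (η j) volume
  ae_tendsto : ∀ᵐ x, Tendsto (fun j => η j x) atTop (𝓝 (η₀ x))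
  energy : Tendsto (fun j => eLpNorm (fun p => gagliardoDiff s (η j) p - gagliardoDiff s η₀ p) 2
    volume) atTop (𝓝 0)

theorem tendsto_eLpNorm_two_of_dominated {X : Type*} [MeasurableSpace X] {μ : Measure X}
    {F : ℕ → X → ℝ} {G : X → ℝ} (hF : ∀ j, AEStronglyMeasurable (F j) μ) (hG : MemLp G 2 μ)
    (hb : ∀ j, ∀ᵐ x ∂μ, |F j x| ≤ G x) (hlim : ∀ᵐ x ∂μ, Tendsto (fun j => F j x) atTop (𝓝 0)) :
    Tendsto (fun j => eLpNorm (F j) 2 μ) atTop (𝓝 0) := by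
  have h : Tendsto (fun j => eLpNorm (F j) 2 μ ^ 2) atTop (𝓝 0) := by
    simp_rw [eLpNorm_two_sq_eq_lintegral]
    have := tendsto_lintegral_of_dominated_convergence' (μ := μ)
      (F := fun j x => ENNReal.ofReal (F j x ^ 2)) (f := fun _ => 0)
      (fun x => ENNReal.ofReal (G x ^ 2))
      (fun j => ((hF j).aemeasurable.pow_const 2).ennreal_ofReal)
      (fun j => (hb j).mono fun x hx => ENNReal.ofReal_le_ofReal (by
        rw [← sq_abs]; exact pow_le_pow_left₀ (abs_nonneg _) hx 2))
      (by rw [← eLpNorm_two_sq_eq_lintegral]; exact ENNReal.pow_ne_top hG.2.ne)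
      (hlim.mono fun x hx => by
        simpa using ENNReal.tendsto_ofReal (hx.pow 2))
    simpa using this
  have h2 := ((ENNReal.continuous_rpow_const (y := 1 / 2)).tendsto 0).comp h
  rw [ENNReal.zero_rpow_of_pos (by norm_num)] at h2
  refine h2.congr fun j => ?_
  rw [Function.comp_apply, ← ENNReal.rpow_natCast, ← ENNReal.rpow_mul]
  norm_num

theorem measurable_gagliardoDiff (s : ℝ) {f : RN N → ℝ} (hf : Measurable f) :
    Measurable (gagliardoDiff s f) := by
  unfold gagliardoDiff
  fun_prop

/-- Translating x while keeping the step fixed commutes with `gagliardoDiff`, so averaging over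
translations can be estimated by Jensen and Fubini. -/
theorem eLpNorm_gagliardoDiff_average_sub_le {ν : Measure (RN N)} [IsProbabilityMeasure ν]
    {η : RN N → ℝ} (hη : Measurable η) {B : ℝ} (hB : ∀ x, |η x| ≤ B) {ε : ENNReal}
    (hν : ∀ᵐ z ∂ν, eLpNorm
      (fun p : RN N × RN N => gagliardoDiff s η (p + (-z, 0)) - gagliardoDiff s η p) 2 volume ≤ ε) :
    eLpNorm (fun p => gagliardoDiff s (fun x => ∫ z, η (x - z) ∂ν) p - gagliardoDiff s η p) 2
      volume ≤ ε := by
  have h_int : ∀ x, Integrable (fun z => η (x - z)) ν := fun x =>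
    Integrable.of_bound (hη.comp (measurable_const.sub measurable_id)).aestronglyMeasurable B (Eventually.of_forall fun z => hB _)
  have hD := measurable_gagliardoDiff s hη
  have e : ∀ p : RN N × RN N, gagliardoDiff s (fun x => ∫ z, η (x - z) ∂ν) p - gagliardoDiff s η p =
      ∫ z, (gagliardoDiff s η (p + (-z, 0)) - gagliardoDiff s η p) ∂ν := by
    intro p
    have h1 : ∀ z, gagliardoDiff s η (p + (-z, 0)) =
        (η (p.1 - z) - η (p.1 - p.2 - z)) * ‖p.2‖ ^ (-((N : ℝ) / 2 + s)) := by
      intro z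
      simp only [gagliardoDiff, Prod.fst_add, Prod.snd_add, add_zero, ← sub_eq_add_neg]
      rw [sub_right_comm]
    simp_rw [h1]
    have hsub : Integrable (fun z => η (p.1 - z) - η (p.1 - p.2 - z)) ν := (h_int _).sub (h_int _)
    rw [integral_sub (hsub.mul_const _) (integrable_const _), integral_mul_const, integral_sub (h_int _) (h_int _)]
    simp [gagliardoDiff]
  have hpt : ∀ p : RN N × RN N,
      ENNReal.ofReal ((gagliardoDiff s (fun x => ∫ z, η (x - z) ∂ν) p - gagliardoDiff s η p) ^ 2) ≤
        ∫⁻ z, ENNReal.ofReal ((gagliardoDiff s η (p + (-z, 0)) - gagliardoDiff s η p) ^ 2) ∂ν := by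
    intro p
    rw [e]
    have hm : Measurable fun z => gagliardoDiff s η (p + (-z, 0)) - gagliardoDiff s η p := by
      fun_prop
    exact ofReal_sq_integral_le hm.aestronglyMeasurable
  rw [← ENNReal.pow_le_pow_left_iff two_ne_zero, eLpNorm_two_sq_eq_lintegral]
  refine (lintegral_mono hpt).trans ?_
  rw [lintegral_lintegral_swap]
  · calc _ ≤ ∫⁻ z, ε ^ 2 ∂ν := by
          refine lintegral_mono_ae (hν.mono fun z hz => ?_)
          rw [← eLpNorm_two_sq_eq_lintegral]
          gcongr
      _ = ε ^ 2 := by simp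
  · refine Measurable.aemeasurable ?_
    simp only [Function.uncurry_def]
    fun_prop

theorem exists_test_approx_of_compactSupport {η : RN N → ℝ} (hη : Measurable η) {B : ℝ}
    (hB : ∀ x, |η x| ≤ B) (hc : HasCompactSupport η) (hD : MemLp (gagliardoDiff s η) 2 volume) :
    ∃ ψ : ℕ → RN N → ℝ, (∀ j, ContDiff ℝ ∞ (ψ j) ∧ HasCompactSupport (ψ j)) ∧
      EnergyConverges s ψ η := by
  have hloc : LocallyIntegrable η volume :=
    (memLp_top_of_bound hη.aestronglyMeasurable B (Eventually.of_forall hB)).locallyIntegrable le_top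
  -- The ratio of outer to inner radius stays equal to 2, as Lebesgue differentiation for the
  -- mollified functions requires.
  let φ : ℕ → ContDiffBump (0 : RN N) := fun j =>
    ⟨1 / ((j : ℝ) + 1), 2 / ((j : ℝ) + 1), by positivity, by gcongr; norm_num⟩
  have hφr : Tendsto (fun j => (φ j).rOut) atTop (𝓝 0) := by
    have := (tendsto_one_div_add_atTop_nhds_zero_nat (𝕜 := ℝ)).const_mul 2
    simpa [φ, div_eq_mul_inv] using this
  let ν : ℕ → Measure (RN N) := fun j =>
    volume.withDensity fun z => ENNReal.ofReal ((φ j).normed volume z)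
  have hmeas : ∀ j, Measurable fun z => ENNReal.ofReal ((φ j).normed volume z) := fun j =>
    ((φ j).contDiff_normed (n := 0)).continuous.measurable.ennreal_ofReal
  have hν : ∀ j, IsProbabilityMeasure (ν j) := fun j => ⟨by
    rw [withDensity_apply _ MeasurableSet.univ, setLIntegral_univ,
      ← ofReal_integral_eq_lintegral_ofReal (φ j).integrable_normed
        (Eventually.of_forall (φ j).nonneg_normed), (φ j).integral_normed, ENNReal.ofReal_one]⟩
  set ψ : ℕ → RN N → ℝ := fun j => convolution ((φ j).normed volume) η
    (ContinuousLinearMap.lsmul ℝ ℝ) volume with hψ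
  have hψν : ∀ j, ψ j = fun x => ∫ z, η (x - z) ∂(ν j) := by
    intro j
    ext x
    rw [hψ]
    simp only [convolution_def, ContinuousLinearMap.lsmul_apply, ν]
    rw [integral_withDensity_eq_integral_toReal_smul (hmeas j) (by simp)]
    simp only [ENNReal.toReal_ofReal ((φ j).nonneg_normed _)]
  refine ⟨ψ, fun j => ⟨(φ j).hasCompactSupport_normed.contDiff_convolution_left _
    (φ j).contDiff_normed hloc, (φ j).hasCompactSupport_normed.convolution _ hc⟩, ?_⟩
  refine ⟨⟨B, fun j x => ?_⟩, fun j => ?_, ?_, ?_⟩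
  · rw [hψν]
    have := norm_integral_le_of_norm_le_const (μ := ν j) (f := fun z => η (x - z))
      (Eventually.of_forall fun z => hB (x - z))
    simpa using this
  · exact ((φ j).hasCompactSupport_normed.contDiff_convolution_left (n := 0) _
      (φ j).contDiff_normed hloc).continuous.aestronglyMeasurable
  · refine ContDiffBump.ae_convolution_tendsto_right_of_locallyIntegrable (K := 2) hφr
      (Eventually.of_forall fun j => ?_) hloc
    simp only [φ]
    rw [mul_one_div]
  · rw [ENNReal.tendsto_nhds_zero]
    intro ε hε
    have hinv : (volume : Measure (RN N × RN N)).IsAddRightInvariant :=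
      inferInstanceAs ((volume : Measure (RN N)).prod (volume : Measure (RN N))).IsAddRightInvariant
    have ht := tendsto_eLpNorm_translate_sub hD
    have hz : Tendsto (fun z : RN N => ((-z, 0) : RN N × RN N)) (𝓝 0) (𝓝 0) := by
      have : Continuous fun z : RN N => ((-z, 0) : RN N × RN N) := by fun_prop
      have h0 := this.tendsto 0
      rw [neg_zero] at h0
      exact h0
    have h1 := (ENNReal.tendsto_nhds_zero.1 (ht.comp hz)) ε hε
    obtain ⟨δ, hδ, hδ'⟩ := Metric.eventually_nhds_iff.1 h1
    filter_upwards [hφr.eventually (gt_mem_nhds hδ)] with j hj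
    rw [hψν]
    refine eLpNorm_gagliardoDiff_average_sub_le hη hB ?_
    rw [ae_withDensity_iff (hmeas j)]
    refine Eventually.of_forall fun z hz0 => ?_
    refine hδ' ?_
    have : z ∈ Function.support ((φ j).normed volume) := by
      intro h0
      exact hz0 (by rw [h0]; simp)
    rw [(φ j).support_normed_eq] at this
    exact (Metric.mem_ball.1 this).trans hj

/-- Multiplication by dilated cutoffs. Dilation by a factor at least 1 does not worsen their
difference bound, so one square integrable function dominates all the errors. -/
theorem exists_compactSupport_approx (hN : 1 ≤ N) (hs0 : 0 < s) (hs1 : s < 1) {η : RN N → ℝ}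
    (hη : Measurable η) {B : ℝ} (hB : ∀ x, |η x| ≤ B) (hI : Integrable η)
    (hD : MemLp (gagliardoDiff s η) 2 volume) :
    ∃ ψ : ℕ → RN N → ℝ, (∀ j, Measurable (ψ j) ∧ (∀ x, |ψ j x| ≤ B) ∧ HasCompactSupport (ψ j) ∧
      MemLp (gagliardoDiff s (ψ j)) 2 volume) ∧ EnergyConverges s ψ η := by
  let χ : ContDiffBump (0 : RN N) := ⟨1, 2, one_pos, one_lt_two⟩
  obtain ⟨C, hC, hχ, -, -⟩ := exists_difference_bounds χ.contDiff χ.hasCompactSupport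
  set r : ℕ → ℝ := fun n => 1 / ((n : ℝ) + 1) with hr
  have hr0 : ∀ n, 0 < r n := fun n => by positivity
  have hr1 : ∀ n, r n ≤ 1 := fun n => by
    rw [hr]; simp only; rw [div_le_one (by positivity)]; linarith [n.cast_nonneg (α := ℝ)]
  set X : ℕ → RN N → ℝ := fun n x => χ (r n • x) with hX
  have hXc : ∀ n, Continuous (X n) := fun n => χ.continuous.comp (by fun_prop)
  have hX0 : ∀ n x, 0 ≤ X n x := fun n x => χ.nonneg
  have hX1 : ∀ n x, X n x ≤ 1 := fun n x => χ.le_one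
  have hXd : ∀ n x h, |X n x - X n (x - h)| ≤ C * min 1 ‖h‖ := by
    intro n x h
    have h1 := hχ (r n • x) (r n • h)
    rw [← smul_sub] at h1
    refine h1.trans ?_
    gcongr
    rw [norm_smul, Real.norm_of_nonneg (hr0 n).le]
    exact mul_le_of_le_one_left (norm_nonneg _) (hr1 n)
  have hXlim : ∀ x, ∀ᶠ n in atTop, X n x = 1 := by
    intro x
    have : Tendsto (fun n => r n * ‖x‖) atTop (𝓝 0) := by
      have := (tendsto_one_div_add_atTop_nhds_zero_nat (𝕜 := ℝ)).mul_const ‖x‖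
      rwa [zero_mul] at this
    filter_upwards [this.eventually (gt_mem_nhds one_pos)] with n hn
    refine χ.one_of_mem_closedBall ?_
    rw [mem_closedBall_zero_iff, norm_smul, Real.norm_of_nonneg (hr0 n).le]
    exact hn.le
  set ψ : ℕ → RN N → ℝ := fun n x => X n x * η x with hψ
  have hψm : ∀ n, Measurable (ψ n) := fun n => (hXc n).measurable.mul hη
  have hη2 : Integrable (fun x => η x ^ 2) :=
    (hI.memLp_two_of_bound (Eventually.of_forall hB)).integrable_sq
  have hK : Integrable (fun h : RN N => (min 1 ‖h‖ * ‖h‖ ^ (-((N : ℝ) / 2 + s))) ^ 2) := by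
    refine (integrable_min_one_norm_rpow_mul hN (a := 2) (b := 2 * s) (by positivity)
      (by linarith)).congr (Eventually.of_forall fun h => ?_)
    simp only
    rw [mul_pow, ← Real.rpow_natCast (‖h‖ ^ _), ← Real.rpow_mul (norm_nonneg _), Real.rpow_two]
    congr 1
    · rcases le_total 1 ‖h‖ with h3 | h3
      · rw [min_eq_left h3, min_eq_left (one_le_pow₀ h3)]; norm_num
      · rw [min_eq_right h3, min_eq_right (pow_le_one₀ (norm_nonneg _) h3)]
    · congr 1; push_cast; ring
  have hG2 : MemLp (fun p : RN N × RN N =>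
      |η p.1| * (min 1 ‖p.2‖ * ‖p.2‖ ^ (-((N : ℝ) / 2 + s)))) 2 volume := by
    rw [memLp_two_iff_integrable_sq (Measurable.aestronglyMeasurable (by fun_prop))]
    refine (hη2.mul_prod hK).congr (Eventually.of_forall fun p => ?_)
    simp only [mul_pow, sq_abs]
  have hG := hD.norm.add (hG2.const_mul C)
  have hmd : ∀ n, AEStronglyMeasurable
      (fun p => gagliardoDiff s (ψ n) p - gagliardoDiff s η p) volume := fun n =>
    ((measurable_gagliardoDiff s (hψm n)).sub (measurable_gagliardoDiff s hη)).aestronglyMeasurable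
  have hbd : ∀ n p, |gagliardoDiff s (ψ n) p - gagliardoDiff s η p| ≤
      ‖gagliardoDiff s η p‖ + C * (|η p.1| * (min 1 ‖p.2‖ * ‖p.2‖ ^ (-((N : ℝ) / 2 + s)))) := by
    intro n p
    set k := ‖p.2‖ ^ (-((N : ℝ) / 2 + s)) with hk
    have hk0 : 0 ≤ k := by positivity
    -- A discrete Leibniz rule: the first term is dominated by the energy density of η, the second
    -- by |η| times the difference bound of the cutoff, which is square integrable because s < 1.
    have e : gagliardoDiff s (ψ n) p - gagliardoDiff s η p =
        (X n (p.1 - p.2) - 1) * gagliardoDiff s η p +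
          (X n p.1 - X n (p.1 - p.2)) * (η p.1 * k) := by
      simp only [gagliardoDiff, hψ, ← hk]; ring
    rw [e]
    refine (abs_add_le _ _).trans (add_le_add ?_ ?_)
    · rw [abs_mul, Real.norm_eq_abs]
      refine mul_le_of_le_one_left (abs_nonneg _) ?_
      rw [abs_le]
      constructor <;> linarith [hX0 n (p.1 - p.2), hX1 n (p.1 - p.2)]
    · rw [abs_mul, abs_mul, abs_of_nonneg hk0]
      calc _ ≤ (C * min 1 ‖p.2‖) * (|η p.1| * k) := by gcongr; exact hXd n _ _
        _ = _ := by ring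
  have hdom : ∀ n, MemLp (fun p => gagliardoDiff s (ψ n) p - gagliardoDiff s η p) 2 volume :=
    fun n => hG.mono (hmd n) (Eventually.of_forall fun p => (hbd n p).trans (le_abs_self _))
  refine ⟨ψ, fun n => ⟨hψm n, fun x => ?_, ?_, ?_⟩, ⟨⟨B, fun n x => ?_⟩,
    fun n => (hψm n).aestronglyMeasurable, ?_, ?_⟩⟩
  · rw [hψ, abs_mul, abs_of_nonneg (hX0 n x)]
    exact (mul_le_of_le_one_left (abs_nonneg _) (hX1 n x)).trans (hB x)
  · have : HasCompactSupport (X n) :=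
      χ.hasCompactSupport.comp_homeomorph (Homeomorph.smulOfNeZero (r n) (hr0 n).ne')
    exact this.mul_right
  · have := (hdom n).add hD
    refine (memLp_congr_ae (Eventually.of_forall fun p => ?_)).1 this
    simp
  · rw [hψ, abs_mul, abs_of_nonneg (hX0 n x)]
    exact (mul_le_of_le_one_left (abs_nonneg _) (hX1 n x)).trans (hB x)
  · refine Eventually.of_forall fun x => tendsto_const_nhds.congr' ?_
    filter_upwards [hXlim x] with n hn
    rw [hψ]; simp [hn]
  · refine tendsto_eLpNorm_two_of_dominated hmd hG (fun n => Eventually.of_forall (hbd n))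
      (Eventually.of_forall fun p => tendsto_const_nhds.congr' ?_)
    filter_upwards [hXlim p.1, hXlim (p.1 - p.2)] with n h1 h2
    simp [gagliardoDiff, hψ, h1, h2]

/-- A property of test functions that is closed under `EnergyConverges` holds for all bounded
integrable functions of finite energy. -/
theorem energy_induction (hN : 1 ≤ N) (hs0 : 0 < s) (hs1 : s < 1) {P : (RN N → ℝ) → Prop}
    (htest : ∀ ψ, ContDiff ℝ ∞ ψ → HasCompactSupport ψ → P ψ)
    (hclosed : ∀ (ψ : ℕ → RN N → ℝ) (η : RN N → ℝ), (∀ j, P (ψ j)) →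
      (∀ j, MemLp (gagliardoDiff s (ψ j)) 2 volume) → MemLp (gagliardoDiff s η) 2 volume →
      EnergyConverges s ψ η → P η)
    {η : RN N → ℝ} {B : ℝ} (hB : ∀ x, |η x| ≤ B) (hI : Integrable η)
    (hD : MemLp (gagliardoDiff s η) 2 volume) : P η := by
  have hmeas : ∀ η : RN N → ℝ, Measurable η → (∀ x, |η x| ≤ B) → Integrable η →
      MemLp (gagliardoDiff s η) 2 volume → P η := by
    intro η hη hB hI hD
    obtain ⟨ψ, hψ, hψη⟩ := exists_compactSupport_approx hN hs0 hs1 hη hB hI hD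
    refine hclosed ψ η (fun j => ?_) (fun j => (hψ j).2.2.2) hD hψη
    obtain ⟨Ψ, hΨ, hΨψ⟩ := exists_test_approx_of_compactSupport (hψ j).1 (hψ j).2.1
      (hψ j).2.2.1 (hψ j).2.2.2
    exact hclosed Ψ (ψ j) (fun i => htest _ (hΨ i).1 (hΨ i).2)
      (fun i => memLp_gagliardoDiff hN hs0 hs1 (hΨ i).1 (hΨ i).2) (hψ j).2.2.2 hΨψ
  have hB0 : 0 ≤ B := (abs_nonneg _).trans (hB 0)
  obtain ⟨m, hm, hηm⟩ := hI.aestronglyMeasurable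
  -- A measurable representative may exceed B on a null set. Clipping restores the bound everywhere,
  -- as the approximation lemmas demand.
  set η' : RN N → ℝ := fun x => max (-B) (min B (m x)) with hη'
  have hη'm : Measurable η' := by
    have := hm.measurable
    fun_prop
  have hη'B : ∀ x, |η' x| ≤ B := fun x => abs_le.2
    ⟨le_max_left _ _, max_le (by linarith) (min_le_left _ _)⟩
  have hae : η =ᵐ[volume] η' := by
    filter_upwards [hηm] with x hx
    have := abs_le.1 (hB x)
    rw [hη']; simp only
    rw [← hx, min_eq_right this.2, max_eq_right this.1]
  have hDae : gagliardoDiff s η =ᵐ[volume] gagliardoDiff s η' := by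
    have h1 := Measure.quasiMeasurePreserving_fst (μ := (volume : Measure (RN N)))
      (ν := (volume : Measure (RN N))) |>.ae hae
    have h2 := (quasiMeasurePreserving_sub_of_right_invariant
      (volume : Measure (RN N)) (volume : Measure (RN N))).ae hae
    filter_upwards [h1, h2] with p hp1 hp2
    simp only [gagliardoDiff, hp1, hp2]
  have hD' := (memLp_congr_ae hDae).1 hD
  refine hclosed (fun _ => η') η (fun _ => hmeas η' hη'm hη'B (hI.congr hae) hD') (fun _ => hD') hD
    ⟨⟨B, fun _ => hη'B⟩, fun _ => hη'm.aestronglyMeasurable, ?_, ?_⟩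
  · filter_upwards [hae] with x hx
    rw [hx]; exact tendsto_const_nhds
  · refine tendsto_const_nhds.congr fun _ => ?_
    symm
    rw [eLpNorm_congr_ae (g := fun _ => (0 : ℝ)) (by filter_upwards [hDae] with p hp; rw [hp, sub_self])]
    simp

end Approximation
end

noncomputable section

/-! ### Smooth steps and peaks on the line -/

section SmoothStep

/-- A smooth step from `0` to `1` on `[a, a + 1 / (n + 1)]`. -/
def smoothStep (n : ℕ) (a t : ℝ) : ℝ := Real.smoothTransition (((n : ℝ) + 1) * (t - a))

/-- The derivative of `smoothStep`: a nonnegative peak of mass one. -/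
def smoothPeak (n : ℕ) (a t : ℝ) : ℝ := deriv (smoothStep n a) t

theorem contDiff_smoothStep (n : ℕ) (a : ℝ) : ContDiff ℝ ∞ (smoothStep n a) :=
  Real.smoothTransition.contDiff.comp (contDiff_const.mul (contDiff_id.sub contDiff_const))

theorem hasDerivAt_smoothStep (n : ℕ) (a t : ℝ) :
    HasDerivAt (smoothStep n a) (smoothPeak n a t) t :=
  ((contDiff_smoothStep n a).differentiable (by simp) t).hasDerivAt

theorem contDiff_smoothPeak (n : ℕ) (a : ℝ) : ContDiff ℝ ∞ (smoothPeak n a) :=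
  ((contDiff_infty_iff_deriv.1 (contDiff_smoothStep n a))).2

theorem smoothStep_nonneg (n : ℕ) (a t : ℝ) : 0 ≤ smoothStep n a t :=
  Real.smoothTransition.nonneg _

theorem smoothStep_le_one (n : ℕ) (a t : ℝ) : smoothStep n a t ≤ 1 :=
  Real.smoothTransition.le_one _

theorem monotone_smoothStep (n : ℕ) (a : ℝ) : Monotone (smoothStep n a) := fun x y h => by
  refine Real.smoothTransition.monotone ?_
  gcongr

theorem smoothStep_anti (n : ℕ) {a b : ℝ} (h : a ≤ b) (t : ℝ) :
    smoothStep n b t ≤ smoothStep n a t := by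
  refine Real.smoothTransition.monotone ?_
  gcongr

theorem smoothStep_of_le (n : ℕ) {a t : ℝ} (h : t ≤ a) : smoothStep n a t = 0 :=
  Real.smoothTransition.zero_of_nonpos (mul_nonpos_of_nonneg_of_nonpos (by positivity)
    (by linarith))

theorem smoothStep_of_ge (n : ℕ) {a t : ℝ} (h : a + 1 / ((n : ℝ) + 1) ≤ t) :
    smoothStep n a t = 1 := by
  refine Real.smoothTransition.one_of_one_le ?_
  have hn : (0 : ℝ) < (n : ℝ) + 1 := by positivity
  have : 1 / ((n : ℝ) + 1) ≤ t - a := by linarith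
  rw [div_le_iff₀ hn] at this
  linarith

theorem smoothPeak_nonneg (n : ℕ) (a t : ℝ) : 0 ≤ smoothPeak n a t :=
  (monotone_smoothStep n a).deriv_nonneg

theorem mem_Icc_of_smoothPeak_ne_zero {n : ℕ} {a t : ℝ} (h : smoothPeak n a t ≠ 0) :
    t ∈ Icc a (a + 1 / ((n : ℝ) + 1)) := by
  by_contra hne
  refine h ?_
  rw [mem_Icc, not_and_or, not_le, not_le] at hne
  rcases hne with h1 | h1
  · have : smoothStep n a =ᶠ[𝓝 t] fun _ => 0 :=
      (eventually_lt_nhds h1).mono fun y hy => smoothStep_of_le n hy.le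
    rw [smoothPeak, this.deriv_eq, deriv_const]
  · have : smoothStep n a =ᶠ[𝓝 t] fun _ => 1 :=
      (eventually_gt_nhds h1).mono fun y hy => smoothStep_of_ge n (le_of_lt hy)
    rw [smoothPeak, this.deriv_eq, deriv_const]

theorem integrable_smoothPeak (n : ℕ) (a : ℝ) : Integrable (smoothPeak n a) :=
  (contDiff_smoothPeak n a).continuous.integrable_of_hasCompactSupport
    (HasCompactSupport.intro isCompact_Icc fun t ht => by
      by_contra h
      exact ht (mem_Icc_of_smoothPeak_ne_zero h))

theorem integral_smoothPeak (n : ℕ) (a : ℝ) : ∫ t, smoothPeak n a t = 1 := by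
  rw [integral_of_hasDerivAt_of_tendsto (hasDerivAt_smoothStep n a) (integrable_smoothPeak n a)
    (m := 0) (n := 1)]
  · norm_num
  · refine tendsto_const_nhds.congr' ?_
    filter_upwards [eventually_le_atBot a] with t ht
    exact (smoothStep_of_le n ht).symm
  · refine tendsto_const_nhds.congr' ?_
    filter_upwards [eventually_ge_atTop (a + 1 / ((n : ℝ) + 1))] with t ht
    exact (smoothStep_of_ge n ht).symm

theorem tendsto_smoothStep {a t : ℝ} (h : a < t) :
    Tendsto (fun n => smoothStep n a t) atTop (𝓝 1) := by
  refine tendsto_const_nhds.congr' ?_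
  have := (tendsto_one_div_add_atTop_nhds_zero_nat (𝕜 := ℝ)).eventually
    (gt_mem_nhds (sub_pos.2 h))
  filter_upwards [this] with n hn
  exact (smoothStep_of_ge n (by linarith)).symm

/-- Integrals against nonnegative weights of mass one concentrating at a point. -/
theorem tendsto_integral_weight {X : Type*} [PseudoMetricSpace X] [MeasurableSpace X]
    {μ : Measure X} {w : ℕ → X → ℝ} {x₀ : X} {F : X → ℝ} (hw : ∀ n x, 0 ≤ w n x)
    (hwI : ∀ n, Integrable (w n) μ) (hw1 : ∀ n, ∫ x, w n x ∂μ = 1)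
    (hsupp : ∀ ε > 0, ∀ᶠ n in atTop, ∀ x, w n x ≠ 0 → dist x x₀ < ε)
    (hF : ContinuousAt F x₀) (hm : ∀ n, AEStronglyMeasurable (fun x => w n x * F x) μ) :
    Tendsto (fun n => ∫ x, w n x * F x ∂μ) atTop (𝓝 (F x₀)) := by
  rw [Metric.tendsto_nhds]
  intro ε hε
  obtain ⟨δ, hδ, hFδ⟩ := Metric.continuousAt_iff.1 hF (ε / 2) (by positivity)
  filter_upwards [hsupp δ hδ] with n hn
  have hb : ∀ x, |w n x * F x - w n x * F x₀| ≤ w n x * (ε / 2) := by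
    intro x
    rw [← mul_sub, abs_mul, abs_of_nonneg (hw n x)]
    rcases eq_or_ne (w n x) 0 with h | h
    · simp [h]
    · exact mul_le_mul_of_nonneg_left (hFδ (hn x h)).le (hw n x)
  have hdiff : Integrable (fun x => w n x * F x - w n x * F x₀) μ :=
    ((hwI n).mul_const (ε / 2)).mono' ((hm n).sub ((hwI n).mul_const _).aestronglyMeasurable)
      (Eventually.of_forall hb)
  have hwF : Integrable (fun x => w n x * F x) μ := by
    have := hdiff.add ((hwI n).mul_const (F x₀))
    refine this.congr (Eventually.of_forall fun x => ?_)
    simp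
  have e : ∫ x, w n x * F x ∂μ - F x₀ = ∫ x, (w n x * F x - w n x * F x₀) ∂μ := by
    rw [integral_sub hwF ((hwI n).mul_const _), integral_mul_const, hw1, one_mul]
  rw [dist_eq_norm, e]
  calc ‖∫ x, (w n x * F x - w n x * F x₀) ∂μ‖ ≤ ∫ x, w n x * (ε / 2) ∂μ :=
        norm_integral_le_of_norm_le ((hwI n).mul_const _) (Eventually.of_forall hb)
    _ = ε / 2 := by rw [integral_mul_const, hw1, one_mul]
    _ < ε := by linarith

theorem eventually_dist_lt_of_smoothPeak_ne_zero (a : ℝ) {ε : ℝ} (hε : 0 < ε) :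
    ∀ᶠ n : ℕ in atTop, ∀ t, smoothPeak n a t ≠ 0 → dist t a < ε := by
  filter_upwards [(tendsto_one_div_add_atTop_nhds_zero_nat (𝕜 := ℝ)).eventually
    (gt_mem_nhds hε)] with n hn t ht
  have := mem_Icc_of_smoothPeak_ne_zero ht
  rw [Real.dist_eq, abs_of_nonneg (by linarith [this.1])]
  linarith [this.2]

/-- The fundamental theorem of calculus for a weak derivative on `(0, ∞)`. -/
theorem sub_eq_neg_integral_of_weak_deriv {U A : ℝ → ℝ} (hU : ContinuousOn U (Ioi 0))
    (hA : ∀ a b : ℝ, 0 < a → a < b → IntegrableOn A (Ioo a b))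
    (h : ∀ θ : ℝ → ℝ, ContDiff ℝ ∞ θ → HasCompactSupport θ → tsupport θ ⊆ Ioi 0 →
      (∫ t in Ioi (0 : ℝ), U t * deriv θ t) - (∫ t in Ioi (0 : ℝ), A t * θ t) = 0)
    {t₁ t₂ : ℝ} (h₁ : 0 < t₁) (h₁₂ : t₁ < t₂) :
    U t₂ - U t₁ = -∫ t in t₁..t₂, A t := by
  -- Smooth approximations of the indicator of (t₁, t₂]; their derivatives are unit masses
  -- concentrating at t₁ minus unit masses concentrating at t₂.
  set θ : ℕ → ℝ → ℝ := fun n t => smoothStep n t₁ t - smoothStep n t₂ t with hθ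
  have hsupp : ∀ n t, t ∉ Icc t₁ (t₂ + 1) → θ n t = 0 := by
    intro n t ht
    rw [mem_Icc, not_and_or, not_le, not_le] at ht
    rw [hθ]; simp only
    rcases ht with ht | ht
    · rw [smoothStep_of_le n ht.le, smoothStep_of_le n (by linarith), sub_zero]
    · have : 1 / ((n : ℝ) + 1) ≤ 1 := by
        rw [div_le_one (by positivity)]; linarith [n.cast_nonneg (α := ℝ)]
      rw [smoothStep_of_ge n (by linarith), smoothStep_of_ge n (by linarith), sub_self]
  have hθ1 : ∀ n t, |θ n t| ≤ 1 := by
    intro n t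
    rw [abs_le]
    constructor <;> linarith [smoothStep_nonneg n t₁ t, smoothStep_nonneg n t₂ t,
      smoothStep_le_one n t₁ t, smoothStep_le_one n t₂ t]
  have hθd : ∀ n, ContDiff ℝ ∞ (θ n) := fun n =>
    (contDiff_smoothStep n t₁).sub (contDiff_smoothStep n t₂)
  have hts : ∀ n, tsupport (θ n) ⊆ Icc t₁ (t₂ + 1) := fun n =>
    closure_minimal (fun t ht => by
      by_contra hne
      exact ht (hsupp n t hne)) isClosed_Icc
  have key := fun n => h (θ n) (hθd n) (HasCompactSupport.intro isCompact_Icc (hsupp n))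
    ((hts n).trans fun t ht => h₁.trans_le ht.1)
  have hderiv : ∀ n t, deriv (θ n) t = smoothPeak n t₁ t - smoothPeak n t₂ t := fun n t =>
    ((hasDerivAt_smoothStep n t₁ t).sub (hasDerivAt_smoothStep n t₂ t)).deriv
  have hUm : AEStronglyMeasurable U (volume.restrict (Ioi 0)) :=
    hU.aestronglyMeasurable measurableSet_Ioi
  have peak : ∀ a : ℝ, 0 < a → Tendsto (fun n => ∫ t in Ioi (0 : ℝ), smoothPeak n a t * U t) atTop
      (𝓝 (U a)) := by
    intro a ha
    refine tendsto_integral_weight (fun n t => smoothPeak_nonneg n a t)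
      (fun n => (integrable_smoothPeak n a).integrableOn) (fun n => ?_)
      (fun ε hε => eventually_dist_lt_of_smoothPeak_ne_zero a hε)
      (hU.continuousAt (Ioi_mem_nhds ha))
      (fun n => (contDiff_smoothPeak n a).continuous.aestronglyMeasurable.mul hUm)
    rw [setIntegral_eq_integral_of_forall_compl_eq_zero, integral_smoothPeak]
    intro t ht
    by_contra hne
    exact ht (ha.trans_le (mem_Icc_of_smoothPeak_ne_zero hne).1)
  have peakI : ∀ n, ∀ a : ℝ, 0 < a →
      IntegrableOn (fun t => smoothPeak n a t * U t) (Ioi 0) := by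
    intro n a ha
    have hsub : Icc a (a + 1 / ((n : ℝ) + 1)) ⊆ Ioi 0 := fun t ht => ha.trans_le ht.1
    have h1 : IntegrableOn (fun t => smoothPeak n a t * U t) (Icc a (a + 1 / ((n : ℝ) + 1))) :=
      (((contDiff_smoothPeak n a).continuous.continuousOn).mul
        (hU.mono hsub)).integrableOn_compact isCompact_Icc
    refine (h1.integrable_of_forall_notMem_eq_zero fun t ht => ?_).integrableOn
    by_contra hne
    exact ht (mem_Icc_of_smoothPeak_ne_zero (left_ne_zero_of_mul hne))
  have lim1 : Tendsto (fun n => ∫ t in Ioi (0 : ℝ), U t * deriv (θ n) t) atTop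
      (𝓝 (U t₁ - U t₂)) := by
    refine ((peak t₁ h₁).sub (peak t₂ (h₁.trans h₁₂))).congr fun n => ?_
    rw [← integral_sub (peakI n t₁ h₁) (peakI n t₂ (h₁.trans h₁₂))]
    refine integral_congr_ae (Eventually.of_forall fun t => ?_)
    simp only
    rw [hderiv]; ring
  have hA' : IntegrableOn A (Ioo (t₁ / 2) (t₂ + 2)) := hA _ _ (by linarith) (by linarith)
  have hAI : IntegrableOn A (Icc t₁ (t₂ + 1)) :=
    hA'.mono_set fun t ht => ⟨by linarith [ht.1], by linarith [ht.2]⟩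
  have lim2 : Tendsto (fun n => ∫ t in Ioi (0 : ℝ), A t * θ n t) atTop (𝓝 (∫ t in t₁..t₂, A t)) := by
    have e1 : ∀ n, ∫ t in Ioi (0 : ℝ), A t * θ n t = ∫ t in Icc t₁ (t₂ + 1), A t * θ n t := by
      intro n
      have hsub : Icc t₁ (t₂ + 1) ⊆ Ioi 0 := fun t ht => h₁.trans_le ht.1
      rw [setIntegral_eq_of_subset_of_forall_sdiff_eq_zero measurableSet_Ioi hsub]
      intro t ht
      rw [hsupp n t ht.2, mul_zero]
    have e2 : ∫ t in t₁..t₂, A t =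
        ∫ t in Icc t₁ (t₂ + 1), (Ioc t₁ t₂).indicator A t := by
      rw [setIntegral_indicator measurableSet_Ioc, intervalIntegral.integral_of_le h₁₂.le,
        inter_eq_self_of_subset_right]
      exact fun t ht => ⟨ht.1.le, by linarith [ht.2]⟩
    simp_rw [e1]
    rw [e2]
    refine tendsto_integral_of_dominated_convergence (fun t => ‖A t‖)
      (fun n => hAI.aestronglyMeasurable.mul (hθd n).continuous.aestronglyMeasurable) hAI.norm
      (fun n => Eventually.of_forall fun t => ?_) (Eventually.of_forall fun t => ?_)
    · rw [norm_mul]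
      exact mul_le_of_le_one_right (norm_nonneg _) (hθ1 n t)
    · by_cases ht : t ∈ Ioc t₁ t₂
      · rw [indicator_of_mem ht]
        have : Tendsto (fun n => θ n t) atTop (𝓝 1) := by
          refine (tendsto_smoothStep ht.1).congr fun n => ?_
          rw [hθ]; simp only
          rw [smoothStep_of_le n ht.2, sub_zero]
        simpa using this.const_mul (A t)
      · rw [indicator_of_notMem ht]
        have : Tendsto (fun n => θ n t) atTop (𝓝 0) := by
          rw [mem_Ioc, not_and_or, not_lt, not_le] at ht
          rcases ht with ht | ht
          · refine tendsto_const_nhds.congr fun n => ?_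
            rw [hθ]; simp only
            rw [smoothStep_of_le n ht, smoothStep_of_le n (by linarith), sub_zero]
          · have := (tendsto_smoothStep (h₁₂.trans ht)).sub (tendsto_smoothStep ht)
            simpa using this
        simpa using this.const_mul (A t)
  have := tendsto_nhds_unique (lim1.sub lim2) (tendsto_const_nhds.congr fun n => (key n).symm)
  linarith

end SmoothStep
end

noncomputable section

/-! ### Time increments of weak energy solutions -/

section Increments

variable {N : ℕ} {s κ : ℝ}

/-- The weak formulation of `∂ₜ u + (-Δ)^{s/2} g = 0`, with `g` locally square integrable in time. -/
structure IsWeakFlow (s : ℝ) (u g : ℝ → RN N → ℝ) : Prop where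
  continuousInL1 : ContinuousInL1 (Ioi 0) u
  memLp : ∀ a b : ℝ, 0 < a → a < b →
    MemLp (Function.uncurry g) 2 (volume.restrict (Ioo a b ×ˢ (univ : Set (RN N))))
  weak : ∀ ζ : ℝ × RN N → ℝ, IsTestFunction ζ →
    (∫ t in Ioi (0 : ℝ), ∫ x, u t x * deriv (fun τ => ζ (τ, x)) t) -
      (∫ t in Ioi (0 : ℝ), ∫ x, g t x * fracLap (s / 2) (fun y => ζ (t, y)) x) = 0

theorem volume_restrict_prod_univ (I : Set ℝ) :
    (volume : Measure (ℝ × RN N)).restrict (I ×ˢ univ) =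
      (volume.restrict I).prod (volume : Measure (RN N)) := by
  rw [← Measure.restrict_univ (μ := (volume : Measure (RN N))), Measure.prod_restrict]
  rfl

theorem isTestFunction_mul {θ : ℝ → ℝ} (hθ : ContDiff ℝ ∞ θ) (hθc : HasCompactSupport θ)
    (hθs : tsupport θ ⊆ Ioi 0) {η : RN N → ℝ} (hη : ContDiff ℝ ∞ η) (hηc : HasCompactSupport η) :
    IsTestFunction (fun p : ℝ × RN N => θ p.1 * η p.2) := by
  have hsub : tsupport (fun p : ℝ × RN N => θ p.1 * η p.2) ⊆ tsupport θ ×ˢ tsupport η := by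
    refine closure_minimal (fun p hp => ?_) ((isClosed_tsupport θ).prod (isClosed_tsupport η))
    exact ⟨subset_tsupport θ (left_ne_zero_of_mul hp), subset_tsupport η (right_ne_zero_of_mul hp)⟩
  exact ⟨(hθ.comp contDiff_fst).mul (hη.comp contDiff_snd),
    (hθc.isCompact.prod hηc.isCompact).of_isClosed_subset (isClosed_tsupport _) hsub,
    fun p hp => ⟨hθs (hsub hp).1, mem_univ _⟩⟩

theorem toReal_eLpNorm_one {X : Type*} [MeasurableSpace X] {μ : Measure X} {f : X → ℝ}
    (hf : Integrable f μ) : (eLpNorm f 1 μ).toReal = ∫ x, ‖f x‖ ∂μ := by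
  rw [eLpNorm_one_eq_lintegral_enorm, integral_norm_eq_lintegral_enorm hf.aestronglyMeasurable]

theorem continuousOn_integral_mul {I : Set ℝ} {u : ℝ → RN N → ℝ} (hu : ContinuousInL1 I u)
    {η : RN N → ℝ} (hη : AEStronglyMeasurable η volume) {B : ℝ} (hB : ∀ x, |η x| ≤ B) :
    ContinuousOn (fun t => ∫ x, u t x * η x) I := by
  intro t₀ ht₀
  rw [ContinuousWithinAt, tendsto_iff_norm_sub_tendsto_zero]
  have h1 := ((ENNReal.tendsto_toReal ENNReal.zero_ne_top).comp (hu.2 t₀ ht₀)).const_mul B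
  simp only [ENNReal.toReal_zero, mul_zero] at h1
  refine tendsto_of_tendsto_of_tendsto_of_le_of_le' tendsto_const_nhds h1
    (Eventually.of_forall fun _ => norm_nonneg _) ?_
  filter_upwards [self_mem_nhdsWithin] with t ht
  have hi : ∀ r ∈ I, Integrable (fun x => u r x * η x) := fun r hr =>
    (hu.1 r hr).mul_bdd hη (Eventually.of_forall hB)
  have hd := (hu.1 t ht).sub (hu.1 t₀ ht₀)
  rw [← integral_sub (hi t ht) (hi t₀ ht₀), Function.comp_apply,
    toReal_eLpNorm_one hd, ← integral_const_mul]
  refine norm_integral_le_of_norm_le (hd.norm.const_mul B) (Eventually.of_forall fun x => ?_)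
  rw [← sub_mul, norm_mul, mul_comm]
  exact mul_le_mul_of_nonneg_right (hB x) (norm_nonneg _)

theorem aemeasurable_eLpNorm_slice {ν : Measure ℝ} {G : ℝ × RN N → ℝ}
    (hG : AEStronglyMeasurable G (ν.prod volume)) :
    AEMeasurable (fun t => eLpNorm (fun x => G (t, x)) 2 volume) ν := by
  have h := (AEMeasurable.lintegral_prod_right' (μ := ν) (ν := (volume : Measure (RN N)))
    (hG.aemeasurable.pow_const 2).ennreal_ofReal).pow_const (1 / 2 : ℝ)
  refine h.congr (Eventually.of_forall fun t => ?_)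
  simp only
  rw [← eLpNorm_two_sq_eq_lintegral (fun x => G (t, x)), ← ENNReal.rpow_natCast,
    ← ENNReal.rpow_mul]
  norm_num

theorem lintegral_eLpNorm_slice_sq {ν : Measure ℝ} [SFinite ν] {G : ℝ × RN N → ℝ}
    (hG : AEStronglyMeasurable G (ν.prod volume)) :
    ∫⁻ t, eLpNorm (fun x => G (t, x)) 2 volume ^ 2 ∂ν = eLpNorm G 2 (ν.prod volume) ^ 2 := by
  rw [eLpNorm_two_sq_eq_lintegral G, lintegral_prod _ (hG.aemeasurable.pow_const 2).ennreal_ofReal]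
  refine lintegral_congr fun t => ?_
  rw [eLpNorm_two_sq_eq_lintegral]

theorem memLp_toReal_eLpNorm_slice {ν : Measure ℝ} [SFinite ν] {G : ℝ × RN N → ℝ}
    (hG : MemLp G 2 (ν.prod volume)) :
    MemLp (fun t => (eLpNorm (fun x => G (t, x)) 2 volume).toReal) 2 ν := by
  have hm := aemeasurable_eLpNorm_slice hG.1
  refine ⟨hm.ennreal_toReal.aestronglyMeasurable, ?_⟩
  have h : eLpNorm (fun t => (eLpNorm (fun x => G (t, x)) 2 volume).toReal) 2 ν ^ 2 ≤
      eLpNorm G 2 (ν.prod volume) ^ 2 := by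
    rw [eLpNorm_two_sq_eq_lintegral, ← lintegral_eLpNorm_slice_sq hG.1]
    refine lintegral_mono fun t => ?_
    rw [ENNReal.ofReal_pow ENNReal.toReal_nonneg]
    gcongr
    exact ENNReal.ofReal_toReal_le
  exact ((ENNReal.pow_le_pow_left_iff two_ne_zero).1 h).trans_lt hG.2

theorem IsWeakFlow.memLp_prod {u g : ℝ → RN N → ℝ} (h : IsWeakFlow s u g) {a b : ℝ} (ha : 0 < a)
    (hab : a < b) :
    MemLp (Function.uncurry g) 2 ((volume.restrict (Ioo a b)).prod volume) := by
  rw [← volume_restrict_prod_univ]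
  exact h.memLp a b ha hab

theorem memLp_snd_of_finite {ν : Measure ℝ} [IsFiniteMeasure ν] {g₀ : RN N → ℝ}
    (hg₀ : MemLp g₀ 2 volume) : MemLp (fun p : ℝ × RN N => g₀ p.2) 2 (ν.prod volume) :=
  hg₀.comp_snd ν

theorem ae_memLp_slice {ν : Measure ℝ} [SFinite ν] {G : ℝ × RN N → ℝ}
    (hG : MemLp G 2 (ν.prod volume)) : ∀ᵐ t ∂ν, MemLp (fun x => G (t, x)) 2 volume := by
  have h1 := hG.1.prodMk_left
  have h2 : ∀ᵐ t ∂ν, eLpNorm (fun x => G (t, x)) 2 volume ^ 2 < ⊤ := by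
    refine ae_lt_top' ((aemeasurable_eLpNorm_slice hG.1).pow_const 2) ?_
    rw [lintegral_eLpNorm_slice_sq hG.1]
    exact ENNReal.pow_ne_top hG.2.ne
  filter_upwards [h1, h2] with t ht1 ht2
  refine ⟨ht1, ?_⟩
  by_contra hne
  rw [not_lt, top_le_iff] at hne
  rw [hne] at ht2
  simp at ht2

/-- Testing with products θ(t) η(x) leaves a weak ODE in time. Continuity in L¹ makes the pairing
with η continuous, so the increment formula holds for every pair of times, not just almost every
pair. -/
theorem IsWeakFlow.increment_test (hN : 1 ≤ N) (hs0 : 0 < s) (hs1 : s < 1) {u g : ℝ → RN N → ℝ}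
    (h : IsWeakFlow s u g) {η : RN N → ℝ} (hη : ContDiff ℝ ∞ η) (hηc : HasCompactSupport η)
    {t₁ t₂ : ℝ} (h₁ : 0 < t₁) (h₁₂ : t₁ < t₂) :
    (∫ x, u t₂ x * η x) - ∫ x, u t₁ x * η x =
      -∫ t in t₁..t₂, ∫ x, g t x * fracLap (s / 2) η x := by
  obtain ⟨B, hB⟩ := hηc.exists_bound_of_continuous hη.continuous
  have hΛ := memLp_fracLap_half hN hs0 hs1 hη hηc
  refine sub_eq_neg_integral_of_weak_deriv (U := fun t => ∫ x, u t x * η x)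
    (A := fun t => ∫ x, g t x * fracLap (s / 2) η x)
    (continuousOn_integral_mul h.continuousInL1 hη.continuous.aestronglyMeasurable hB)
    (fun a b ha hab => ?_) (fun θ hθ hθc hθs => ?_) h₁ h₁₂
  · have hg := h.memLp_prod ha hab
    have hΛ' : MemLp (fun p : ℝ × RN N => fracLap (s / 2) η p.2) 2
      ((volume.restrict (Ioo a b)).prod volume) := memLp_snd_of_finite hΛ
    exact (hg.integrable_mul hΛ').integral_prod_left
  · have := h.weak _ (isTestFunction_mul hθ hθc hθs hη hηc)
    simp only at this
    have e1 : ∀ t, ∫ x, u t x * deriv (fun τ => θ τ * η x) t = (∫ x, u t x * η x) * deriv θ t := by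
      intro t
      rw [← integral_mul_const]
      refine integral_congr_ae (Eventually.of_forall fun x => ?_)
      simp only
      rw [deriv_mul_const (hθ.differentiable (by simp) t)]
      ring
    have e2 : ∀ t, ∫ x, g t x * fracLap (s / 2) (fun y => θ t * η y) x =
        (∫ x, g t x * fracLap (s / 2) η x) * θ t := by
      intro t
      rw [← integral_mul_const]
      refine integral_congr_ae (Eventually.of_forall fun x => ?_)
      simp only
      rw [fracLap_half_const_mul hN hs0 hs1 hη hηc]
      ring
    simp_rw [e1, e2] at this
    exact this

theorem IsWeakFlow.memLp_norm_sub {u g : ℝ → RN N → ℝ} (h : IsWeakFlow s u g) {g₀ : RN N → ℝ}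
    (hg₀ : MemLp g₀ 2 volume) {a b : ℝ} (ha : 0 < a) (hab : a < b) :
    MemLp (fun t => (eLpNorm (fun x => g t x - g₀ x) 2 volume).toReal) 2
      (volume.restrict (Ioo a b)) :=
  memLp_toReal_eLpNorm_slice (G := fun p => g p.1 p.2 - g₀ p.2)
    ((h.memLp_prod ha hab).sub (memLp_snd_of_finite hg₀))

/-- Freezing g at g₀ isolates the Gagliardo form of f₀, whose sign will be known. The Cauchy–Schwarz
error sees η only through its energy, so the estimate can be extended to rough η. -/
theorem IsWeakFlow.increment_test_le (hN : 1 ≤ N) (hs0 : 0 < s) (hs1 : s < 1)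
    (hκ : IsGagliardoFactor N s κ) {u g : ℝ → RN N → ℝ}
    (h : IsWeakFlow s u g) {f₀ g₀ : RN N → ℝ} (hf₀ : AEStronglyMeasurable f₀ volume)
    (h₀ : HasHalfFracLap s f₀ g₀) {t₁ t₂ : ℝ} (h₁ : 0 < t₁) (h₁₂ : t₁ < t₂)
    {η : RN N → ℝ} (hη : ContDiff ℝ ∞ η) (hηc : HasCompactSupport η) :
    |(∫ x, (u t₂ x - u t₁ x) * η x) +
        (t₂ - t₁) * (κ * ∫ p, gagliardoDiff s f₀ p * gagliardoDiff s η p)| ≤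
      √κ * (∫ t in t₁..t₂, (eLpNorm (fun x => g t x - g₀ x) 2 volume).toReal) *
        (eLpNorm (gagliardoDiff s η) 2 volume).toReal := by
  obtain ⟨B, hB⟩ := hηc.exists_bound_of_continuous hη.continuous
  have hΛ := memLp_fracLap_half hN hs0 hs1 hη hηc
  have h₂ : 0 < t₂ := h₁.trans h₁₂
  have ha : 0 < t₁ / 2 := by linarith
  have hab : t₁ / 2 < t₂ + 1 := by linarith
  have hsub : Ioc t₁ t₂ ⊆ Ioo (t₁ / 2) (t₂ + 1) := fun t ht => ⟨by linarith [ht.1], by linarith [ht.2]⟩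
  have hi : ∀ r, 0 < r → Integrable (fun x => u r x * η x) := fun r hr =>
    (h.continuousInL1.1 r hr).mul_bdd hη.continuous.aestronglyMeasurable (Eventually.of_forall hB)
  have hg := h.memLp_prod ha hab
  have hΛ' : MemLp (fun p : ℝ × RN N => fracLap (s / 2) η p.2) 2
    ((volume.restrict (Ioo (t₁ / 2) (t₂ + 1))).prod volume) := memLp_snd_of_finite hΛ
  have hAI : IntervalIntegrable (fun t => ∫ x, g t x * fracLap (s / 2) η x) volume t₁ t₂ := by
    rw [intervalIntegrable_iff_integrableOn_Ioc_of_le h₁₂.le]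
    exact IntegrableOn.mono_set ((hg.integrable_mul hΛ').integral_prod_left) hsub
  have hnI : IntegrableOn (fun t => (eLpNorm (fun x => g t x - g₀ x) 2 volume).toReal)
      (Ioc t₁ t₂) :=
    IntegrableOn.mono_set ((h.memLp_norm_sub h₀.1 ha hab).integrable (by norm_num)) hsub
  have e : (∫ x, (u t₂ x - u t₁ x) * η x) +
        (t₂ - t₁) * (κ * ∫ p, gagliardoDiff s f₀ p * gagliardoDiff s η p) =
      -∫ t in t₁..t₂, ((∫ x, g t x * fracLap (s / 2) η x) - ∫ x, g₀ x * fracLap (s / 2) η x) := by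
    rw [← h₀.integral_mul_fracLap hN hs0 hs1 hκ hf₀ hη hηc, intervalIntegral.integral_sub hAI
      intervalIntegrable_const, intervalIntegral.integral_const, smul_eq_mul]
    simp_rw [sub_mul]
    rw [integral_sub (hi t₂ h₂) (hi t₁ h₁), h.increment_test hN hs0 hs1 hη hηc h₁ h₁₂]
    ring
  have hpt : ∀ᵐ t ∂(volume.restrict (Ioc t₁ t₂)),
      ‖(∫ x, g t x * fracLap (s / 2) η x) - ∫ x, g₀ x * fracLap (s / 2) η x‖ ≤
        (eLpNorm (fun x => g t x - g₀ x) 2 volume).toReal *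
          (√κ * (eLpNorm (gagliardoDiff s η) 2 volume).toReal) := by
    have hgt := ae_restrict_of_ae_restrict_of_subset hsub (ae_memLp_slice hg)
    filter_upwards [hgt] with t ht
    have ht' : MemLp (g t) 2 volume := ht
    have e1 : (∫ x, g t x * fracLap (s / 2) η x) - ∫ x, g₀ x * fracLap (s / 2) η x =
        ∫ x, (g t x - g₀ x) * fracLap (s / 2) η x := by
      simp_rw [sub_mul]
      exact (integral_sub (ht'.integrable_mul hΛ) (h₀.1.integrable_mul hΛ)).symm
    rw [e1]
    refine (abs_integral_mul_le_eLpNorm_two (ht'.sub h₀.1) hΛ).trans (le_of_eq ?_)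
    rw [eLpNorm_fracLap_half_eq hN hs0 hs1 hκ hη hηc, ENNReal.toReal_mul,
      ENNReal.toReal_ofReal (Real.sqrt_nonneg _)]
    rfl
  rw [e, abs_neg, ← Real.norm_eq_abs, intervalIntegral.integral_of_le h₁₂.le,
    intervalIntegral.integral_of_le h₁₂.le]
  refine (norm_integral_le_of_norm_le (hnI.mul_const _) hpt).trans (le_of_eq ?_)
  rw [integral_mul_const]
  ring

/-- A time increment of a weak flow, tested with a bounded integrable function of finite energy. -/
theorem IsWeakFlow.increment_le (hN : 1 ≤ N) (hs0 : 0 < s) (hs1 : s < 1)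
    (hκ : IsGagliardoFactor N s κ) {u g : ℝ → RN N → ℝ}
    (h : IsWeakFlow s u g) {f₀ g₀ : RN N → ℝ} (hf₀ : AEStronglyMeasurable f₀ volume)
    (h₀ : HasHalfFracLap s f₀ g₀) {t₁ t₂ : ℝ} (h₁ : 0 < t₁) (h₁₂ : t₁ < t₂)
    {η : RN N → ℝ} {B : ℝ} (hB : ∀ x, |η x| ≤ B) (hI : Integrable η)
    (hD : MemLp (gagliardoDiff s η) 2 volume) :
    |(∫ x, (u t₂ x - u t₁ x) * η x) +
        (t₂ - t₁) * (κ * ∫ p, gagliardoDiff s f₀ p * gagliardoDiff s η p)| ≤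
      √κ * (∫ t in t₁..t₂, (eLpNorm (fun x => g t x - g₀ x) 2 volume).toReal) *
        (eLpNorm (gagliardoDiff s η) 2 volume).toReal := by
  refine energy_induction hN hs0 hs1 (P := fun η =>
    |(∫ x, (u t₂ x - u t₁ x) * η x) +
        (t₂ - t₁) * (κ * ∫ p, gagliardoDiff s f₀ p * gagliardoDiff s η p)| ≤
      √κ * (∫ t in t₁..t₂, (eLpNorm (fun x => g t x - g₀ x) 2 volume).toReal) *
        (eLpNorm (gagliardoDiff s η) 2 volume).toReal)
    (fun η hη hηc => h.increment_test_le hN hs0 hs1 hκ hf₀ h₀ h₁ h₁₂ hη hηc) ?_ hB hI hD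
  -- Each term is continuous under `EnergyConverges`: the increment by bounded almost everywhere
  -- convergence, the form and the norm by L² convergence of the weighted differences.
  intro ψ η hP hψD hηD hψ
  have hu : Integrable (fun x => u t₂ x - u t₁ x) :=
    (h.continuousInL1.1 t₂ (h₁.trans h₁₂)).sub (h.continuousInL1.1 t₁ h₁)
  have hDf₀ := h₀.memLp_gagliardoDiff hN hs0 hs1 hκ hf₀
  obtain ⟨B', hB'⟩ := hψ.bound
  have l1 : Tendsto (fun j => ∫ x, (u t₂ x - u t₁ x) * ψ j x) atTop
      (𝓝 (∫ x, (u t₂ x - u t₁ x) * η x)) := by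
    refine tendsto_integral_of_dominated_convergence (fun x => ‖u t₂ x - u t₁ x‖ * B')
      (fun j => hu.aestronglyMeasurable.mul (hψ.measurable j)) (hu.norm.mul_const B')
      (fun j => Eventually.of_forall fun x => ?_) ?_
    · rw [norm_mul]
      exact mul_le_mul_of_nonneg_left (hB' j x) (norm_nonneg _)
    · filter_upwards [hψ.ae_tendsto] with x hx
      exact hx.const_mul _
  have l2 : Tendsto (fun j => ∫ p, gagliardoDiff s f₀ p * gagliardoDiff s (ψ j) p) atTop
      (𝓝 (∫ p, gagliardoDiff s f₀ p * gagliardoDiff s η p)) := by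
    have := tendsto_integral_mul_of_tendsto_eLpNorm hψD hηD hDf₀ hψ.energy
    simpa only [mul_comm] using this
  have l3 := tendsto_toReal_eLpNorm_of_tendsto hψD hηD hψ.energy
  exact le_of_tendsto_of_tendsto' (l1.add ((l2.const_mul κ).const_mul (t₂ - t₁))).abs
    (l3.const_mul _) hP

end Increments
end

noncomputable section

/-! ### Ramps and convex primitives -/

section Ramp

/-- A Lipschitz approximation of the indicator of `(0, ∞)`. -/
def ramp (n : ℕ) (w : ℝ) : ℝ := min 1 (max 0 (((n : ℝ) + 1) * w))

theorem ramp_nonneg (n : ℕ) (w : ℝ) : 0 ≤ ramp n w := le_min zero_le_one (le_max_left _ _)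

theorem ramp_le_one (n : ℕ) (w : ℝ) : ramp n w ≤ 1 := min_le_left _ _

theorem ramp_of_nonpos (n : ℕ) {w : ℝ} (hw : w ≤ 0) : ramp n w = 0 := by
  rw [ramp, max_eq_left (mul_nonpos_of_nonneg_of_nonpos (by positivity) hw)]
  exact min_eq_right zero_le_one

theorem continuous_ramp (n : ℕ) : Continuous (ramp n) := by
  unfold ramp; fun_prop

theorem monotone_ramp (n : ℕ) : Monotone (ramp n) := fun a b h => by
  unfold ramp; gcongr

theorem abs_ramp_sub_le (n : ℕ) (a b : ℝ) : |ramp n a - ramp n b| ≤ ((n : ℝ) + 1) * |a - b| := by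
  unfold ramp
  refine (abs_min_sub_min_le_max _ _ _ _).trans ?_
  rw [sub_self, abs_zero, max_eq_right (abs_nonneg _)]
  refine (abs_max_sub_max_le_max _ _ _ _).trans ?_
  rw [sub_self, abs_zero, max_eq_right (abs_nonneg _), ← mul_sub, abs_mul,
    abs_of_nonneg (by positivity : (0 : ℝ) ≤ (n : ℝ) + 1)]

theorem mul_ramp_sub_nonneg (n : ℕ) (a b : ℝ) : 0 ≤ (a - b) * (ramp n a - ramp n b) := by
  rcases le_total a b with h | h
  · exact mul_nonneg_of_nonpos_of_nonpos (by linarith) (by linarith [monotone_ramp n h])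
  · exact mul_nonneg (by linarith) (by linarith [monotone_ramp n h])

theorem tendsto_ramp {w : ℝ} (hw : 0 < w) : Tendsto (fun n => ramp n w) atTop (𝓝 1) := by
  refine tendsto_const_nhds.congr' ?_
  obtain ⟨m, hm⟩ := exists_nat_gt (1 / w)
  filter_upwards [eventually_ge_atTop m] with n hn
  have h1 : (1 : ℝ) ≤ ((n : ℝ) + 1) * w := by
    rw [div_lt_iff₀ hw] at hm
    have : (m : ℝ) ≤ n := by exact_mod_cast hn
    nlinarith
  rw [ramp, min_eq_left (h1.trans (le_max_right _ _))]

/-- The primitive in `U` of `ramp n (Φ U - Φ c)` vanishing at `c`. -/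
def leftPrimitive (Φ : ℝ → ℝ) (n : ℕ) (U c : ℝ) : ℝ := ∫ r in c..U, ramp n (Φ r - Φ c)

/-- The primitive in `-c` of `ramp n (Φ U - Φ c)` vanishing at `U`. -/
def rightPrimitive (Φ : ℝ → ℝ) (n : ℕ) (U c : ℝ) : ℝ := ∫ r in c..U, ramp n (Φ U - Φ r)

variable {Φ : ℝ → ℝ}

/-- The supporting-line inequality for the convex primitive of q; a and b may come in either order.
-/
theorem Monotone.intervalIntegral_le_mul {q : ℝ → ℝ} (hq : Monotone q) (a b : ℝ) :
    ∫ r in a..b, q r ≤ (b - a) * q b := by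
  rcases le_total a b with h | h
  · calc ∫ r in a..b, q r ≤ ∫ _ in a..b, q b :=
          intervalIntegral.integral_mono_on h hq.intervalIntegrable intervalIntegrable_const
            fun r hr => hq hr.2
      _ = _ := by simp
  · rw [intervalIntegral.integral_symm]
    have : ∫ _ in b..a, q b ≤ ∫ r in b..a, q r :=
      intervalIntegral.integral_mono_on h intervalIntegrable_const hq.intervalIntegrable
            fun r hr => hq hr.1
    rw [intervalIntegral.integral_const, smul_eq_mul] at this
    linarith

/-- Convexity in U. Its counterpart in c is `rightPrimitive_sub_le`: for finite n the two entropies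
differ, but their slopes at (U, c) come from one and the same ramp value, so a single test function
serves both flows. -/
theorem leftPrimitive_sub_le (hΦ : Monotone Φ) (n : ℕ) (U U' c : ℝ) :
    leftPrimitive Φ n U c - leftPrimitive Φ n U' c ≤ (U - U') * ramp n (Φ U - Φ c) := by
  have hq : Monotone fun r => ramp n (Φ r - Φ c) := fun a b h =>
    monotone_ramp n (by linarith [hΦ h])
  rw [leftPrimitive, leftPrimitive, intervalIntegral.integral_interval_sub_left
    hq.intervalIntegrable hq.intervalIntegrable]
  exact hq.intervalIntegral_le_mul U' U

theorem rightPrimitive_sub_le (hΦ : Monotone Φ) (n : ℕ) (U c c' : ℝ) :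
    rightPrimitive Φ n U c - rightPrimitive Φ n U c' ≤ -(c - c') * ramp n (Φ U - Φ c) := by
  have hq : Monotone fun r => -ramp n (Φ U - Φ r) := fun a b h =>
    neg_le_neg (monotone_ramp n (by linarith [hΦ h]))
  have hi : ∀ a b, IntervalIntegrable (fun r => ramp n (Φ U - Φ r)) volume a b := fun a b =>
    Antitone.intervalIntegrable fun x y h => monotone_ramp n (by linarith [hΦ h])
  have h := hq.intervalIntegral_le_mul c' c
  rw [intervalIntegral.integral_neg] at h
  have hadd := intervalIntegral.integral_add_adjacent_intervals (hi c' c) (hi c U)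
  rw [rightPrimitive, rightPrimitive]
  linarith

theorem leftPrimitive_nonneg (hΦ : Monotone Φ) (n : ℕ) (U c : ℝ) : 0 ≤ leftPrimitive Φ n U c := by
  rcases le_total c U with h | h
  · exact intervalIntegral.integral_nonneg h fun r _ => ramp_nonneg n _
  · rw [leftPrimitive, intervalIntegral.integral_zero_ae]
    refine Eventually.of_forall fun r hr => ramp_of_nonpos n ?_
    rw [uIoc_of_ge h] at hr
    linarith [hΦ hr.2]

theorem rightPrimitive_nonneg (hΦ : Monotone Φ) (n : ℕ) (U c : ℝ) :
    0 ≤ rightPrimitive Φ n U c := by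
  rcases le_total c U with h | h
  · exact intervalIntegral.integral_nonneg h fun r _ => ramp_nonneg n _
  · rw [rightPrimitive, intervalIntegral.integral_zero_ae]
    refine Eventually.of_forall fun r hr => ramp_of_nonpos n ?_
    rw [uIoc_of_ge h] at hr
    linarith [hΦ hr.1.le]

/-- The supporting line at U, compared with the zero at c. This uniform bound provides integrability
and domination later on. -/
theorem leftPrimitive_le (hΦ : Monotone Φ) (n : ℕ) (U c : ℝ) :
    leftPrimitive Φ n U c ≤ max 0 (U - c) := by
  have h := leftPrimitive_sub_le hΦ n U c c
  have h0 : leftPrimitive Φ n c c = 0 := by simp [leftPrimitive]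
  rw [h0, sub_zero] at h
  refine h.trans ?_
  rcases le_total 0 (U - c) with h1 | h1
  · rw [max_eq_right h1]; exact mul_le_of_le_one_right h1 (ramp_le_one n _)
  · rw [max_eq_left h1]; exact mul_nonpos_of_nonpos_of_nonneg h1 (ramp_nonneg n _)

theorem rightPrimitive_le (hΦ : Monotone Φ) (n : ℕ) (U c : ℝ) :
    rightPrimitive Φ n U c ≤ max 0 (U - c) := by
  have h := rightPrimitive_sub_le hΦ n U c U
  have h0 : rightPrimitive Φ n U U = 0 := by simp [rightPrimitive]
  rw [h0, sub_zero, neg_sub] at h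
  refine h.trans ?_
  rcases le_total 0 (U - c) with h1 | h1
  · rw [max_eq_right h1]; exact mul_le_of_le_one_right h1 (ramp_le_one n _)
  · rw [max_eq_left h1]; exact mul_nonpos_of_nonpos_of_nonneg h1 (ramp_nonneg n _)

theorem continuous_leftPrimitive (hΦ : Continuous Φ) (n : ℕ) :
    Continuous fun p : ℝ × ℝ => leftPrimitive Φ n p.1 p.2 := by
  have hc : Continuous (Function.uncurry fun (p : ℝ × ℝ) (r : ℝ) => ramp n (Φ r - Φ p.2)) := by
    have := continuous_ramp n
    fun_prop
  have h1 := intervalIntegral.continuous_parametric_intervalIntegral_of_continuous (μ := volume)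
    (a₀ := 0) hc continuous_fst
  have h2 := intervalIntegral.continuous_parametric_intervalIntegral_of_continuous (μ := volume)
    (a₀ := 0) hc continuous_snd
  refine (h1.sub h2).congr fun p => ?_
  have hi : ∀ a b, IntervalIntegrable (fun r => ramp n (Φ r - Φ p.2)) volume a b := fun a b =>
    Continuous.intervalIntegrable (by have := continuous_ramp n; fun_prop) a b
  exact intervalIntegral.integral_interval_sub_left (hi _ _) (hi _ _)

theorem continuous_rightPrimitive (hΦ : Continuous Φ) (n : ℕ) :
    Continuous fun p : ℝ × ℝ => rightPrimitive Φ n p.1 p.2 := by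
  have hc : Continuous (Function.uncurry fun (p : ℝ × ℝ) (r : ℝ) => ramp n (Φ p.1 - Φ r)) := by
    have := continuous_ramp n
    fun_prop
  have h1 := intervalIntegral.continuous_parametric_intervalIntegral_of_continuous (μ := volume)
    (a₀ := 0) hc continuous_fst
  have h2 := intervalIntegral.continuous_parametric_intervalIntegral_of_continuous (μ := volume)
    (a₀ := 0) hc continuous_snd
  refine (h1.sub h2).congr fun p => ?_
  have hi : ∀ a b, IntervalIntegrable (fun r => ramp n (Φ p.1 - Φ r)) volume a b := fun a b =>
    Continuous.intervalIntegrable (by have := continuous_ramp n; fun_prop) a b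
  exact intervalIntegral.integral_interval_sub_left (hi _ _) (hi _ _)

theorem tendsto_integral_ramp {w : ℝ → ℝ} (hw : Continuous w) {c U : ℝ} (hcU : c ≤ U)
    (hpos : ∀ r ∈ Ioo c U, 0 < w r) :
    Tendsto (fun n => ∫ r in c..U, ramp n (w r)) atTop (𝓝 (U - c)) := by
  have h : U - c = ∫ _ in c..U, (1 : ℝ) := by simp
  rw [h]
  refine intervalIntegral.tendsto_integral_filter_of_dominated_convergence (fun _ => 1)
    (Eventually.of_forall fun n =>
      ((continuous_ramp n).comp hw).aestronglyMeasurable)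
    (Eventually.of_forall fun n => Eventually.of_forall fun r _ => ?_)
    intervalIntegrable_const ?_
  · rw [Real.norm_of_nonneg (ramp_nonneg n _)]; exact ramp_le_one n _
  · have : ∀ᵐ r : ℝ, r ≠ U := by simp [ae_iff]
    filter_upwards [this] with r hr hr'
    rw [uIoc_of_le hcU] at hr'
    exact tendsto_ramp (hpos r ⟨hr'.1, lt_of_le_of_ne hr'.2 hr⟩)

/-- Strict monotonicity above c is essential: the ramps tend to 1 only where Φ r exceeds Φ c. -/
theorem tendsto_leftPrimitive (hΦ : Monotone Φ) (hΦc : Continuous Φ) {U c : ℝ}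
    (hs : StrictMonoOn Φ (Ici c)) :
    Tendsto (fun n => leftPrimitive Φ n U c) atTop (𝓝 (max 0 (U - c))) := by
  rcases le_total c U with h | h
  · rw [max_eq_right (by linarith)]
    exact tendsto_integral_ramp (by fun_prop) h fun r hr =>
      sub_pos.2 (hs (mem_Ici.2 le_rfl) (mem_Ici.2 hr.1.le) hr.1)
  · refine tendsto_const_nhds.congr fun n => le_antisymm ?_ ?_
    · rw [max_eq_left (by linarith)]; exact leftPrimitive_nonneg hΦ n U c
    · exact leftPrimitive_le hΦ n U c

theorem tendsto_rightPrimitive (hΦ : Monotone Φ) (hΦc : Continuous Φ) {U c : ℝ}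
    (hs : StrictMonoOn Φ (Ici c)) :
    Tendsto (fun n => rightPrimitive Φ n U c) atTop (𝓝 (max 0 (U - c))) := by
  rcases le_total c U with h | h
  · rw [max_eq_right (by linarith)]
    exact tendsto_integral_ramp (by fun_prop) h fun r hr =>
      sub_pos.2 (hs (mem_Ici.2 hr.1.le) (mem_Ici.2 h) hr.2)
  · refine tendsto_const_nhds.congr fun n => le_antisymm ?_ ?_
    · rw [max_eq_left (by linarith)]; exact rightPrimitive_nonneg hΦ n U c
    · exact rightPrimitive_le hΦ n U c

end Ramp
end

noncomputable section

/-! ### The doubling inequality at fixed times -/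

section Doubling

variable {N : ℕ} {s κ : ℝ} {φ : ℝ → ℝ} {ε : ℝ}

/-- Flattening φ below ε gives an everywhere continuous monotone function, from which the entropies
are built. -/
theorem IsSingularNonlinearity.monotone_cutoff (hφ : IsSingularNonlinearity φ) (hε : 0 < ε) :
    Monotone fun r => φ (max r ε) := fun _ _ h =>
  hφ.strictMono.monotoneOn (lt_max_of_lt_right hε) (lt_max_of_lt_right hε) (max_le_max h le_rfl)

theorem IsSingularNonlinearity.continuous_cutoff (hφ : IsSingularNonlinearity φ) (hε : 0 < ε) :
    Continuous fun r => φ (max r ε) :=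
  hφ.continuous.comp_continuous (by fun_prop) fun _ => lt_max_of_lt_right hε

theorem IsSingularNonlinearity.strictMonoOn_cutoff (hφ : IsSingularNonlinearity φ) (hε : 0 < ε)
    {c : ℝ} (hc : ε ≤ c) : StrictMonoOn (fun r => φ (max r ε)) (Ici c) := by
  intro a ha b hb hab
  have ha' : ε ≤ a := hc.trans ha
  have hb' : ε ≤ b := hc.trans hb
  simp only
  rw [max_eq_left ha', max_eq_left hb']
  exact hφ.strictMono (hε.trans_le ha') (hε.trans_le hb') hab

/-- The flattening is invisible to the ramp: if U ≤ ε ≤ c, both arguments are nonpositive and both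
ramps vanish. -/
theorem IsSingularNonlinearity.ramp_cutoff (hφ : IsSingularNonlinearity φ) (hε : 0 < ε) (n : ℕ)
    {U c : ℝ} (hU : 0 < U) (hc : ε ≤ c) :
    ramp n (φ (max U ε) - φ (max c ε)) = ramp n (φ U - φ c) := by
  rw [max_eq_left hc]
  rcases le_total ε U with h | h
  · rw [max_eq_left h]
  · have hc0 : 0 < c := hε.trans_le hc
    have h1 := hφ.strictMono.monotoneOn hε hc0 hc
    have h2 := hφ.strictMono.monotoneOn hU hε h
    rw [max_eq_right h, ramp_of_nonpos n (by linarith), ramp_of_nonpos n (by linarith)]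

theorem max_zero_sub_le (a b : ℝ) (hε : 0 < ε) : max 0 (a - (b + ε)) ≤ |a - b| :=
  max_le (abs_nonneg _) (by linarith [le_abs_self (a - b)])

theorem integrable_of_le_max {a b : RN N → ℝ} (ha : Integrable a) (hb : Integrable b)
    (hε : 0 < ε) {L : ℝ → ℝ → ℝ} (hL : Continuous fun p : ℝ × ℝ => L p.1 p.2)
    (hL0 : ∀ U c, 0 ≤ L U c) (hL1 : ∀ U c, L U c ≤ max 0 (U - c)) :
    Integrable fun x => L (a x) (b x + ε) := by
  refine (ha.sub hb).norm.mono' ?_ (Eventually.of_forall fun x => ?_)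
  · exact hL.comp_aestronglyMeasurable
      (ha.aestronglyMeasurable.prodMk (hb.aestronglyMeasurable.add_const ε))
  · rw [Real.norm_of_nonneg (hL0 _ _)]
    exact (hL1 _ _).trans (max_zero_sub_le _ _ hε)

theorem aestronglyMeasurable_comp_singular (hφ : IsSingularNonlinearity φ) {a : RN N → ℝ}
    (ha : AEStronglyMeasurable a volume) (hpos : ∀ᵐ x, 0 < a x) :
    AEStronglyMeasurable (fun x => φ (a x)) volume := by
  classical
  have hm : Measurable (fun r : ℝ => (Ioi (0 : ℝ)).piecewise φ (fun _ => 0) r) :=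
    hφ.continuous.measurable_piecewise continuousOn_const measurableSet_Ioi
  refine (hm.comp_aemeasurable ha.aemeasurable).aestronglyMeasurable.congr ?_
  filter_upwards [hpos] with x hx
  exact piecewise_eq_of_mem (Ioi (0 : ℝ)) φ (fun _ => 0) (mem_Ioi.2 hx)

/-- The pointwise convexity inequalities, integrated. Each entropy is stepped in one variable only,
with the other frozen at its final value. -/
theorem entropy_increment_le (hφ : IsSingularNonlinearity φ) (hε : 0 < ε) (n : ℕ)
    {a a' b b' : RN N → ℝ} (ha : Integrable a) (ha' : Integrable a') (hb : Integrable b)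
    (hb' : Integrable b') (hapos : ∀ᵐ x, 0 < a x) (hbnn : ∀ᵐ x, 0 ≤ b x) :
    ((∫ x, leftPrimitive (fun r => φ (max r ε)) n (a x) (b x + ε)) -
        ∫ x, leftPrimitive (fun r => φ (max r ε)) n (a' x) (b x + ε)) +
      ((∫ x, rightPrimitive (fun r => φ (max r ε)) n (a x) (b x + ε)) -
        ∫ x, rightPrimitive (fun r => φ (max r ε)) n (a x) (b' x + ε)) ≤
    (∫ x, (a x - a' x) * ramp n (φ (a x) - φ (b x + ε))) -
      ∫ x, (b x - b' x) * ramp n (φ (a x) - φ (b x + ε)) := by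
  have hmono := hφ.monotone_cutoff hε
  have hcont := hφ.continuous_cutoff hε
  set Φ : ℝ → ℝ := fun r => φ (max r ε) with hΦ
  have hJ : ∀ {a b : RN N → ℝ}, Integrable a → Integrable b →
      Integrable fun x => leftPrimitive Φ n (a x) (b x + ε) := fun ha hb =>
    integrable_of_le_max ha hb hε (continuous_leftPrimitive hcont n)
      (leftPrimitive_nonneg hmono n) (leftPrimitive_le hmono n)
  have hK : ∀ {a b : RN N → ℝ}, Integrable a → Integrable b →
      Integrable fun x => rightPrimitive Φ n (a x) (b x + ε) := fun ha hb =>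
    integrable_of_le_max ha hb hε (continuous_rightPrimitive hcont n)
      (rightPrimitive_nonneg hmono n) (rightPrimitive_le hmono n)
  have hbpos : ∀ᵐ x, 0 < b x + ε := hbnn.mono fun x hx => by linarith
  have hηm : AEStronglyMeasurable (fun x => ramp n (φ (a x) - φ (b x + ε))) volume :=
    (continuous_ramp n).comp_aestronglyMeasurable
      ((aestronglyMeasurable_comp_singular hφ ha.aestronglyMeasurable hapos).sub
        (aestronglyMeasurable_comp_singular hφ (hb.aestronglyMeasurable.add_const ε) hbpos))
  have hη1 : ∀ x, ‖ramp n (φ (a x) - φ (b x + ε))‖ ≤ 1 := fun x => by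
    rw [Real.norm_of_nonneg (ramp_nonneg n _)]; exact ramp_le_one n _
  have hi1 : Integrable fun x => (a x - a' x) * ramp n (φ (a x) - φ (b x + ε)) :=
    (ha.sub ha').mul_bdd hηm (Eventually.of_forall hη1)
  have hi2 : Integrable fun x => (b x - b' x) * ramp n (φ (a x) - φ (b x + ε)) :=
    (hb.sub hb').mul_bdd hηm (Eventually.of_forall hη1)
  have i1 : Integrable fun x =>
      leftPrimitive Φ n (a x) (b x + ε) - leftPrimitive Φ n (a' x) (b x + ε) :=
    (hJ ha hb).sub (hJ ha' hb)
  have i2 : Integrable fun x =>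
      rightPrimitive Φ n (a x) (b x + ε) - rightPrimitive Φ n (a x) (b' x + ε) :=
    (hK ha hb).sub (hK ha hb')
  rw [← integral_sub (hJ ha hb) (hJ ha' hb), ← integral_sub (hK ha hb) (hK ha hb'),
    ← integral_add i1 i2, ← integral_sub hi1 hi2]
  refine integral_mono_ae (i1.add i2) (hi1.sub hi2) ?_
  filter_upwards [hapos, hbnn] with x hax hbx
  have h1 := leftPrimitive_sub_le hmono n (a x) (a' x) (b x + ε)
  have h2 := rightPrimitive_sub_le hmono n (a x) (b x + ε) (b' x + ε)
  have e := hφ.ramp_cutoff hε n hax (show ε ≤ b x + ε by linarith)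
  simp only [hΦ] at h1 h2 ⊢
  rw [e] at h1 h2
  have e2 : b x + ε - (b' x + ε) = b x - b' x := by ring
  rw [e2] at h2
  linarith

/-- A Chebyshev bound: where the ramp is positive, a exceeds b + ε, so |a - b| / ε is at least 1. -/
theorem integrable_ramp_test (hφ : IsSingularNonlinearity φ) (hε : 0 < ε) (n : ℕ)
    {a b : RN N → ℝ} (ha : Integrable a) (hb : Integrable b) (hapos : ∀ᵐ x, 0 < a x)
    (hbnn : ∀ᵐ x, 0 ≤ b x) : Integrable fun x => ramp n (φ (a x) - φ (b x + ε)) := by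
  have hbpos : ∀ᵐ x, 0 < b x + ε := hbnn.mono fun x hx => by linarith
  refine ((ha.sub hb).norm.div_const ε).mono' ((continuous_ramp n).comp_aestronglyMeasurable
      ((aestronglyMeasurable_comp_singular hφ ha.aestronglyMeasurable hapos).sub
        (aestronglyMeasurable_comp_singular hφ (hb.aestronglyMeasurable.add_const ε) hbpos))) ?_
  filter_upwards [hapos, hbpos] with x hax hbx
  rw [Real.norm_of_nonneg (ramp_nonneg n _)]
  rcases le_total (a x) (b x + ε) with h | h
  · rw [ramp_of_nonpos n (sub_nonpos.2 (hφ.strictMono.monotoneOn hax hbx h))]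
    positivity
  · refine (ramp_le_one n _).trans ?_
    rw [one_le_div hε]
    exact le_trans (by simp only [Pi.sub_apply]; linarith) (le_abs_self _)

/-- The core estimate. Both increments are tested with the same η, a ramp of f - e up to the
constant φ(ε); subtracting leaves h κ times the form of f - e against η, which is nonnegative and
can be dropped. -/
theorem doubling_increment_le (hN : 1 ≤ N) (hs0 : 0 < s) (hs1 : s < 1)
    (hκ : IsGagliardoFactor N s κ) (hφ : IsSingularNonlinearity φ) (hε : 0 < ε) (n : ℕ)
    {u gu v gv : ℝ → RN N → ℝ} (hu : IsWeakFlow s u gu) (hv : IsWeakFlow s v gv)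
    {t τ h : ℝ} (hh : 0 < h) (ht : h < t) (hτ : h < τ)
    (hut : HasHalfFracLap s (fun x => φ (u t x)) (gu t))
    (hvτ : HasHalfFracLap s (fun x => shiftedNonlinearity φ ε (v τ x)) (gv τ))
    (hupos : ∀ᵐ x, 0 < u t x) (hvnn : ∀ᵐ x, 0 ≤ v τ x) :
    ((∫ x, leftPrimitive (fun r => φ (max r ε)) n (u t x) (v τ x + ε)) -
        ∫ x, leftPrimitive (fun r => φ (max r ε)) n (u (t - h) x) (v τ x + ε)) +
      ((∫ x, rightPrimitive (fun r => φ (max r ε)) n (u t x) (v τ x + ε)) -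
        ∫ x, rightPrimitive (fun r => φ (max r ε)) n (u t x) (v (τ - h) x + ε)) ≤
    ((n : ℝ) + 1) * ((eLpNorm (gu t) 2 volume).toReal + (eLpNorm (gv τ) 2 volume).toReal) *
      ((∫ r in (t - h)..t, (eLpNorm (fun x => gu r x - gu t x) 2 volume).toReal) +
        ∫ r in (τ - h)..τ, (eLpNorm (fun x => gv r x - gv τ x) 2 volume).toReal) := by
  have ht0 : 0 < t - h := by linarith
  have hτ0 : 0 < τ - h := by linarith
  have iu := hu.continuousInL1.1
  have iv := hv.continuousInL1.1
  have hat := iu t (show (0 : ℝ) < t by linarith)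
  have hbt := iv τ (show (0 : ℝ) < τ by linarith)
  have hvpos : ∀ᵐ x, 0 < v τ x + ε := hvnn.mono fun x hx => by linarith
  refine (entropy_increment_le hφ hε n hat (iu _ ht0) hbt (iv _ hτ0) hupos hvnn).trans ?_
  set η : RN N → ℝ := fun x => ramp n (φ (u t x) - φ (v τ x + ε)) with hη
  set f : RN N → ℝ := fun x => φ (u t x) with hf
  set e : RN N → ℝ := fun x => shiftedNonlinearity φ ε (v τ x) with he
  have hηI : Integrable η := integrable_ramp_test hφ hε n hat hbt hupos hvnn
  have hη1 : ∀ x, |η x| ≤ 1 := fun x => by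
    rw [abs_of_nonneg (ramp_nonneg n _)]; exact ramp_le_one n _
  have hfm : AEStronglyMeasurable f volume :=
    aestronglyMeasurable_comp_singular hφ hat.aestronglyMeasurable hupos
  have hem : AEStronglyMeasurable e volume :=
    (aestronglyMeasurable_comp_singular hφ (hbt.aestronglyMeasurable.add_const ε) hvpos).sub
      aestronglyMeasurable_const
  have hDf := hut.memLp_gagliardoDiff hN hs0 hs1 hκ hfm
  have hDe := hvτ.memLp_gagliardoDiff hN hs0 hs1 hκ hem
  have hDw : MemLp (fun p => gagliardoDiff s f p - gagliardoDiff s e p) 2 volume := hDf.sub hDe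
  have hrel : ∀ p : RN N × RN N,
      gagliardoDiff s f p - gagliardoDiff s e p =
        ((φ (u t p.1) - φ (v τ p.1 + ε)) - (φ (u t (p.1 - p.2)) - φ (v τ (p.1 - p.2) + ε))) *
          ‖p.2‖ ^ (-((N : ℝ) / 2 + s)) := by
    intro p
    simp only [gagliardoDiff, hf, he, shiftedNonlinearity]
    ring
  -- The constant φ(ε) disappears in differences, so the Lipschitz bound of the ramp gives η finite
  -- energy.
  have hle : ∀ p, |gagliardoDiff s η p| ≤
      ((n : ℝ) + 1) * |gagliardoDiff s f p - gagliardoDiff s e p| := by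
    intro p
    rw [hrel, gagliardoDiff, abs_mul, abs_mul, ← mul_assoc]
    gcongr
    exact abs_ramp_sub_le n _ _
  have hpos : ∀ p, 0 ≤ (gagliardoDiff s f p - gagliardoDiff s e p) * gagliardoDiff s η p := by
    intro p
    rw [hrel, gagliardoDiff, mul_mul_mul_comm]
    exact mul_nonneg (mul_ramp_sub_nonneg n _ _) (mul_self_nonneg _)
  have hDη : MemLp (gagliardoDiff s η) 2 volume :=
    (hDw.const_mul ((n : ℝ) + 1)).mono
      (aestronglyMeasurable_gagliardoDiff s hηI.aestronglyMeasurable)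
      (Eventually.of_forall fun p => by
        rw [norm_mul, Real.norm_of_nonneg (by positivity : (0 : ℝ) ≤ (n : ℝ) + 1)]
        exact hle p)
  have hκ0 : 0 < √κ := Real.sqrt_pos.2 hκ.1
  have hnorm : √κ * (eLpNorm (gagliardoDiff s η) 2 volume).toReal ≤ ((n : ℝ) + 1) *
      ((eLpNorm (gu t) 2 volume).toReal + (eLpNorm (gv τ) 2 volume).toReal) := by
    have h1 : eLpNorm (gagliardoDiff s η) 2 volume ≤ ENNReal.ofReal ((n : ℝ) + 1) *
        eLpNorm (fun p => gagliardoDiff s f p - gagliardoDiff s e p) 2 volume :=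
      eLpNorm_le_mul_eLpNorm_of_ae_le_mul (Eventually.of_forall hle) 2
    have h2 : ENNReal.ofReal (√κ) * eLpNorm (gagliardoDiff s η) 2 volume ≤
        ENNReal.ofReal ((n : ℝ) + 1) * (eLpNorm (gu t) 2 volume + eLpNorm (gv τ) 2 volume) := by
      calc _ ≤ ENNReal.ofReal (√κ) * (ENNReal.ofReal ((n : ℝ) + 1) *
              (eLpNorm (gagliardoDiff s f) 2 volume + eLpNorm (gagliardoDiff s e) 2 volume)) := by
            gcongr
            refine h1.trans ?_
            gcongr
            exact eLpNorm_sub_le hDf.1 hDe.1 (by norm_num)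
        _ = ENNReal.ofReal ((n : ℝ) + 1) * (ENNReal.ofReal (√κ) *
              eLpNorm (gagliardoDiff s f) 2 volume + ENNReal.ofReal (√κ) *
                eLpNorm (gagliardoDiff s e) 2 volume) := by ring
        _ ≤ _ := by
            gcongr
            · exact hut.eLpNorm_gagliardoDiff_le hN hs0 hs1 hκ hfm
            · exact hvτ.eLpNorm_gagliardoDiff_le hN hs0 hs1 hκ hem
    have h3 := ENNReal.toReal_mono (ENNReal.mul_ne_top ENNReal.ofReal_ne_top
      (ENNReal.add_ne_top.2 ⟨hut.1.2.ne, hvτ.1.2.ne⟩)) h2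
    rwa [ENNReal.toReal_mul, ENNReal.toReal_mul, ENNReal.toReal_ofReal (Real.sqrt_nonneg _),
      ENNReal.toReal_ofReal (by positivity), ENNReal.toReal_add hut.1.2.ne hvτ.1.2.ne] at h3
  -- The increment of v enters with a minus sign, so the upper bound is kept for u and the lower
  -- bound for v.
  have k1 := (abs_le.1 (hu.increment_le hN hs0 hs1 hκ hfm hut ht0 (by linarith : t - h < t)
    hη1 hηI hDη)).2
  have k2 := (abs_le.1 (hv.increment_le hN hs0 hs1 hκ hem hvτ hτ0 (by linarith : τ - h < τ)
    hη1 hηI hDη)).1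
  set mu := ∫ r in (t - h)..t, (eLpNorm (fun x => gu r x - gu t x) 2 volume).toReal
  set mv := ∫ r in (τ - h)..τ, (eLpNorm (fun x => gv r x - gv τ x) 2 volume).toReal
  have hmu : 0 ≤ mu := intervalIntegral.integral_nonneg (by linarith) fun _ _ => ENNReal.toReal_nonneg
  have hmv : 0 ≤ mv := intervalIntegral.integral_nonneg (by linarith) fun _ _ => ENNReal.toReal_nonneg
  have hE : 0 ≤ (∫ p, gagliardoDiff s f p * gagliardoDiff s η p) -
      ∫ p, gagliardoDiff s e p * gagliardoDiff s η p := by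
    have e1 := integral_sub (hDf.integrable_mul hDη) (hDe.integrable_mul hDη)
    simp only [Pi.mul_apply] at e1
    rw [← e1]
    refine integral_nonneg fun p => ?_
    have := hpos p
    rw [sub_mul] at this
    exact this
  have hE' : 0 ≤ h * (κ * ((∫ p, gagliardoDiff s f p * gagliardoDiff s η p) -
      ∫ p, gagliardoDiff s e p * gagliardoDiff s η p)) :=
    mul_nonneg hh.le (mul_nonneg hκ.1.le hE)
  rw [show t - (t - h) = h by ring] at k1
  rw [show τ - (τ - h) = h by ring] at k2
  have hfin : √κ * (eLpNorm (gagliardoDiff s η) 2 volume).toReal * (mu + mv) ≤ ((n : ℝ) + 1) *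
      ((eLpNorm (gu t) 2 volume).toReal + (eLpNorm (gv τ) 2 volume).toReal) * (mu + mv) :=
    mul_le_mul_of_nonneg_right hnorm (by linarith)
  refine le_trans ?_ hfin
  rw [mul_sub, mul_sub] at hE'
  linarith

end Doubling
end

noncomputable section

/-! ### Passing to the limit in the doubled time variables -/

section TimeDoubling

variable {N : ℕ}

theorem measurable_eLpNorm_slice {Y : Type*} [MeasurableSpace Y] {H : Y × RN N → ℝ}
    (hH : Measurable H) : Measurable fun y => eLpNorm (fun x => H (y, x)) 2 volume := by
  have h := (Measurable.lintegral_prod_right' (ν := (volume : Measure (RN N)))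
    (hH.pow_const 2).ennreal_ofReal).pow_const (1 / 2 : ℝ)
  convert h using 2 with y
  rw [← eLpNorm_two_sq_eq_lintegral (fun x => H (y, x)), ← ENNReal.rpow_natCast,
    ← ENNReal.rpow_mul]
  norm_num

/-- The mean over `r ∈ (t - h, t)` of the `L²` distance between the slices at `r` and `t`. -/
def meanModulus (g : ℝ → RN N → ℝ) (h t : ℝ) : ℝ :=
  h⁻¹ * ∫ r in (t - h)..t, (eLpNorm (fun x => g r x - g t x) 2 volume).toReal

theorem meanModulus_eq_integral (g : ℝ → RN N → ℝ) {h : ℝ} (hh : 0 < h) (t : ℝ) :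
    meanModulus g h t = ∫ z, (eLpNorm (fun x => g (t + z) x - g t x) 2 volume).toReal
      ∂(ENNReal.ofReal h⁻¹ • volume.restrict (Ioc (-h) 0)) := by
  rw [integral_smul_measure, ENNReal.toReal_ofReal (by positivity), smul_eq_mul, meanModulus,
    ← intervalIntegral.integral_of_le (by linarith),
    intervalIntegral.integral_comp_add_left
      (fun r => (eLpNorm (fun x => g r x - g t x) 2 volume).toReal) t, add_zero, ← sub_eq_add_neg]

theorem measurable_meanModulus {g : ℝ → RN N → ℝ} (hg : Measurable (Function.uncurry g)) {h : ℝ}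
    (hh : 0 < h) : Measurable (meanModulus g h) := by
  rw [funext (meanModulus_eq_integral g hh)]
  have hH : Measurable fun q : (ℝ × ℝ) × RN N => g (q.1.1 + q.1.2) q.2 - g q.1.1 q.2 :=
    (hg.comp (by fun_prop : Measurable fun q : (ℝ × ℝ) × RN N => (q.1.1 + q.1.2, q.2))).sub
      (hg.comp (by fun_prop : Measurable fun q : (ℝ × ℝ) × RN N => (q.1.1, q.2)))
  have h1 := (measurable_eLpNorm_slice hH).ennreal_toReal.stronglyMeasurable
  exact (h1.integral_prod_right'
    (ν := ENNReal.ofReal h⁻¹ • volume.restrict (Ioc (-h) 0))).measurable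

theorem tendsto_eLpNorm_time_translate_sub {g : ℝ → RN N → ℝ}
    (hg2 : MemLp (Function.uncurry g) 2 volume) :
    Tendsto (fun z : ℝ => eLpNorm (fun p : ℝ × RN N => g (p.1 + z) p.2 - g p.1 p.2) 2 volume)
      (𝓝 0) (𝓝 0) := by
  have hinv : (volume : Measure (ℝ × RN N)).IsAddRightInvariant :=
    inferInstanceAs ((volume : Measure ℝ).prod (volume : Measure (RN N))).IsAddRightInvariant
  have ht := tendsto_eLpNorm_translate_sub hg2
  have hz : Tendsto (fun z : ℝ => ((z, 0) : ℝ × RN N)) (𝓝 0) (𝓝 0) := by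
    have : Continuous fun z : ℝ => ((z, 0) : ℝ × RN N) := by fun_prop
    exact this.tendsto 0
  refine (ht.comp hz).congr fun z => ?_
  simp [Function.uncurry_def]

theorem lintegral_eLpNorm_time_translate_sub {g : ℝ → RN N → ℝ}
    (hg : Measurable (Function.uncurry g)) (z : ℝ) :
    ∫⁻ t, eLpNorm (fun x => g (t + z) x - g t x) 2 volume ^ 2 =
      eLpNorm (fun p : ℝ × RN N => g (p.1 + z) p.2 - g p.1 p.2) 2 volume ^ 2 := by
  have hm : Measurable fun p : ℝ × RN N => g (p.1 + z) p.2 - g p.1 p.2 :=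
    (hg.comp (by fun_prop : Measurable fun p : ℝ × RN N => (p.1 + z, p.2))).sub hg
  have h := lintegral_eLpNorm_slice_sq (ν := volume)
    (G := fun p : ℝ × RN N => g (p.1 + z) p.2 - g p.1 p.2) hm.aestronglyMeasurable
  dsimp only at h
  exact h

theorem measurable_eLpNorm_time_translate_sub {g : ℝ → RN N → ℝ}
    (hg : Measurable (Function.uncurry g)) : Measurable fun q : ℝ × ℝ =>
      eLpNorm (fun x => g (q.1 + q.2) x - g q.1 x) 2 volume := by
  have hH : Measurable fun q : (ℝ × ℝ) × RN N => g (q.1.1 + q.1.2) q.2 - g q.1.1 q.2 :=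
    (hg.comp (by fun_prop : Measurable fun q : (ℝ × ℝ) × RN N => (q.1.1 + q.1.2, q.2))).sub
      (hg.comp (by fun_prop : Measurable fun q : (ℝ × ℝ) × RN N => (q.1.1, q.2)))
  have h := measurable_eLpNorm_slice
    (H := fun q : (ℝ × ℝ) × RN N => g (q.1.1 + q.1.2) q.2 - g q.1.1 q.2) hH
  dsimp only at h
  exact h

/-- Written as an average over shifts z in (-h, 0], the squared modulus is bounded by Jensen and
Fubini by the mean of squared L² norms of time translations, all small for small h. -/
theorem tendsto_eLpNorm_meanModulus {g : ℝ → RN N → ℝ} (hg : Measurable (Function.uncurry g))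
    (hg2 : MemLp (Function.uncurry g) 2 volume) :
    Tendsto (fun h => eLpNorm (meanModulus g h) 2 volume) (𝓝[>] 0) (𝓝 0) := by
  rw [ENNReal.tendsto_nhds_zero]
  intro δ hδ
  obtain ⟨ρ, hρ, hρ'⟩ := Metric.eventually_nhds_iff.1
    ((ENNReal.tendsto_nhds_zero.1 (tendsto_eLpNorm_time_translate_sub hg2)) δ hδ)
  filter_upwards [Ioo_mem_nhdsGT hρ] with h hh
  have hh0 : 0 < h := hh.1
  set ν : Measure ℝ := ENNReal.ofReal h⁻¹ • volume.restrict (Ioc (-h) 0) with hν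
  have hνp : IsProbabilityMeasure ν := ⟨by
    rw [hν, Measure.smul_apply, Measure.restrict_apply_univ, Real.volume_Ioc, smul_eq_mul,
      ← ENNReal.ofReal_mul (by positivity), zero_sub, neg_neg, inv_mul_cancel₀ hh0.ne',
      ENNReal.ofReal_one]⟩
  have hN2 := measurable_eLpNorm_time_translate_sub hg
  have hsw := lintegral_lintegral_swap (μ := (volume : Measure ℝ)) (ν := ν)
    (f := fun t z => eLpNorm (fun x => g (t + z) x - g t x) 2 volume ^ 2)
    (hN2.pow_const 2).aemeasurable
  have h1 : ∀ t, ENNReal.ofReal (meanModulus g h t ^ 2) ≤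
      ∫⁻ z, eLpNorm (fun x => g (t + z) x - g t x) 2 volume ^ 2 ∂ν := by
    intro t
    rw [meanModulus_eq_integral g hh0]
    have hm := hN2.comp (measurable_prodMk_left (β := ℝ) (x := t))
    simp only [Function.comp_def] at hm
    refine (ofReal_sq_integral_le hm.ennreal_toReal.aestronglyMeasurable).trans
      (lintegral_mono fun z => ?_)
    rw [ENNReal.ofReal_pow ENNReal.toReal_nonneg]
    gcongr
    exact ENNReal.ofReal_toReal_le
  have h2 : ∀ᵐ z ∂ν, ∫⁻ t, eLpNorm (fun x => g (t + z) x - g t x) 2 volume ^ 2 ≤ δ ^ 2 := by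
    have hmem : ∀ᵐ z ∂ν, z ∈ Ioc (-h) 0 :=
      Measure.ae_smul_measure (ae_restrict_mem measurableSet_Ioc) _
    filter_upwards [hmem] with z hz
    have hd : dist z 0 < ρ := by
      rw [Real.dist_eq, sub_zero, abs_lt]
      constructor <;> linarith [hz.1, hz.2, hh.2]
    rw [lintegral_eLpNorm_time_translate_sub hg]
    have := hρ' hd
    gcongr
  rw [← ENNReal.pow_le_pow_left_iff two_ne_zero, eLpNorm_two_sq_eq_lintegral]
  calc ∫⁻ t, ENNReal.ofReal (meanModulus g h t ^ 2)
      ≤ ∫⁻ t, ∫⁻ z, eLpNorm (fun x => g (t + z) x - g t x) 2 volume ^ 2 ∂ν := lintegral_mono h1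
    _ = ∫⁻ z, (∫⁻ t, eLpNorm (fun x => g (t + z) x - g t x) 2 volume ^ 2) ∂ν :=
        hsw
    _ ≤ ∫⁻ _, δ ^ 2 ∂ν := lintegral_mono_ae h2
    _ = δ ^ 2 := by rw [lintegral_const, measure_univ, mul_one]

theorem tendsto_integral_mul_differenceQuotient {E : Type*} [NormedAddCommGroup E]
    [NormedSpace ℝ E] [FiniteDimensional ℝ E] [MeasurableSpace E] [BorelSpace E] {μ : Measure E}
    {J θ : E → ℝ} (hJ : Integrable J μ) (hθ : ContDiff ℝ 1 θ) (hc : HasCompactSupport θ) (e : E) :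
    Tendsto (fun h : ℝ => ∫ p, J p * (h⁻¹ * (θ (p + h • e) - θ p)) ∂μ) (𝓝[>] 0)
      (𝓝 (∫ p, J p * fderiv ℝ θ p e ∂μ)) := by
  obtain ⟨L, hL⟩ := hθ.lipschitzWith_of_hasCompactSupport hc one_ne_zero
  have hcont := hθ.continuous
  refine tendsto_integral_filter_of_dominated_convergence (fun p => ‖J p‖ * (L * ‖e‖))
    (Eventually.of_forall fun h => hJ.aestronglyMeasurable.mul
      (Continuous.aestronglyMeasurable (by fun_prop))) ?_ (hJ.norm.mul_const _)
    (Eventually.of_forall fun p => ?_)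
  · filter_upwards [self_mem_nhdsWithin] with h hh
    refine Eventually.of_forall fun p => ?_
    rw [norm_mul]
    gcongr
    have h0 : (0 : ℝ) < h := hh
    rw [norm_mul, norm_inv, Real.norm_of_nonneg h0.le, inv_mul_le_iff₀ h0]
    have := hL.dist_le_mul (p + h • e) p
    rw [dist_eq_norm, dist_eq_norm, add_sub_cancel_left, norm_smul, Real.norm_of_nonneg h0.le] at this
    linarith
  · have hd : HasLineDerivAt ℝ θ (fderiv ℝ θ p e) p e :=
      ((hθ.differentiable one_ne_zero p).hasFDerivAt).hasLineDerivAt e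
    have h1 := hasDerivAt_iff_tendsto_slope_zero.1 hd
    simp only [zero_add, zero_smul, add_zero, smul_eq_mul] at h1
    exact ((h1.mono_left (nhdsWithin_mono 0 fun x hx => ne_of_gt hx))).const_mul (J p)

/-- Summation by parts: forward differences of the test function become backward differences of J,
which are the ones estimated. -/
theorem integral_mul_translate_sub {J θ : ℝ × ℝ → ℝ} (hJ : Integrable J) (hθ : Continuous θ) {B : ℝ}
    (hB : ∀ p, ‖θ p‖ ≤ B) (v : ℝ × ℝ) :
    ∫ p, J p * (θ (p + v) - θ p) = -∫ p, θ p * (J p - J (p - v)) := by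
  have hinv : (volume : Measure (ℝ × ℝ)).IsAddRightInvariant :=
    inferInstanceAs ((volume : Measure ℝ).prod (volume : Measure ℝ)).IsAddRightInvariant
  have hm : AEStronglyMeasurable θ volume := hθ.aestronglyMeasurable
  have i1 : Integrable (fun p => J p * θ p) := hJ.mul_bdd hm (Eventually.of_forall hB)
  have i2 : Integrable (fun p => J (p - v) * θ p) :=
    (hJ.comp_sub_right v).mul_bdd hm (Eventually.of_forall hB)
  have i3 : Integrable (fun p => J p * θ (p + v)) := by
    simpa using i2.comp_add_right v
  have e : ∫ p, J p * θ (p + v) = ∫ p, J (p - v) * θ p := by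
    rw [← integral_add_right_eq_self (fun p => J (p - v) * θ p) v]
    simp
  simp_rw [mul_sub, mul_comm (θ _)]
  rw [integral_sub i3 i1, integral_sub i1 i2, e, neg_sub]

end TimeDoubling
end

/-! ### Distributional inequality and continuity in the two times -/

noncomputable section

section DoublingLimit

variable {N : ℕ}

/-- If the difference quotients of `J` in the first and of `K` in the second variable are at most
`R h`, with `R h → 0` in `L¹`, then `∂₁ J + ∂₂ K ≤ 0` in the sense of distributions. -/
theorem integral_mul_fderiv_nonneg {J K θ : ℝ × ℝ → ℝ} {a b : ℝ} (ha : 0 < a)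
    (hJ : ContinuousOn J (Ioi 0 ×ˢ Ioi 0)) (hK : ContinuousOn K (Ioi 0 ×ˢ Ioi 0))
    (hθ : ContDiff ℝ 1 θ) (hθ0 : ∀ p, 0 ≤ θ p) (hθS : ∀ p ∉ Icc a b ×ˢ Icc a b, θ p = 0)
    {R : ℝ → ℝ × ℝ → ℝ}
    (hR : ∀ᶠ h in 𝓝[>] (0 : ℝ), ∀ᵐ p ∂(volume.restrict (Icc a b ×ˢ Icc a b)),
      J p - J (p - (h, 0)) + (K p - K (p - (0, h))) ≤ h * R h p)
    (hRm : ∀ᶠ h in 𝓝[>] (0 : ℝ),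
      AEStronglyMeasurable (R h) (volume.restrict (Icc a b ×ˢ Icc a b)))
    (hR0 : Tendsto (fun h => eLpNorm (R h) 1 (volume.restrict (Icc a b ×ˢ Icc a b)))
      (𝓝[>] 0) (𝓝 0)) :
    0 ≤ ∫ p in Icc a b ×ˢ Icc a b, (J p * fderiv ℝ θ p (1, 0) + K p * fderiv ℝ θ p (0, 1)) := by
  set S : Set (ℝ × ℝ) := Icc a b ×ˢ Icc a b with hS
  -- The box is enlarged downwards so that backward shifts of points of S by h < a / 2 stay inside;
  -- J and K, controlled only for positive times, are cut off outside it.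
  set Q : Set (ℝ × ℝ) := Icc (a / 2) b ×ˢ Icc (a / 2) b with hQ
  have hSc : IsCompact S := isCompact_Icc.prod isCompact_Icc
  have hQc : IsCompact Q := isCompact_Icc.prod isCompact_Icc
  have hSm : MeasurableSet S := hSc.measurableSet
  have hQm : MeasurableSet Q := hQc.measurableSet
  have hQpos : Q ⊆ Ioi 0 ×ˢ Ioi 0 := fun p hp =>
    ⟨lt_of_lt_of_le (by linarith) hp.1.1, lt_of_lt_of_le (by linarith) hp.2.1⟩
  have hSQ : S ⊆ Q := fun p hp => ⟨⟨by linarith [hp.1.1], hp.1.2⟩, ⟨by linarith [hp.2.1], hp.2.2⟩⟩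
  have hθc : HasCompactSupport θ := HasCompactSupport.intro hSc hθS
  obtain ⟨B, hB⟩ := hθc.exists_bound_of_continuous hθ.continuous
  have hJi : Integrable (Q.indicator J) :=
    (integrable_indicator_iff hQm).2 ((hJ.mono hQpos).integrableOn_compact hQc)
  have hKi : Integrable (Q.indicator K) :=
    (integrable_indicator_iff hQm).2 ((hK.mono hQpos).integrableOn_compact hQc)
  have hfd : ∀ p ∉ S, fderiv ℝ θ p = 0 := fun p hp => by
    have : θ =ᶠ[𝓝 p] fun _ => 0 := by
      filter_upwards [hSc.isClosed.isOpen_compl.mem_nhds hp] with q hq using hθS q hq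
    rw [this.fderiv_eq]
    simp
  have hfc : Continuous (fderiv ℝ θ) := hθ.continuous_fderiv one_ne_zero
  have lim := (tendsto_integral_mul_differenceQuotient hJi hθ hθc (1, 0)).add
    (tendsto_integral_mul_differenceQuotient hKi hθ hθc (0, 1))
  have hbd : ∀ e : ℝ × ℝ, ∃ C, ∀ p, ‖fderiv ℝ θ p e‖ ≤ C := fun e =>
    (hθc.fderiv_apply (𝕜 := ℝ) e).exists_bound_of_continuous (by fun_prop)
  have h_int : ∀ (J : ℝ × ℝ → ℝ), Integrable (Q.indicator J) → ∀ e,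
      Integrable fun p => Q.indicator J p * fderiv ℝ θ p e := fun J hJ e =>
    hJ.mul_bdd (Continuous.aestronglyMeasurable (by fun_prop))
      (Eventually.of_forall (hbd e).choose_spec)
  have heq : ∫ p in S, (J p * fderiv ℝ θ p (1, 0) + K p * fderiv ℝ θ p (0, 1)) =
      (∫ p, Q.indicator J p * fderiv ℝ θ p (1, 0)) +
        ∫ p, Q.indicator K p * fderiv ℝ θ p (0, 1) := by
    rw [← integral_add (h_int J hJi _) (h_int K hKi _)]
    symm
    rw [← setIntegral_eq_integral_of_forall_compl_eq_zero (E := ℝ) (s := S)]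
    · refine setIntegral_congr_fun (E := ℝ) hSm fun p hp => ?_
      rw [indicator_of_mem (hSQ hp), indicator_of_mem (hSQ hp)]
    · intro p hp
      simp [hfd p hp]
  rw [heq]
  have hlow := ((ENNReal.tendsto_toReal ENNReal.zero_ne_top).comp hR0).const_mul (-B)
  simp only [ENNReal.toReal_zero, mul_zero] at hlow
  have hfin : ∀ᶠ h in 𝓝[>] (0 : ℝ), eLpNorm (R h) 1 (volume.restrict S) < ⊤ :=
    hR0.eventually (gt_mem_nhds ENNReal.zero_lt_top)
  refine le_of_tendsto_of_tendsto hlow lim ?_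
  filter_upwards [hR, hRm, hfin, Ioo_mem_nhdsGT (show (0 : ℝ) < a / 2 by linarith)]
    with h h1 h2 h3 hh
  have hRi : Integrable (R h) (volume.restrict S) := memLp_one_iff_integrable.1 ⟨h2, h3⟩
  have hh0 : 0 < h := hh.1
  have hinv : (volume : Measure (ℝ × ℝ)).IsAddRightInvariant :=
    inferInstanceAs ((volume : Measure ℝ).prod (volume : Measure ℝ)).IsAddRightInvariant
  have key : ∀ J : ℝ × ℝ → ℝ, Integrable (Q.indicator J) → ∀ e : ℝ × ℝ,
      ∫ p, Q.indicator J p * (h⁻¹ * (θ (p + h • e) - θ p)) =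
        -(h⁻¹ * ∫ p, θ p * (Q.indicator J p - Q.indicator J (p - h • e))) := by
    intro J hJ e
    have := integral_mul_translate_sub hJ hθ.continuous hB (h • e)
    rw [← mul_neg, ← this, ← integral_const_mul]
    refine integral_congr_ae (Eventually.of_forall fun p => ?_)
    simp only
    ring
  have hXi : ∀ J : ℝ × ℝ → ℝ, Integrable (Q.indicator J) → ∀ e : ℝ × ℝ,
      Integrable fun p => θ p * (Q.indicator J p - Q.indicator J (p - h • e)) := fun J hJ e =>
    (hJ.sub (hJ.comp_sub_right _)).bdd_mul hθ.continuous.aestronglyMeasurable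
      (Eventually.of_forall hB)
  simp only [Function.comp_apply]
  rw [key J hJi, key K hKi, toReal_eLpNorm_one hRi]
  have hle : (∫ p, θ p * (Q.indicator J p - Q.indicator J (p - h • (1, 0)))) +
      (∫ p, θ p * (Q.indicator K p - Q.indicator K (p - h • (0, 1)))) ≤
        h * (B * ∫ p in S, ‖R h p‖) := by
    rw [← integral_add (hXi J hJi _) (hXi K hKi _),
      ← setIntegral_eq_integral_of_forall_compl_eq_zero (s := S), ← integral_const_mul,
      ← integral_const_mul]
    · refine integral_mono_ae ((hXi J hJi _).add (hXi K hKi _)).integrableOn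
        ((hRi.norm.const_mul _).const_mul _) ?_
      filter_upwards [h1, ae_restrict_mem hSm] with p hp hpS
      have m1 : p - h • ((1 : ℝ), (0 : ℝ)) ∈ Q := by
        refine ⟨⟨?_, ?_⟩, ⟨?_, ?_⟩⟩ <;> simp <;>
          linarith [hpS.1.1, hpS.1.2, hpS.2.1, hpS.2.2, hh.2]
      have m2 : p - h • ((0 : ℝ), (1 : ℝ)) ∈ Q := by
        refine ⟨⟨?_, ?_⟩, ⟨?_, ?_⟩⟩ <;> simp <;>
          linarith [hpS.1.1, hpS.1.2, hpS.2.1, hpS.2.2, hh.2]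
      rw [indicator_of_mem (hSQ hpS), indicator_of_mem (hSQ hpS), indicator_of_mem m1,
        indicator_of_mem m2, ← mul_add]
      have e1 : h • ((1 : ℝ), (0 : ℝ)) = (h, 0) := by simp
      have e2 : h • ((0 : ℝ), (1 : ℝ)) = (0, h) := by simp
      rw [e1, e2]
      calc θ p * (J p - J (p - (h, 0)) + (K p - K (p - (0, h)))) ≤ θ p * (h * R h p) :=
            mul_le_mul_of_nonneg_left hp (hθ0 p)
        _ ≤ θ p * (h * ‖R h p‖) :=
            mul_le_mul_of_nonneg_left (mul_le_mul_of_nonneg_left (le_abs_self _) hh0.le) (hθ0 p)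
        _ ≤ B * (h * ‖R h p‖) :=
            mul_le_mul_of_nonneg_right ((le_abs_self _).trans (hB p)) (by positivity)
        _ = h * (B * ‖R h p‖) := by ring
    · intro p hp
      rw [hθS p hp]
      simp
  rw [← neg_add, ← mul_add, neg_mul]
  refine neg_le_neg ?_
  rw [inv_mul_le_iff₀ hh0]
  exact hle

/-- There is no fixed dominating function, so the integrand is truncated at |a₀ - b₀|, which the
limit never exceeds. The excess over the truncation is at most |a k - a₀| + |b k - b₀|. -/
theorem tendsto_integral_of_le_max {ε : ℝ} (hε : 0 < ε) {L : ℝ → ℝ → ℝ}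
    (hL : Continuous fun p : ℝ × ℝ => L p.1 p.2)
    (hL0 : ∀ U c, 0 ≤ L U c) (hL1 : ∀ U c, L U c ≤ max 0 (U - c)) {a b : ℕ → RN N → ℝ}
    {a₀ b₀ : RN N → ℝ} (ha : ∀ k, Integrable (a k)) (hb : ∀ k, Integrable (b k))
    (ha₀ : Integrable a₀) (hb₀ : Integrable b₀)
    (hat : Tendsto (fun k => eLpNorm (a k - a₀) 1 volume) atTop (𝓝 0))
    (hbt : Tendsto (fun k => eLpNorm (b k - b₀) 1 volume) atTop (𝓝 0))
    (haa : ∀ᵐ x, Tendsto (fun k => a k x) atTop (𝓝 (a₀ x)))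
    (hba : ∀ᵐ x, Tendsto (fun k => b k x) atTop (𝓝 (b₀ x))) :
    Tendsto (fun k => ∫ x, L (a k x) (b k x + ε)) atTop (𝓝 (∫ x, L (a₀ x) (b₀ x + ε))) := by
  have hi : ∀ k, Integrable fun x => L (a k x) (b k x + ε) := fun k =>
    integrable_of_le_max (ha k) (hb k) hε hL hL0 hL1
  have hD : Integrable fun x => |a₀ x - b₀ x| := (ha₀.sub hb₀).norm
  have hmin : ∀ k, Integrable fun x => min (L (a k x) (b k x + ε)) |a₀ x - b₀ x| := fun k =>
    (hi k).inf hD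
  have h1 : Tendsto (fun k => ∫ x, min (L (a k x) (b k x + ε)) |a₀ x - b₀ x|) atTop
      (𝓝 (∫ x, L (a₀ x) (b₀ x + ε))) := by
    refine tendsto_integral_of_dominated_convergence _ (fun k => (hmin k).aestronglyMeasurable) hD
      (fun k => Eventually.of_forall fun x => ?_) ?_
    · rw [Real.norm_of_nonneg (le_min (hL0 _ _) (abs_nonneg _))]
      exact min_le_right _ _
    · filter_upwards [haa, hba] with x hax hbx
      have h2 : Tendsto (fun k => L (a k x) (b k x + ε)) atTop (𝓝 (L (a₀ x) (b₀ x + ε))) :=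
        (hL.tendsto (a₀ x, b₀ x + ε)).comp (hax.prodMk_nhds (hbx.add_const ε))
      have h3 := h2.min (tendsto_const_nhds (x := |a₀ x - b₀ x|))
      rwa [min_eq_left ((hL1 _ _).trans (max_zero_sub_le _ _ hε))] at h3
  have h2 : Tendsto (fun k => ∫ x, (L (a k x) (b k x + ε) -
      min (L (a k x) (b k x + ε)) |a₀ x - b₀ x|)) atTop (𝓝 0) := by
    have hab := ((ENNReal.tendsto_toReal ENNReal.zero_ne_top).comp hat).add
      ((ENNReal.tendsto_toReal ENNReal.zero_ne_top).comp hbt)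
    simp only [ENNReal.toReal_zero, add_zero] at hab
    refine squeeze_zero (fun k => integral_nonneg fun x => sub_nonneg.2 (min_le_left _ _))
      (fun k => ?_) hab
    have i1 := ((ha k).sub ha₀).norm
    have i2 := ((hb k).sub hb₀).norm
    simp only [Function.comp_apply]
    rw [toReal_eLpNorm_one ((ha k).sub ha₀), toReal_eLpNorm_one ((hb k).sub hb₀),
      ← integral_add i1 i2]
    refine integral_mono ((hi k).sub (hmin k)) (i1.add i2) fun x => ?_
    simp only [Pi.sub_apply, Real.norm_eq_abs]
    have h3 : L (a k x) (b k x + ε) ≤ |a k x - b k x| := (hL1 _ _).trans (max_zero_sub_le _ _ hε)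
    have h4 : |a k x - b k x| ≤ |a k x - a₀ x| + |b k x - b₀ x| + |a₀ x - b₀ x| := by
      have : a k x - b k x = (a k x - a₀ x) - (b k x - b₀ x) + (a₀ x - b₀ x) := by ring
      rw [this]
      exact (abs_add_le _ _).trans (add_le_add_left (abs_sub _ _) _)
    rcases min_cases (L (a k x) (b k x + ε)) |a₀ x - b₀ x| with h5 | h5 <;> rw [h5.1]
    · rw [sub_self]; positivity
    · linarith
  have h3 := h1.add h2
  rw [add_zero] at h3
  refine h3.congr fun k => ?_
  rw [integral_sub (hi k) (hmin k)]
  ring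

theorem continuousOn_integral_of_le_max {ε : ℝ} (hε : 0 < ε) {L : ℝ → ℝ → ℝ}
    (hL : Continuous fun p : ℝ × ℝ => L p.1 p.2)
    (hL0 : ∀ U c, 0 ≤ L U c) (hL1 : ∀ U c, L U c ≤ max 0 (U - c)) {u v : ℝ → RN N → ℝ}
    (hu : ContinuousInL1 (Ioi 0) u) (hv : ContinuousInL1 (Ioi 0) v) :
    ContinuousOn (fun p : ℝ × ℝ => ∫ x, L (u p.1 x) (v p.2 x + ε)) (Ioi 0 ×ˢ Ioi 0) := by
  rw [continuousOn_iff_continuous_domRestrict, continuous_iff_continuousAt]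
  intro q
  -- Convergence in L¹ gives almost everywhere convergence only along subsequences; two successive
  -- extractions handle u and v.
  refine tendsto_of_subseq_tendsto fun ns hns => ?_
  have l1 : Tendsto (fun k => (ns k).1.1) atTop (𝓝[Ioi 0] q.1.1) :=
    tendsto_nhdsWithin_iff.2 ⟨((continuous_fst.comp continuous_subtype_val).tendsto q).comp hns,
      Eventually.of_forall fun k => (ns k).2.1⟩
  have l2 : Tendsto (fun k => (ns k).1.2) atTop (𝓝[Ioi 0] q.1.2) :=
    tendsto_nhdsWithin_iff.2 ⟨((continuous_snd.comp continuous_subtype_val).tendsto q).comp hns,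
      Eventually.of_forall fun k => (ns k).2.2⟩
  have ta := (hu.2 q.1.1 q.2.1).comp l1
  have tb := (hv.2 q.1.2 q.2.2).comp l2
  have iu : ∀ k, Integrable (u (ns k).1.1) := fun k => hu.1 _ (ns k).2.1
  have iv : ∀ k, Integrable (v (ns k).1.2) := fun k => hv.1 _ (ns k).2.2
  obtain ⟨m1, hm1, ha1⟩ := (tendstoInMeasure_of_tendsto_eLpNorm one_ne_zero
    (fun k => (iu k).aestronglyMeasurable) (hu.1 _ q.2.1).aestronglyMeasurable
      ta).exists_seq_tendsto_ae
  have tb1 := tb.comp hm1.tendsto_atTop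
  obtain ⟨m2, hm2, ha2⟩ := (tendstoInMeasure_of_tendsto_eLpNorm one_ne_zero
    (fun k => (iv (m1 k)).aestronglyMeasurable) (hv.1 _ q.2.2).aestronglyMeasurable
      tb1).exists_seq_tendsto_ae
  refine ⟨m1 ∘ m2, ?_⟩
  exact tendsto_integral_of_le_max hε hL hL0 hL1 (fun k => iu (m1 (m2 k)))
    (fun k => iv (m1 (m2 k))) (hu.1 _ q.2.1) (hv.1 _ q.2.2)
    (ta.comp (hm1.tendsto_atTop.comp hm2.tendsto_atTop)) (tb1.comp hm2.tendsto_atTop)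
    (ha1.mono fun x hx => hx.comp hm2.tendsto_atTop) ha2

/-- Extension by zero outside the time window makes g globally square integrable, so that continuity
of translations applies. -/
theorem exists_measurable_representative {g : ℝ → RN N → ℝ} {c d : ℝ}
    (hg : MemLp (Function.uncurry g) 2 ((volume.restrict (Ioo c d)).prod volume)) :
    ∃ G : ℝ → RN N → ℝ, Measurable (Function.uncurry G) ∧ MemLp (Function.uncurry G) 2 volume ∧
      ∀ᵐ t ∂(volume.restrict (Ioo c d)), g t =ᵐ[volume] G t := by
  have hSm : MeasurableSet (Ioo c d ×ˢ (univ : Set (RN N))) := measurableSet_Ioo.prod .univ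
  set H := (Ioo c d ×ˢ (univ : Set (RN N))).indicator (hg.1.mk (Function.uncurry g)) with hH
  have hm : Measurable H := hg.1.stronglyMeasurable_mk.measurable.indicator hSm
  refine ⟨fun t x => H (t, x), hm, ?_, ?_⟩
  · have : MemLp H 2 volume := by
      rw [hH, memLp_indicator_iff_restrict hSm, volume_restrict_prod_univ]
      exact (memLp_congr_ae hg.1.ae_eq_mk).1 hg
    exact this
  · have h1 := Measure.ae_ae_of_ae_prod hg.1.ae_eq_mk
    filter_upwards [h1, ae_restrict_mem measurableSet_Ioo] with t ht htm
    filter_upwards [ht] with x hx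
    have hmem : (t, x) ∈ Ioo c d ×ˢ (univ : Set (RN N)) := ⟨htm, mem_univ _⟩
    exact hx.trans (indicator_of_mem hmem _).symm

theorem meanModulus_congr {g G : ℝ → RN N → ℝ} {c d : ℝ}
    (hgG : ∀ᵐ t ∂(volume.restrict (Ioo c d)), g t =ᵐ[volume] G t) {t h : ℝ} (hh : 0 < h)
    (hc : c < t - h) (hd : t < d) (ht : g t =ᵐ[volume] G t) :
    meanModulus g h t = meanModulus G h t := by
  unfold meanModulus
  congr 1
  rw [intervalIntegral.integral_of_le (by linarith), intervalIntegral.integral_of_le (by linarith)]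
  refine integral_congr_ae ?_
  have hsub : Ioc (t - h) t ⊆ Ioo c d := fun r hr => ⟨hc.trans hr.1, hr.2.trans_lt hd⟩
  filter_upwards [ae_restrict_of_ae_restrict_of_subset hsub hgG] with r hr
  exact congrArg ENNReal.toReal (eLpNorm_congr_ae (hr.sub ht))

theorem eLpNorm_comp_fst {ν : Measure ℝ} [IsFiniteMeasure ν] {f : ℝ → ℝ}
    (hf : AEStronglyMeasurable f ν) :
    eLpNorm (fun p : ℝ × ℝ => f p.1) 2 (ν.prod ν) = ν univ ^ (1 / 2 : ℝ) * eLpNorm f 2 ν := by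
  have h1 := eLpNorm_map_measure (p := 2) (f := Prod.fst) (μ := ν.prod ν) (g := f)
    (by rw [Measure.map_fst_prod]; exact hf.smul_measure _) measurable_fst.aemeasurable
  rw [Measure.map_fst_prod, eLpNorm_smul_measure_of_ne_top (by simp)] at h1
  simpa [Function.comp_def] using h1.symm

theorem eLpNorm_comp_snd {ν : Measure ℝ} [IsFiniteMeasure ν] {f : ℝ → ℝ}
    (hf : AEStronglyMeasurable f ν) :
    eLpNorm (fun p : ℝ × ℝ => f p.2) 2 (ν.prod ν) = ν univ ^ (1 / 2 : ℝ) * eLpNorm f 2 ν := by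
  have h1 := eLpNorm_map_measure (p := 2) (f := Prod.snd) (μ := ν.prod ν) (g := f)
    (by rw [Measure.map_snd_prod]; exact hf.smul_measure _) measurable_snd.aemeasurable
  rw [Measure.map_snd_prod, eLpNorm_smul_measure_of_ne_top (by simp)] at h1
  simpa [Function.comp_def] using h1.symm

/-- Hölder on the product of two finite measures. The factor A + B stands for the energies at the
two times, α + β for the mean moduli. -/
theorem tendsto_eLpNorm_mul_add {ν : Measure ℝ} [IsFiniteMeasure ν] {A B : ℝ → ℝ} (hA : MemLp A 2 ν)
    (hB : MemLp B 2 ν) {α β : ℝ → ℝ → ℝ} (hα : ∀ h, 0 < h → AEStronglyMeasurable (α h) ν)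
    (hβ : ∀ h, 0 < h → AEStronglyMeasurable (β h) ν)
    (hα0 : Tendsto (fun h => eLpNorm (α h) 2 ν) (𝓝[>] 0) (𝓝 0))
    (hβ0 : Tendsto (fun h => eLpNorm (β h) 2 ν) (𝓝[>] 0) (𝓝 0)) :
    Tendsto (fun h => eLpNorm (fun p : ℝ × ℝ => (A p.1 + B p.2) * (α h p.1 + β h p.2)) 1
      (ν.prod ν)) (𝓝[>] 0) (𝓝 0) := by
  have hAB : MemLp (fun p : ℝ × ℝ => A p.1 + B p.2) 2 (ν.prod ν) :=
    (hA.comp_fst ν).add (hB.comp_snd ν)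
  have h1 : Tendsto (fun h => eLpNorm (fun p : ℝ × ℝ => A p.1 + B p.2) 2 (ν.prod ν) *
      (ν univ ^ (1 / 2 : ℝ) * eLpNorm (α h) 2 ν + ν univ ^ (1 / 2 : ℝ) * eLpNorm (β h) 2 ν))
      (𝓝[>] 0) (𝓝 0) := by
    have hν : ν univ ^ (1 / 2 : ℝ) ≠ ⊤ := by finiteness
    have := ENNReal.Tendsto.const_mul (a := eLpNorm (fun p : ℝ × ℝ => A p.1 + B p.2) 2 (ν.prod ν))
      ((ENNReal.Tendsto.const_mul hα0 (Or.inr hν)).add (ENNReal.Tendsto.const_mul hβ0 (Or.inr hν)))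
      (Or.inr hAB.2.ne)
    simpa using this
  refine tendsto_of_tendsto_of_tendsto_of_le_of_le' tendsto_const_nhds h1
    (Eventually.of_forall fun _ => zero_le) ?_
  filter_upwards [self_mem_nhdsWithin] with h hh
  have ma := hα h hh
  have mb := hβ h hh
  have m1 : AEStronglyMeasurable (fun p : ℝ × ℝ => α h p.1) (ν.prod ν) := ma.comp_fst
  have m2 : AEStronglyMeasurable (fun p : ℝ × ℝ => β h p.2) (ν.prod ν) := mb.comp_snd
  refine (eLpNorm_smul_le_mul_eLpNorm (p := 2) (q := 2) (r := 1) (m1.add m2) hAB.1).trans ?_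
  gcongr
  rw [← eLpNorm_comp_fst ma, ← eLpNorm_comp_snd mb]
  exact eLpNorm_add_le m1 m2 (by norm_num)

end DoublingLimit
end

noncomputable section

/-! ### The comparison principle -/

section Comparison

variable {N : ℕ} {s κ : ℝ} {φ : ℝ → ℝ} {ε : ℝ}

/-- The doubled entropy inequality for the regularized entropies. -/
theorem integral_primitive_mul_fderiv_nonneg (hN : 1 ≤ N) (hs0 : 0 < s) (hs1 : s < 1)
    (hκ : IsGagliardoFactor N s κ) (hφ : IsSingularNonlinearity φ) (hε : 0 < ε) (n : ℕ)
    {u gu v gv : ℝ → RN N → ℝ} (hu : IsWeakFlow s u gu) (hv : IsWeakFlow s v gv)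
    (hut : ∀ᵐ t ∂(volume.restrict (Ioi (0 : ℝ))),
      HasHalfFracLap s (fun x => φ (u t x)) (gu t) ∧ ∀ᵐ x, 0 < u t x)
    (hvτ : ∀ᵐ τ ∂(volume.restrict (Ioi (0 : ℝ))),
      HasHalfFracLap s (fun x => shiftedNonlinearity φ ε (v τ x)) (gv τ) ∧ ∀ᵐ x, 0 ≤ v τ x)
    {θ : ℝ × ℝ → ℝ} {a b : ℝ} (ha : 0 < a) (hab : a < b)
    (hθ : ContDiff ℝ 1 θ) (hθ0 : ∀ p, 0 ≤ θ p) (hθS : ∀ p ∉ Icc a b ×ˢ Icc a b, θ p = 0) :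
    0 ≤ ∫ p in Icc a b ×ˢ Icc a b,
      ((∫ x, leftPrimitive (fun r => φ (max r ε)) n (u p.1 x) (v p.2 x + ε)) *
          fderiv ℝ θ p (1, 0) +
        (∫ x, rightPrimitive (fun r => φ (max r ε)) n (u p.1 x) (v p.2 x + ε)) *
          fderiv ℝ θ p (0, 1)) := by
  have hmono := hφ.monotone_cutoff hε
  have hcont := hφ.continuous_cutoff hε
  -- The window (a / 2, b + 1) contains every interval [t - h, t] with t in [a, b] and h < a / 2.
  have hc : 0 < a / 2 := by linarith
  have hcd : a / 2 < b + 1 := by linarith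
  obtain ⟨Gu, hGum, hGu2, hGu⟩ := exists_measurable_representative (hu.memLp_prod hc hcd)
  obtain ⟨Gv, hGvm, hGv2, hGv⟩ := exists_measurable_representative (hv.memLp_prod hc hcd)
  set ν : Measure ℝ := volume.restrict (Icc a b) with hν
  have hνν : (volume : Measure (ℝ × ℝ)).restrict (Icc a b ×ˢ Icc a b) = ν.prod ν :=
    (Measure.prod_restrict _ _).symm
  have hA : ∀ {G : ℝ → RN N → ℝ}, MemLp (Function.uncurry G) 2 volume →
      MemLp (fun t => (eLpNorm (G t) 2 volume).toReal) 2 ν := fun {G} hG => by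
    have h := memLp_toReal_eLpNorm_slice (ν := volume) (G := Function.uncurry G) hG
    exact h.restrict _
  have hM : ∀ {G : ℝ → RN N → ℝ}, Measurable (Function.uncurry G) →
      MemLp (Function.uncurry G) 2 volume →
      Tendsto (fun h => eLpNorm (meanModulus G h) 2 ν) (𝓝[>] 0) (𝓝 0) := fun {G} hGm hG =>
    tendsto_of_tendsto_of_tendsto_of_le_of_le tendsto_const_nhds
      (tendsto_eLpNorm_meanModulus hGm hG) (fun _ => zero_le)
      fun h => eLpNorm_mono_measure _ Measure.restrict_le_self
  have hlim := tendsto_eLpNorm_mul_add (hA hGu2) (hA hGv2)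
    (fun h hh => (measurable_meanModulus hGum hh).aestronglyMeasurable)
    (fun h hh => (measurable_meanModulus hGvm hh).aestronglyMeasurable) (hM hGum hGu2)
    (hM hGvm hGv2)
  refine integral_mul_fderiv_nonneg ha
    (continuousOn_integral_of_le_max hε (continuous_leftPrimitive hcont n)
      (leftPrimitive_nonneg hmono n) (leftPrimitive_le hmono n)
      hu.continuousInL1 hv.continuousInL1)
    (continuousOn_integral_of_le_max hε (continuous_rightPrimitive hcont n)
      (rightPrimitive_nonneg hmono n) (rightPrimitive_le hmono n)
      hu.continuousInL1 hv.continuousInL1) hθ hθ0 hθS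
    (R := fun h p => ((n : ℝ) + 1) * (((eLpNorm (Gu p.1) 2 volume).toReal +
      (eLpNorm (Gv p.2) 2 volume).toReal) * (meanModulus Gu h p.1 + meanModulus Gv h p.2)))
    ?_ ?_ ?_
  · filter_upwards [Ioo_mem_nhdsGT hc] with h hh
    have hh0 : 0 < h := hh.1
    have hsub : Icc a b ⊆ Ioo (a / 2) (b + 1) := fun t ht =>
      ⟨by linarith [ht.1], by linarith [ht.2]⟩
    have hsub' : Icc a b ⊆ Ioi 0 := fun t ht => ha.trans_le ht.1
    have p1 : ∀ᵐ t ∂ν, (HasHalfFracLap s (fun x => φ (u t x)) (gu t) ∧ ∀ᵐ x, 0 < u t x) ∧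
        gu t =ᵐ[volume] Gu t ∧ t ∈ Icc a b := by
      filter_upwards [ae_restrict_of_ae_restrict_of_subset hsub' hut,
        ae_restrict_of_ae_restrict_of_subset hsub hGu, ae_restrict_mem measurableSet_Icc]
        with t h1 h2 h3 using ⟨h1, h2, h3⟩
    have p2 : ∀ᵐ τ ∂ν, (HasHalfFracLap s (fun x => shiftedNonlinearity φ ε (v τ x)) (gv τ) ∧
        ∀ᵐ x, 0 ≤ v τ x) ∧ gv τ =ᵐ[volume] Gv τ ∧ τ ∈ Icc a b := by
      filter_upwards [ae_restrict_of_ae_restrict_of_subset hsub' hvτ,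
        ae_restrict_of_ae_restrict_of_subset hsub hGv, ae_restrict_mem measurableSet_Icc]
        with t h1 h2 h3 using ⟨h1, h2, h3⟩
    rw [hνν]
    filter_upwards [Measure.quasiMeasurePreserving_fst.ae p1,
      Measure.quasiMeasurePreserving_snd.ae p2] with p hp1 hp2
    obtain ⟨⟨q1, q2⟩, q3, q4⟩ := hp1
    obtain ⟨⟨r1, r2⟩, r3, r4⟩ := hp2
    have key := doubling_increment_le hN hs0 hs1 hκ hφ hε n hu hv hh0
      (show h < p.1 by linarith [hh.2, q4.1]) (show h < p.2 by linarith [hh.2, r4.1]) q1 r1 q2 r2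
    have m1 : ∀ (g : ℝ → RN N → ℝ) (t : ℝ),
        ∫ r in (t - h)..t, (eLpNorm (fun x => g r x - g t x) 2 volume).toReal =
          h * meanModulus g h t := fun g t => by
      rw [meanModulus, mul_inv_cancel_left₀ hh0.ne']
    rw [m1, m1, meanModulus_congr hGu hh0 (by linarith [hh.2, q4.1]) (by linarith [q4.2]) q3,
      meanModulus_congr hGv hh0 (by linarith [hh.2, r4.1]) (by linarith [r4.2]) r3,
      eLpNorm_congr_ae q3, eLpNorm_congr_ae r3] at key
    simp only [Prod.fst_sub, Prod.snd_sub, sub_zero]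
    refine key.trans (le_of_eq ?_)
    ring
  · filter_upwards [self_mem_nhdsWithin] with h hh
    rw [hνν]
    have hh0 : 0 < h := hh
    exact (((hA hGu2).1.comp_fst.add (hA hGv2).1.comp_snd).mul
      ((measurable_meanModulus hGum hh0).aestronglyMeasurable.comp_fst.add
        (measurable_meanModulus hGvm hh0).aestronglyMeasurable.comp_snd)).const_mul _
  · rw [hνν]
    have h2 := ENNReal.Tendsto.const_mul (a := ‖(n : ℝ) + 1‖ₑ) hlim (Or.inr (by simp))
    rw [mul_zero] at h2
    refine h2.congr fun h => ?_
    exact (eLpNorm_const_smul ((n : ℝ) + 1) _ 1 (ν.prod ν)).symm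

/-- The doubled Kato inequality for the positive part of the difference of two solutions. -/
theorem integral_positivePart_mul_fderiv_nonneg (hN : 1 ≤ N) (hs0 : 0 < s) (hs1 : s < 1)
    (hφ : IsSingularNonlinearity φ) (hε : 0 < ε)
    {u gu v gv : ℝ → RN N → ℝ} (hu : IsWeakFlow s u gu) (hv : IsWeakFlow s v gv)
    (hut : ∀ᵐ t ∂(volume.restrict (Ioi (0 : ℝ))),
      HasHalfFracLap s (fun x => φ (u t x)) (gu t) ∧ ∀ᵐ x, 0 < u t x)
    (hvτ : ∀ᵐ τ ∂(volume.restrict (Ioi (0 : ℝ))),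
      HasHalfFracLap s (fun x => shiftedNonlinearity φ ε (v τ x)) (gv τ))
    (hvnn : ∀ τ, 0 < τ → ∀ᵐ x, 0 ≤ v τ x)
    {θ : ℝ × ℝ → ℝ} {a b : ℝ} (ha : 0 < a) (hab : a < b)
    (hθ : ContDiff ℝ 1 θ) (hθ0 : ∀ p, 0 ≤ θ p) (hθS : ∀ p ∉ Icc a b ×ˢ Icc a b, θ p = 0) :
    0 ≤ ∫ p in Icc a b ×ˢ Icc a b,
      (∫ x, max 0 (u p.1 x - (v p.2 x + ε))) * fderiv ℝ θ p (1, 1) := by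
  obtain ⟨κ, hκ⟩ := exists_integral_fracLap_mul_eq hN hs0 hs1
  have hmono := hφ.monotone_cutoff hε
  have hcont := hφ.continuous_cutoff hε
  have hvτ' : ∀ᵐ τ ∂(volume.restrict (Ioi (0 : ℝ))),
      HasHalfFracLap s (fun x => shiftedNonlinearity φ ε (v τ x)) (gv τ) ∧ ∀ᵐ x, 0 ≤ v τ x := by
    filter_upwards [hvτ, ae_restrict_mem measurableSet_Ioi] with τ h1 h2 using ⟨h1, hvnn τ h2⟩
  set S : Set (ℝ × ℝ) := Icc a b ×ˢ Icc a b with hS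
  have hSc : IsCompact S := isCompact_Icc.prod isCompact_Icc
  have hSpos : S ⊆ Ioi 0 ×ˢ Ioi 0 := fun p hp => ⟨ha.trans_le hp.1.1, ha.trans_le hp.2.1⟩
  have hfc : Continuous (fderiv ℝ θ) := hθ.continuous_fderiv one_ne_zero
  have hFc : ∀ {L : ℝ → ℝ → ℝ}, (Continuous fun p : ℝ × ℝ => L p.1 p.2) → (∀ U c, 0 ≤ L U c) →
      (∀ U c, L U c ≤ max 0 (U - c)) →
      ContinuousOn (fun p : ℝ × ℝ => ∫ x, L (u p.1 x) (v p.2 x + ε)) S := fun h0 h1 h2 =>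
    (continuousOn_integral_of_le_max hε h0 h1 h2 hu.continuousInL1 hv.continuousInL1).mono hSpos
  have hF := hFc (L := fun U c => max 0 (U - c)) (by fun_prop) (fun _ _ => le_max_left _ _)
    (fun _ _ => le_rfl)
  have hJ := fun n => hFc (continuous_leftPrimitive hcont n) (leftPrimitive_nonneg hmono n)
    (leftPrimitive_le hmono n)
  have hK := fun n => hFc (continuous_rightPrimitive hcont n) (rightPrimitive_nonneg hmono n)
    (rightPrimitive_le hmono n)
  have hle : ∀ {L : ℝ → ℝ → ℝ}, (Continuous fun p : ℝ × ℝ => L p.1 p.2) → (∀ U c, 0 ≤ L U c) →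
      (∀ U c, L U c ≤ max 0 (U - c)) → ∀ p ∈ S, ‖∫ x, L (u p.1 x) (v p.2 x + ε)‖ ≤
        ∫ x, max 0 (u p.1 x - (v p.2 x + ε)) := by
    intro L h0 h1 h2 p hp
    have i1 := hu.continuousInL1.1 p.1 (hSpos hp).1
    have i2 := hv.continuousInL1.1 p.2 (hSpos hp).2
    rw [Real.norm_of_nonneg (integral_nonneg fun x => h1 _ _)]
    exact integral_mono (integrable_of_le_max i1 i2 hε h0 h1 h2)
      (integrable_of_le_max i1 i2 hε (L := fun U c => max 0 (U - c)) (by fun_prop)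
        (fun _ _ => le_max_left _ _) (fun _ _ => le_rfl)) fun x => h2 _ _
  -- Convergence is required only for c ≥ ε, where the flattened φ is strictly increasing. This
  -- suffices because v ≥ 0 almost everywhere.
  have hpt : ∀ {L : ℕ → ℝ → ℝ → ℝ}, (∀ n, Continuous fun p : ℝ × ℝ => L n p.1 p.2) →
      (∀ n U c, 0 ≤ L n U c) → (∀ n U c, L n U c ≤ max 0 (U - c)) →
      (∀ U c, ε ≤ c → Tendsto (fun n => L n U c) atTop (𝓝 (max 0 (U - c)))) → ∀ p ∈ S,
      Tendsto (fun n => ∫ x, L n (u p.1 x) (v p.2 x + ε)) atTop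
        (𝓝 (∫ x, max 0 (u p.1 x - (v p.2 x + ε)))) := by
    intro L h0 h1 h2 h3 p hp
    have i1 := hu.continuousInL1.1 p.1 (hSpos hp).1
    have i2 := hv.continuousInL1.1 p.2 (hSpos hp).2
    refine tendsto_integral_of_dominated_convergence
      (fun x => max 0 (u p.1 x - (v p.2 x + ε)))
      (fun n => (integrable_of_le_max i1 i2 hε (h0 n) (h1 n) (h2 n)).aestronglyMeasurable)
      (integrable_of_le_max i1 i2 hε (L := fun U c => max 0 (U - c)) (by fun_prop)
        (fun _ _ => le_max_left _ _) (fun _ _ => le_rfl))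
      (fun n => Eventually.of_forall fun x => ?_) ?_
    · rw [Real.norm_of_nonneg (h1 n _ _)]
      exact h2 n _ _
    · filter_upwards [hvnn p.2 (hSpos hp).2] with x hx
      exact h3 _ _ (by linarith)
  have hlim : Tendsto (fun n => ∫ p in S,
      ((∫ x, leftPrimitive (fun r => φ (max r ε)) n (u p.1 x) (v p.2 x + ε)) *
          fderiv ℝ θ p (1, 0) +
        (∫ x, rightPrimitive (fun r => φ (max r ε)) n (u p.1 x) (v p.2 x + ε)) *
          fderiv ℝ θ p (0, 1))) atTop
      (𝓝 (∫ p in S, (∫ x, max 0 (u p.1 x - (v p.2 x + ε))) * fderiv ℝ θ p (1, 1))) := by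
    refine tendsto_integral_of_dominated_convergence
      (fun p => (∫ x, max 0 (u p.1 x - (v p.2 x + ε))) *
        (‖fderiv ℝ θ p (1, 0)‖ + ‖fderiv ℝ θ p (0, 1)‖)) (fun n => ?_) ?_ (fun n => ?_) ?_
    · refine ContinuousOn.aestronglyMeasurable ?_ hSc.measurableSet
      exact ((hJ n).mul (Continuous.continuousOn (by fun_prop))).add
        ((hK n).mul (Continuous.continuousOn (by fun_prop)))
    · exact (hF.mul (Continuous.continuousOn (by fun_prop))).integrableOn_compact hSc
    · filter_upwards [ae_restrict_mem hSc.measurableSet] with p hp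
      refine (norm_add_le _ _).trans ?_
      rw [norm_mul, norm_mul, mul_add]
      exact add_le_add
        (mul_le_mul_of_nonneg_right (hle (continuous_leftPrimitive hcont n)
          (leftPrimitive_nonneg hmono n) (leftPrimitive_le hmono n) p hp) (norm_nonneg _))
        (mul_le_mul_of_nonneg_right (hle (continuous_rightPrimitive hcont n)
          (rightPrimitive_nonneg hmono n) (rightPrimitive_le hmono n) p hp) (norm_nonneg _))
    · filter_upwards [ae_restrict_mem hSc.measurableSet] with p hp
      have e : fderiv ℝ θ p (1, 1) = fderiv ℝ θ p (1, 0) + fderiv ℝ θ p (0, 1) := by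
        rw [← map_add]; simp
      rw [e, mul_add]
      exact ((hpt (fun n => continuous_leftPrimitive hcont n)
          (fun n => leftPrimitive_nonneg hmono n) (fun n => leftPrimitive_le hmono n)
          (fun U c hc => tendsto_leftPrimitive hmono hcont (hφ.strictMonoOn_cutoff hε hc)) p
          hp).mul_const _).add
        ((hpt (fun n => continuous_rightPrimitive hcont n)
          (fun n => rightPrimitive_nonneg hmono n) (fun n => rightPrimitive_le hmono n)
          (fun U c hc => tendsto_rightPrimitive hmono hcont (hφ.strictMonoOn_cutoff hε hc)) p
          hp).mul_const _)
  exact ge_of_tendsto' hlim fun n => integral_primitive_mul_fderiv_nonneg hN hs0 hs1 hκ hφ hε n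
    hu hv hut hvτ' ha hab hθ hθ0 hθS

/-- A function of two times with `(∂₁ + ∂₂) F ≤ 0` is nonincreasing on the diagonal. -/
theorem diagonal_le_of_integral_nonneg {F : ℝ × ℝ → ℝ} (hF : ContinuousOn F (Ioi 0 ×ˢ Ioi 0))
    (h : ∀ (θ : ℝ × ℝ → ℝ) (a b : ℝ), 0 < a → a < b → ContDiff ℝ 1 θ → (∀ p, 0 ≤ θ p) →
      (∀ p ∉ Icc a b ×ˢ Icc a b, θ p = 0) →
      0 ≤ ∫ p in Icc a b ×ˢ Icc a b, F p * fderiv ℝ θ p (1, 1))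
    {t₁ t₂ : ℝ} (h₁ : 0 < t₁) (h₁₂ : t₁ < t₂) : F (t₂, t₂) ≤ F (t₁, t₁) := by
  set S : Set (ℝ × ℝ) := Icc t₁ (t₂ + 2) ×ˢ Icc t₁ (t₂ + 2) with hS
  have hSc : IsCompact S := isCompact_Icc.prod isCompact_Icc
  have hSpos : S ⊆ Ioi 0 ×ˢ Ioi 0 := fun p hp => ⟨h₁.trans_le hp.1.1, h₁.trans_le hp.2.1⟩
  have hFm : AEStronglyMeasurable F (volume.restrict S) :=
    (hF.mono hSpos).aestronglyMeasurable hSc.measurableSet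
  have hk1 : ∀ k : ℕ, 1 / ((k : ℝ) + 1) ≤ 1 := fun k => by
    rw [div_le_one (by positivity)]
    linarith [Nat.cast_nonneg (α := ℝ) k]
  have hpc : ∀ k a, Continuous (smoothPeak k a) := fun k a => (contDiff_smoothPeak k a).continuous
  -- Unit masses concentrating at (t₀, t₀). The second factor is constant along the diagonal
  -- direction. Each peak has width at most 1, whence the bound t₂ + 2 in S.
  set w : ℝ → ℕ → ℝ × ℝ → ℝ := fun t₀ k p => smoothPeak k t₀ p.1 * smoothPeak k 0 (p.2 - p.1)
    with hw
  have hwc : ∀ t₀ k, Continuous (w t₀ k) := fun t₀ k => by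
    have h1 := hpc k t₀
    have h2 := hpc k 0
    exact (h1.comp continuous_fst).mul (h2.comp (continuous_snd.sub continuous_fst))
  have hwS : ∀ t₀ ∈ Icc t₁ t₂, ∀ k, ∀ p ∉ S, w t₀ k p = 0 := by
    intro t₀ ht₀ k p hp
    by_contra hne
    have m1 := mem_Icc_of_smoothPeak_ne_zero (left_ne_zero_of_mul hne)
    have m2 := mem_Icc_of_smoothPeak_ne_zero (right_ne_zero_of_mul hne)
    have := hk1 k
    exact hp ⟨⟨by linarith [m1.1, ht₀.1], by linarith [m1.2, ht₀.2]⟩,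
      ⟨by linarith [m1.1, m2.1, ht₀.1], by linarith [m1.2, m2.2, ht₀.2]⟩⟩
  have hwi : ∀ t₀ ∈ Icc t₁ t₂, ∀ k, Integrable (w t₀ k) := fun t₀ ht₀ k =>
    (hwc t₀ k).integrable_of_hasCompactSupport (HasCompactSupport.intro hSc (hwS t₀ ht₀ k))
  have hw1 : ∀ t₀ ∈ Icc t₁ t₂, ∀ k, ∫ p in S, w t₀ k p = 1 := by
    intro t₀ ht₀ k
    rw [setIntegral_eq_integral_of_forall_compl_eq_zero (hwS t₀ ht₀ k)]
    have e := integral_prod (μ := (volume : Measure ℝ)) (ν := (volume : Measure ℝ)) (w t₀ k)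
      (hwi t₀ ht₀ k)
    refine e.trans ?_
    simp only [hw]
    simp_rw [integral_const_mul, integral_sub_right_eq_self (fun τ => smoothPeak k 0 τ),
      integral_smoothPeak, mul_one]
    exact integral_smoothPeak k t₀
  have hconv : ∀ t₀ ∈ Icc t₁ t₂, Tendsto (fun k => ∫ p in S, w t₀ k p * F p) atTop
      (𝓝 (F (t₀, t₀))) := by
    intro t₀ ht₀
    have ht₀' : 0 < t₀ := h₁.trans_le ht₀.1
    refine tendsto_integral_weight
      (fun k p => mul_nonneg (smoothPeak_nonneg _ _ _) (smoothPeak_nonneg _ _ _))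
      (fun k => (hwi t₀ ht₀ k).integrableOn) (hw1 t₀ ht₀) ?_
      (hF.continuousAt ((isOpen_Ioi.prod isOpen_Ioi).mem_nhds ⟨ht₀', ht₀'⟩))
      (fun k => (hwc t₀ k).aestronglyMeasurable.mul hFm)
    intro δ hδ
    filter_upwards [eventually_dist_lt_of_smoothPeak_ne_zero t₀ (half_pos hδ),
      eventually_dist_lt_of_smoothPeak_ne_zero 0 (half_pos hδ)] with k k1 k2 p hp
    have d1 := k1 _ (left_ne_zero_of_mul hp)
    have d2 := k2 _ (right_ne_zero_of_mul hp)
    rw [Real.dist_eq, abs_lt] at d1 d2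
    rw [Prod.dist_eq, max_lt_iff, Real.dist_eq, Real.dist_eq, abs_lt, abs_lt]
    refine ⟨⟨?_, ?_⟩, ?_, ?_⟩ <;> simp only <;> linarith [d1.1, d1.2, d2.1, d2.2]
  have m1 : t₁ ∈ Icc t₁ t₂ := ⟨le_rfl, h₁₂.le⟩
  have m2 : t₂ ∈ Icc t₁ t₂ := ⟨h₁₂.le, le_rfl⟩
  have hFw : ∀ t₀ k, IntegrableOn (fun p => w t₀ k p * F p) S := fun t₀ k =>
    ((hwc t₀ k).continuousOn.mul (hF.mono hSpos)).integrableOn_compact hSc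
  refine le_of_tendsto_of_tendsto' (hconv t₂ m2) (hconv t₁ m1) fun k => ?_
  rw [← sub_nonneg, ← integral_sub (hFw t₁ k) (hFw t₂ k)]
  have hst : ∀ a, ContDiff ℝ 1 (smoothStep k a) := fun a => (contDiff_smoothStep k a).of_le (by simp)
  have hpk : ContDiff ℝ 1 (smoothPeak k 0) := (contDiff_smoothPeak k 0).of_le (by simp)
  -- Differentiation along (1, 1) acts only on the steps and yields the weight at t₁ minus the
  -- weight at t₂. The order t₁ < t₂ makes θ nonnegative.
  set θ : ℝ × ℝ → ℝ := fun p =>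
    (smoothStep k t₁ p.1 - smoothStep k t₂ p.1) * smoothPeak k 0 (p.2 - p.1) with hθ
  have hθd : ContDiff ℝ 1 θ :=
    (((hst t₁).comp contDiff_fst).sub ((hst t₂).comp contDiff_fst)).mul
      (hpk.comp (contDiff_snd.sub contDiff_fst))
  have hder : ∀ p, fderiv ℝ θ p (1, 1) = w t₁ k p - w t₂ k p := by
    intro p
    have d1 : HasLineDerivAt ℝ θ (fderiv ℝ θ p (1, 1)) p (1, 1) :=
      ((hθd.differentiable one_ne_zero p).hasFDerivAt).hasLineDerivAt _
    have d2 : HasLineDerivAt ℝ θ (w t₁ k p - w t₂ k p) p (1, 1) := by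
      have hs : ∀ a, HasDerivAt (fun r : ℝ => smoothStep k a (p.1 + r)) (smoothPeak k a p.1) 0 := by
        intro a
        have := (hasDerivAt_smoothStep k a (p.1 + 0)).comp_const_add p.1 0
        rwa [add_zero] at this
      have hm := ((hs t₁).sub (hs t₂)).mul_const (smoothPeak k 0 (p.2 - p.1))
      have e1 : (fun r : ℝ => θ (p + r • ((1 : ℝ), (1 : ℝ)))) = fun r =>
          (smoothStep k t₁ (p.1 + r) - smoothStep k t₂ (p.1 + r)) * smoothPeak k 0 (p.2 - p.1) := by
        ext r
        simp [hθ]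
      rw [HasLineDerivAt, e1, hw, ← sub_mul]
      exact hm
    exact d1.unique d2
  have := h θ t₁ (t₂ + 2) h₁ (by linarith) hθd
    (fun p => mul_nonneg (sub_nonneg.2 (smoothStep_anti k h₁₂.le _)) (smoothPeak_nonneg _ _ _)) ?_
  · refine this.trans (le_of_eq (integral_congr_ae (Eventually.of_forall fun p => ?_)))
    simp only
    rw [hder]
    ring
  · intro p hp
    by_contra hne
    have n1 := left_ne_zero_of_mul hne
    have n2 := mem_Icc_of_smoothPeak_ne_zero (right_ne_zero_of_mul hne)
    have hk := hk1 k
    have l1 : t₁ ≤ p.1 := by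
      by_contra hlt
      rw [not_le] at hlt
      exact n1 (by rw [smoothStep_of_le k hlt.le, smoothStep_of_le k (by linarith), sub_zero])
    have l2 : p.1 ≤ t₂ + 1 := by
      by_contra hlt
      rw [not_le] at hlt
      exact n1 (by rw [smoothStep_of_ge k (by linarith), smoothStep_of_ge k (by linarith),
        sub_self])
    exact hp ⟨⟨l1, by linarith⟩, by linarith [n2.1], by linarith [n2.2]⟩

/-- Comparison at a fixed time. -/
theorem ae_le_of_initial_datum (hN : 1 ≤ N) (hs0 : 0 < s) (hs1 : s < 1)
    (hφ : IsSingularNonlinearity φ) (hε : 0 < ε) {u₀ : RN N → ℝ} (hu₀ : Integrable u₀)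
    {u v : ℝ → RN N → ℝ} (hu : IsWeakEnergySolution s φ u) (hui : HasInitialDatum u u₀)
    (hv : IsShiftedWeakSolution s φ ε u₀ v) {t : ℝ} (ht : 0 < t) : ∀ᵐ x, u t x ≤ v t x + ε := by
  obtain ⟨gu, hgu, hgu2, hguw⟩ := hu.weakForm
  obtain ⟨gv, hgv, hgv2, hgvw⟩ := hv.weakForm
  have hvc : ContinuousInL1 (Ioi 0) v :=
    ⟨fun r hr => hv.continuousInL1.1 r (Ioi_subset_Ici_self hr), fun r hr =>
      (hv.continuousInL1.2 r (Ioi_subset_Ici_self hr)).mono_left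
        (nhdsWithin_mono _ Ioi_subset_Ici_self)⟩
  have fu : IsWeakFlow s u gu := ⟨hu.continuousInL1, hgu2, hguw⟩
  have fv : IsWeakFlow s v gv := ⟨hvc, hgv2, hgvw⟩
  have hut := hgu.and hu.finite
  set F : ℝ × ℝ → ℝ := fun p => ∫ x, max 0 (u p.1 x - (v p.2 x + ε)) with hF
  have hFc : ContinuousOn F (Ioi 0 ×ˢ Ioi 0) :=
    continuousOn_integral_of_le_max hε (L := fun U c => max 0 (U - c)) (by fun_prop)
      (fun _ _ => le_max_left _ _) (fun _ _ => le_rfl) hu.continuousInL1 hvc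
  have hmono : ∀ r, 0 < r → r < t → F (t, t) ≤ F (r, r) := fun r hr hrt =>
    diagonal_le_of_integral_nonneg hFc (fun θ a b ha hab hθ hθ0 hθS =>
      integral_positivePart_mul_fderiv_nonneg hN hs0 hs1 hφ hε fu fv hut hgv
        (fun τ hτ => hv.nonneg τ hτ.le) ha hab hθ hθ0 hθS) hr hrt
  have hi : ∀ r, 0 < r → Integrable fun x => max 0 (u r x - (v r x + ε)) := fun r hr =>
    integrable_of_le_max (hu.continuousInL1.1 r hr) (hvc.1 r hr) hε
      (L := fun U c => max 0 (U - c)) (by fun_prop) (fun _ _ => le_max_left _ _)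
      (fun _ _ => le_rfl)
  have hv0 : Tendsto (fun r => eLpNorm (v r - v 0) 1 volume) (𝓝[>] 0) (𝓝 0) :=
    (hv.continuousInL1.2 0 self_mem_Ici).mono_left (nhdsWithin_mono _ Ioi_subset_Ici_self)
  have hlim := ((ENNReal.tendsto_toReal ENNReal.zero_ne_top).comp hui).add
    ((ENNReal.tendsto_toReal ENNReal.zero_ne_top).comp hv0)
  simp only [ENNReal.toReal_zero, add_zero] at hlim
  -- F(t, t) ≤ F(r, r) for 0 < r < t, and the L¹ distances of u(r) and v(r) to the common datum
  -- bound F(r, r); then r → 0.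
  have hzero : F (t, t) ≤ 0 := by
    refine ge_of_tendsto hlim ?_
    filter_upwards [Ioo_mem_nhdsGT ht] with r hr
    have iu := (hu.continuousInL1.1 r hr.1).sub hu₀
    have iv := (hvc.1 r hr.1).sub (hv.continuousInL1.1 0 self_mem_Ici)
    refine (hmono r hr.1 hr.2).trans ?_
    simp only [Function.comp_apply]
    rw [toReal_eLpNorm_one iu, toReal_eLpNorm_one iv, ← integral_add iu.norm iv.norm]
    refine integral_mono_ae (hi r hr.1) (iu.norm.add iv.norm) ?_
    filter_upwards [hv.initial] with x hx
    simp only [Pi.sub_apply, Real.norm_eq_abs, hx]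
    refine (max_zero_sub_le _ _ hε).trans ?_
    have : u r x - v r x = (u r x - u₀ x) - (v r x - u₀ x) := by ring
    rw [this]
    exact abs_sub _ _
  have hz : F (t, t) = 0 := le_antisymm hzero (integral_nonneg fun x => le_max_left _ _)
  have hae := (integral_eq_zero_iff_of_nonneg (fun x => le_max_left _ _) (hi t ht)).1 hz
  filter_upwards [hae] with x hx
  have h1 : max 0 (u t x - (v t x + ε)) = 0 := hx
  linarith [le_max_right 0 (u t x - (v t x + ε))]

end Comparison
end

/-! ### From fixed times to space-time -/

theorem theorem7p1 (N : ℕ) (hN : 1 ≤ N) (s : ℝ) (hs0 : 0 < s) (hs1 : s < 1)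
    (φ : ℝ → ℝ) (hφ : IsSingularNonlinearity φ)
    (u₀ : RN N → ℝ) (hu₀ : Integrable u₀ volume) (hu₀_nonneg : ∀ᵐ x, 0 ≤ u₀ x)
    (u : ℝ → RN N → ℝ) (hu : IsStrongSolution s φ u) (hu_init : HasInitialDatum u u₀)
    (ε : ℝ) (hε : 0 < ε)
    (uε : ℝ → RN N → ℝ) (huε : IsApproximateSolution s φ ε u₀ uε) :
    ∀ᵐ p ∂(volume.restrict (spaceTime N)), u p.1 p.2 ≤ uε p.1 p.2 := by
  obtain ⟨v, hv, hvε⟩ := huε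
  have hmu := hu.measurable
  have hmv := hv.measurable
  rw [spaceTime, volume_restrict_prod_univ] at hmu hmv ⊢
  simp_rw [hvε]
  -- Measurable representatives make the exceptional set measurable, so Fubini lifts the comparison
  -- at each fixed time to almost every point of space-time.
  have hae : ∀ᵐ p ∂((volume.restrict (Ioi 0)).prod (volume : Measure (RN N))),
      hmu.mk _ p ≤ hmv.mk _ p + ε := by
    refine (Measure.ae_prod_iff_ae_ae (measurableSet_le hmu.stronglyMeasurable_mk.measurable
      (hmv.stronglyMeasurable_mk.measurable.add_const ε))).2 ?_
    filter_upwards [ae_restrict_mem measurableSet_Ioi, Measure.ae_ae_of_ae_prod hmu.ae_eq_mk,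
      Measure.ae_ae_of_ae_prod hmv.ae_eq_mk] with t ht h1 h2
    filter_upwards [h1, h2, ae_le_of_initial_datum hN hs0 hs1 hφ hε hu₀
      hu.toIsWeakEnergySolution hu_init hv ht] with x hx1 hx2 hx
    rw [← hx1, ← hx2]
    exact hx
  filter_upwards [hae, hmu.ae_eq_mk, hmv.ae_eq_mk] with p hp h1 h2
  rw [← h1, ← h2] at hp
  exact hp
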